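/- Let $n\ge 0$ and let $M$ be an orientable smooth ($C^\infty$, Hausdorff, second countable, without boundary) manifold of dimension $2n+1$; put $W=M\times\mathbb{R}$. All tensor fields, metrics and connections below are smooth, and connections may have torsion. For a smooth manifold $N$, we say that \emph{the gauge equation of dual connections on $N$ admits a skew-symmetric solution of rank $r$} if there are a Riemannian metric $g$ on $N$, affine connections $\nabla,\nabla^*$ on $N$ that are dual with respect to $g$, that is, $$Z\big(g(X,Y)\big)=g(\nabla_ZX,Y)+g(X,\nabla^*_ZY)\quad\text{for all vector fields }X,Y,Z,$$ and a $(1,1)$-tensor field $\theta$ on $N$, skew-symmetric with respect to $g$ ($g(\theta X,Y)=-g(X,\theta Y)$) and of rank $r$ at every point, such that $$\nabla^*_X(\theta Y)=\theta(\nabla_XY)\quad\text{for all vector fields }X,Y.$$ The following assertions are equivalent: \begin{enumerate} \item the gauge equation of dual connections on $M$ admits a skew-symmetric solution of rank $2n$; \item $M$ admits an almost cosymplectic structure, i.e. a $2$-form $\omega$ and a $1$-form $\eta$ such that $\omega^n\wedge\eta$ vanishes nowhere; \item $M$ admits an almost contact structure, i.e. a $(1,1)$-tensor field $\varphi$, a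 vector field $\xi$ and a $1$-form $\eta$ with $\eta(\xi)=1$ and $\varphi^2=-\mathrm{Id}+\eta\otimes\xi$; \item $W$ admits an almost symplectic structure, i.e. a non-degenerate $2$-form; \item the gauge equation of dual connections on $W$ admits a skew-symmetric solution of rank $2n+2$. \end{enumerate} -/

import Mathlib

open scoped Manifold ContDiff Bundle

noncomputable section

/-! ### Linear algebra: wedge products of alternating forms on a real vector space -/

section Linear

variable {V : Type*} [AddCommGroup V] [Module ℝ V]

/-- The wedge product `a ∧ b` of a `k`-form and an `l`-form: the sum over shuffles
of `sign · a ⊗ b`, followed by multiplication of real numbers. -/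
def wedge {k l : ℕ} (a : V [⋀^Fin k]→ₗ[ℝ] ℝ) (b : V [⋀^Fin l]→ₗ[ℝ] ℝ) :
    V [⋀^Fin (k + l)]→ₗ[ℝ] ℝ :=
  ((LinearMap.mul' ℝ ℝ).compAlternatingMap (a.domCoprod b)).domDomCongr finSumFinEquiv

/-- The wedge power `w ∧ ⋯ ∧ w` (`n` factors) of a two-form; it has degree `2 n`. -/
def wedgePow (w : V [⋀^Fin 2]→ₗ[ℝ] ℝ) : (n : ℕ) → V [⋀^Fin (2 * n)]→ₗ[ℝ] ℝ
  | 0 => AlternatingMap.constOfIsEmpty ℝ V (Fin 0) 1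
  | n + 1 => wedge (wedgePow w n) w

/-- A linear functional, seen as an alternating form of degree `1`. -/
def oneFormAlt (η : V →ₗ[ℝ] ℝ) : V [⋀^Fin 1]→ₗ[ℝ] ℝ :=
  AlternatingMap.ofSubsingleton ℝ V ℝ (0 : Fin 1) η

/-- An alternating bilinear form, seen as an alternating form of degree `2`. -/
def twoFormAlt (B : V →ₗ[ℝ] V →ₗ[ℝ] ℝ) (h : ∀ v, B v v = 0) : V [⋀^Fin 2]→ₗ[ℝ] ℝ where
  toFun v := B (v 0) (v 1)
  map_update_add' := by
    intro inst v i x y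
    rw [Subsingleton.elim inst (instDecidableEqFin 2)]
    fin_cases i <;> simp
  map_update_smul' := by
    intro inst v i c x
    rw [Subsingleton.elim inst (instDecidableEqFin 2)]
    fin_cases i <;> simp
  map_eq_zero_of_eq' := by
    intro v i j hij hne
    fin_cases i <;> fin_cases j <;> simp_all

end Linear

/-! ### Tensor fields and connections -/

section Tensors

variable {E : Type*} [NormedAddCommGroup E] [NormedSpace ℝ E]
  {H : Type*} [TopologicalSpace H] (I : ModelWithCorners ℝ E H)
  (M : Type*) [TopologicalSpace M] [ChartedSpace H M] [IsManifold I ∞ M]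

/-- Smooth vector fields on `M`. -/
abbrev SmoothVectorField : Type _ :=
  Cₛ^∞⟮I; E, fun x : M ↦ TangentSpace I x⟯

/-- Smooth tensor fields of type `(1,1)` on `M`, i.e. smooth fields of endomorphisms of `TM`. -/
abbrev SmoothEndomorphismField : Type _ :=
  Cₛ^∞⟮I; E →L[ℝ] E, fun x : M ↦ (TangentSpace I x →L[ℝ] TangentSpace I x)⟯

/-- Smooth one-forms on `M`. -/
abbrev SmoothOneForm : Type _ :=
  Cₛ^∞⟮I; E →L[ℝ] ℝ, fun x : M ↦ (TangentSpace I x →L[ℝ] ℝ)⟯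

/-- Smooth two-forms on `M`. -/
structure SmoothTwoForm where
  /-- The value at a point, as a bilinear form on the tangent space. -/
  toSection : Cₛ^∞⟮I; E →L[ℝ] E →L[ℝ] ℝ,
    fun x : M ↦ (TangentSpace I x →L[ℝ] TangentSpace I x →L[ℝ] ℝ)⟯
  alternating : ∀ (x : M) (v : TangentSpace I x), toSection x v v = 0

/-- Smooth Riemannian metrics on `M`. -/
abbrev SmoothMetric : Type _ :=
  Bundle.ContMDiffRiemannianMetric I ∞ E (fun x : M ↦ TangentSpace I x)

/-- Affine connections on `M`, i.e. covariant derivatives on `TM`. For a connection `D`,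
`D Y x (X x)` is `(∇_X Y)(x)`. No condition on the torsion is imposed. -/
abbrev AffineConnection : Type _ :=
  CovariantDerivative I E (fun x : M ↦ TangentSpace I x)

variable {I M}

/-- A two-form at a point, as an alternating form of degree `2` on the tangent space. -/
def SmoothTwoForm.altAt (w : SmoothTwoForm I M) (x : M) :
    (TangentSpace I x) [⋀^Fin 2]→ₗ[ℝ] ℝ :=
  twoFormAlt ((ContinuousLinearMap.coeLM ℝ).comp (w.toSection x).toLinearMap) (w.alternating x)

/-- A one-form at a point, as an alternating form of degree `1` on the tangent space. -/
def SmoothOneForm.altAt (η : SmoothOneForm I M) (x : M) :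
    (TangentSpace I x) [⋀^Fin 1]→ₗ[ℝ] ℝ :=
  oneFormAlt (η x).toLinearMap

/-- The connections `D` and `D'` are dual with respect to the metric `g`:
`Z (g(X, Y)) = g(∇_Z X, Y) + g(X, ∇'_Z Y)` for all vector fields `X, Y, Z`. -/
def AreDualConnections (g : SmoothMetric I M) (D D' : AffineConnection I M) : Prop :=
  ∀ (X Y Z : SmoothVectorField I M) (x : M),
    d% (fun y : M ↦ g.inner y (X y) (Y y)) x (Z x) =
      g.inner x (D X x (Z x)) (Y x) + g.inner x (X x) (D' Y x (Z x))

/-- The gauge equation `∇'_X (θ Y) = θ (∇_X Y)` for all vector fields `X, Y`. -/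
def SatisfiesGaugeEquation (D D' : AffineConnection I M)
    (θ : SmoothEndomorphismField I M) : Prop :=
  ∀ (X Y : SmoothVectorField I M) (x : M),
    D' (fun y ↦ θ y (Y y)) x (X x) = θ x (D Y x (X x))

/-- `θ` is skew-symmetric with respect to the metric `g`. -/
def IsSkewSymmetric (g : SmoothMetric I M) (θ : SmoothEndomorphismField I M) : Prop :=
  ∀ (x : M) (v w : TangentSpace I x), g.inner x (θ x v) w = -g.inner x v (θ x w)

/-- `θ` has rank `r` at every point. -/
def HasConstantRank (θ : SmoothEndomorphismField I M) (r : ℕ) : Prop :=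
  ∀ x : M, Module.finrank ℝ (LinearMap.range (θ x).toLinearMap) = r

end Tensors

/-! ### The structures compared in the theorem -/

section Structures

variable {E : Type*} [NormedAddCommGroup E] [NormedSpace ℝ E]
  {H : Type*} [TopologicalSpace H] (I : ModelWithCorners ℝ E H)
  (M : Type*) [TopologicalSpace M] [ChartedSpace H M] [IsManifold I ∞ M]

/-- The gauge equation of dual connections on `M` has a skew-symmetric solution of rank `r`:
there are a Riemannian metric, a pair of smooth affine connections dual with respect to it, and
a skew-symmetric `(1,1)`-tensor field of rank `r` at every point satisfying the gauge equation. -/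
def HasSkewGaugeSolution (r : ℕ) : Prop :=
  ∃ (g : SmoothMetric I M) (D D' : AffineConnection I M) (θ : SmoothEndomorphismField I M),
    D.ContMDiffCovariantDerivative ∞ ∧ D'.ContMDiffCovariantDerivative ∞ ∧
    AreDualConnections g D D' ∧ SatisfiesGaugeEquation D D' θ ∧
    IsSkewSymmetric g θ ∧ HasConstantRank θ r

/-- `M` (of dimension `2 n + 1`) has an almost cosymplectic structure: a two-form `w` and a
one-form `η` such that `w ^ n ∧ η` vanishes nowhere. -/
def HasAlmostCosymplecticStructure (n : ℕ) : Prop :=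
  ∃ (w : SmoothTwoForm I M) (η : SmoothOneForm I M),
    ∀ x : M, wedge (wedgePow (w.altAt x) n) (SmoothOneForm.altAt η x) ≠ 0

/-- `M` has an almost contact structure: a `(1,1)`-tensor field `φ`, a vector field `ξ` and a
one-form `η` with `η(ξ) = 1` and `φ² = - Id + η ⊗ ξ`. -/
def HasAlmostContactStructure : Prop :=
  ∃ (φ : SmoothEndomorphismField I M) (ξ : SmoothVectorField I M) (η : SmoothOneForm I M),
    ∀ x : M, η x (ξ x) = 1 ∧ ∀ v : TangentSpace I x, φ x (φ x v) = -v + η x v • ξ x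

/-- `M` has an almost symplectic structure: a non-degenerate two-form. -/
def HasAlmostSymplecticStructure : Prop :=
  ∃ w : SmoothTwoForm I M, ∀ (x : M) (v : TangentSpace I x),
    (∀ u : TangentSpace I x, w.toSection x v u = 0) → v = 0

end Structures

/-- A smooth manifold `M` modelled on `E` is orientable: it is covered by a family of charts of
its smooth structure all of whose coordinate changes have positive Jacobian determinant. -/
def IsOrientableManifold (E : Type*) [NormedAddCommGroup E] [NormedSpace ℝ E]
    (M : Type*) [TopologicalSpace M] [ChartedSpace E M] : Prop :=
  ∃ A : Set (OpenPartialHomeomorph M E), A ⊆ IsManifold.maximalAtlas 𝓘(ℝ, E) ∞ M ∧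
    (∀ x : M, ∃ e ∈ A, x ∈ e.source) ∧
    ∀ e ∈ A, ∀ e' ∈ A, ∀ x ∈ e.source ∩ e'.source,
      0 < (fderiv ℝ (e' ∘ e.symm) (e x)).det

end

open scoped Manifold ContDiff Bundle

noncomputable section

open Bundle Topology

section WedgeAlgebra

variable {V : Type*} [AddCommGroup V] [Module ℝ V]

theorem wedge_alternatization {k l : ℕ} (a : MultilinearMap ℝ (fun _ : Fin k ↦ V) ℝ)
    (b : MultilinearMap ℝ (fun _ : Fin l ↦ V) ℝ) :
    wedge (MultilinearMap.alternatization a) (MultilinearMap.alternatization b) =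
      MultilinearMap.alternatization
        (((LinearMap.mul' ℝ ℝ).compMultilinearMap (a.domCoprod b)).domDomCongr
          finSumFinEquiv) := by
  ext v
  rw [wedge, ← MultilinearMap.domCoprod_alternization, AlternatingMap.domDomCongr_apply,
    LinearMap.compAlternatingMap_apply, MultilinearMap.alternatization_apply,
    MultilinearMap.alternatization_apply, map_sum,
    ← Equiv.sum_comp (finSumFinEquiv (m := k) (n := l)).permCongr]
  refine Finset.sum_congr rfl fun σ _ ↦ ?_
  simp only [Units.smul_def, map_zsmul, MultilinearMap.domDomCongr_apply,
    MultilinearMap.domCoprod_apply, LinearMap.compMultilinearMap_apply, LinearMap.mul'_apply,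
    Equiv.Perm.sign_permCongr, Equiv.permCongr_apply, Equiv.symm_apply_apply]
  rfl

/-- The `n`-th tensor power of half a two-form; its alternatization is the wedge power. -/
def halfTensorPow (w : V [⋀^Fin 2]→ₗ[ℝ] ℝ) :
    (n : ℕ) → MultilinearMap ℝ (fun _ : Fin (2 * n) ↦ V) ℝ
  | 0 => MultilinearMap.constOfIsEmpty ℝ (fun _ : Fin 0 ↦ V) 1
  | n + 1 => ((LinearMap.mul' ℝ ℝ).compMultilinearMap
      ((halfTensorPow w n).domCoprod ((2⁻¹ : ℝ) • (w : MultilinearMap ℝ (fun _ : Fin 2 ↦ V) ℝ)))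
      ).domDomCongr finSumFinEquiv

theorem halfTensorPow_apply (w : V [⋀^Fin 2]→ₗ[ℝ] ℝ) (n : ℕ) (v : Fin (2 * n) → V) :
    halfTensorPow w n v =
      ∏ i : Fin n, 2⁻¹ * w ![v ⟨2 * i, by omega⟩, v ⟨2 * i + 1, by omega⟩] := by
  induction n with
  | zero => simp [halfTensorPow]
  | succ n ih =>
    rw [Fin.prod_univ_castSucc]
    simp only [halfTensorPow, MultilinearMap.domDomCongr_apply, MultilinearMap.domCoprod_apply,
      LinearMap.compMultilinearMap_apply, LinearMap.mul'_apply, ih, smul_apply,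
      smul_eq_mul, AlternatingMap.coe_multilinearMap]
    congr 3
    ext j
    fin_cases j <;> rfl

theorem alternatization_half (w : V [⋀^Fin 2]→ₗ[ℝ] ℝ) :
    MultilinearMap.alternatization
      ((2⁻¹ : ℝ) • (w : MultilinearMap ℝ (fun _ : Fin 2 ↦ V) ℝ)) = w := by
  have h : ∀ c : ℝ, MultilinearMap.alternatization
      (c • (w : MultilinearMap ℝ (fun _ : Fin 2 ↦ V) ℝ)) =
      c • MultilinearMap.alternatization (w : MultilinearMap ℝ (fun _ : Fin 2 ↦ V) ℝ) := by
    intro c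
    ext v
    simp only [MultilinearMap.alternatization_apply, MultilinearMap.domDomCongr_apply,
      smul_apply, AlternatingMap.smul_apply, Finset.smul_sum]
    exact Finset.sum_congr rfl fun σ _ ↦ smul_comm _ _ _
  rw [h, AlternatingMap.coe_alternatization]
  ext v
  simp

theorem wedgePow_eq_alternatization (w : V [⋀^Fin 2]→ₗ[ℝ] ℝ) (n : ℕ) :
    wedgePow w n = MultilinearMap.alternatization (halfTensorPow w n) := by
  induction n with
  | zero =>
    ext v
    simp [wedgePow, halfTensorPow, MultilinearMap.alternatization_apply]
  | succ n ih =>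
    have h := wedge_alternatization (halfTensorPow w n)
      ((2⁻¹ : ℝ) • (w : MultilinearMap ℝ (fun _ : Fin 2 ↦ V) ℝ))
    rw [alternatization_half, ← ih] at h
    exact h

theorem alternatization_oneForm (η : V →ₗ[ℝ] ℝ) :
    MultilinearMap.alternatization
      (oneFormAlt η : MultilinearMap ℝ (fun _ : Fin 1 ↦ V) ℝ) = oneFormAlt η := by
  rw [AlternatingMap.coe_alternatization]
  simp

/-- The value of `w ^ n ∧ η` as an explicit sum over permutations. -/
theorem wedge_wedgePow_oneForm_apply (B : V →ₗ[ℝ] V →ₗ[ℝ] ℝ) (hB : ∀ v, B v v = 0)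
    (η : V →ₗ[ℝ] ℝ) (n : ℕ) (v : Fin (2 * n + 1) → V) :
    wedge (wedgePow (twoFormAlt B hB) n) (oneFormAlt η) v =
      ∑ σ : Equiv.Perm (Fin (2 * n + 1)), ((Equiv.Perm.sign σ : ℤ) : ℝ) *
        ((∏ i : Fin n, 2⁻¹ * B (v (σ ⟨2 * i, by omega⟩)) (v (σ ⟨2 * i + 1, by omega⟩))) *
          η (v (σ (Fin.last (2 * n))))) := by
  rw [wedgePow_eq_alternatization, ← alternatization_oneForm, wedge_alternatization,
    MultilinearMap.alternatization_apply]
  refine Finset.sum_congr rfl fun σ _ ↦ ?_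
  simp only [MultilinearMap.domDomCongr_apply, LinearMap.compMultilinearMap_apply,
    MultilinearMap.domCoprod_apply, LinearMap.mul'_apply, halfTensorPow_apply, Units.smul_def,
    zsmul_eq_mul]
  rfl

/-- The value of `w ^ n ∧ η` is linear in `η`. -/
theorem wedge_wedgePow_oneForm_add_smul (B : V →ₗ[ℝ] V →ₗ[ℝ] ℝ) (hB : ∀ v, B v v = 0)
    (η η' : V →ₗ[ℝ] ℝ) (a b : ℝ) (n : ℕ) (v : Fin (2 * n + 1) → V) :
    wedge (wedgePow (twoFormAlt B hB) n) (oneFormAlt (a • η + b • η')) v =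
      a * wedge (wedgePow (twoFormAlt B hB) n) (oneFormAlt η) v +
      b * wedge (wedgePow (twoFormAlt B hB) n) (oneFormAlt η') v := by
  simp only [wedge_wedgePow_oneForm_apply, Finset.mul_sum, ← Finset.sum_add_distrib]
  refine Finset.sum_congr rfl fun σ _ ↦ ?_
  simp only [LinearMap.add_apply, LinearMap.smul_apply, smul_eq_mul]
  ring

/-- The symbol `ω(e_a, e_b)` of the standard symplectic plane. -/
def symplecticSymbol (a b : Fin 2) : ℝ := (b : ℝ) - (a : ℝ)

/-- A family `e_i, f_i` of vectors on which an alternating form takes its standard values. -/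
def IsSymplecticFamily (B : V →ₗ[ℝ] V →ₗ[ℝ] ℝ) {m : ℕ} (u : Fin m × Fin 2 → V) : Prop :=
  ∀ p q, B (u p) (u q) = if p.1 = q.1 then symplecticSymbol p.2 q.2 else 0

theorem sign_mul_prod_symplectic_nonneg {n : ℕ} (τ : Equiv.Perm (Fin n × Fin 2)) :
    0 ≤ ((Equiv.Perm.sign τ : ℤ) : ℝ) * ∏ i : Fin n, (2⁻¹ *
      (if (τ (i, 0)).1 = (τ (i, 1)).1 then
        symplecticSymbol (τ (i, 0)).2 (τ (i, 1)).2 else 0)) := by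
  by_cases h : ∀ i, (τ (i, 0)).1 = (τ (i, 1)).1
  · have hfst : ∀ x, (τ x).1 = (τ (x.1, 0)).1 := by
      rintro ⟨i, a⟩
      fin_cases a
      · rfl
      · exact (h i).symm
    have hsnd : ∀ i, Function.Injective fun a ↦ (τ (i, a)).2 := by
      intro i a b hab
      have : τ (i, a) = τ (i, b) := Prod.ext (by rw [hfst (i, a), hfst (i, b)]) hab
      simpa using τ.injective this
    have hsurj : Function.Surjective fun i ↦ (τ (i, 0)).1 := by
      intro j
      obtain ⟨x, hx⟩ := τ.surjective (j, 0)
      exact ⟨x.1, ((hfst x).symm.trans (congrArg Prod.fst hx))⟩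
    let p : Equiv.Perm (Fin n) :=
      Equiv.ofBijective _ (Finite.injective_iff_bijective.1 (Finite.injective_iff_surjective.2 hsurj))
    let s : Fin n → Equiv.Perm (Fin 2) := fun i ↦
      Equiv.ofBijective _ (Finite.injective_iff_bijective.1 (hsnd i))
    have hτ : τ = Equiv.prodCongrLeft (fun _ : Fin 2 ↦ p) * Equiv.prodCongrRight s := by
      ext x
      · simp [p, hfst x]
      · simp [s]
    have hs : ∀ i, symplecticSymbol (τ (i, 0)).2 (τ (i, 1)).2 =
        ((Equiv.Perm.sign (s i) : ℤ) : ℝ) := by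
      intro i
      have key : ∀ t : Equiv.Perm (Fin 2), symplecticSymbol (t 0) (t 1) =
          ((Equiv.Perm.sign t : ℤ) : ℝ) := by
        intro t
        have hz : ∀ t : Equiv.Perm (Fin 2), ((t 1 : ℕ) : ℤ) - ((t 0 : ℕ) : ℤ) =
          (Equiv.Perm.sign t : ℤ) := by decide
        rw [symplecticSymbol, ← hz t]
        push_cast
        rfl
      exact key (s i)
    have hsign : Equiv.Perm.sign τ = ∏ i, Equiv.Perm.sign (s i) := by
      rw [hτ, Equiv.Perm.sign_mul, Equiv.Perm.sign_prodCongrLeft, Equiv.Perm.sign_prodCongrRight]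
      simp
    simp only [h, if_true, hs, Finset.prod_mul_distrib, hsign]
    push_cast
    rw [mul_left_comm, ← Finset.prod_mul_distrib]
    refine mul_nonneg (by positivity) (Finset.prod_nonneg fun i _ ↦ mul_self_nonneg _)
  · push Not at h
    obtain ⟨i, hi⟩ := h
    rw [Finset.prod_eq_zero (Finset.mem_univ i) (by simp [hi]), mul_zero]

/-- The standard enumeration of a symplectic basis with one extra vector. -/
def optionProdEquivFin (n : ℕ) : Option (Fin n × Fin 2) ≃ Fin (2 * n + 1) :=
  Equiv.ofBijective
    (fun o ↦ o.elim (Fin.last (2 * n)) fun p ↦ ⟨2 * p.1 + p.2, by omega⟩) <| by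
    rw [Fintype.bijective_iff_injective_and_card]
    constructor
    · rintro (_ | ⟨i, a⟩) (_ | ⟨j, b⟩) h
      · rfl
      · simp [Fin.ext_iff] at h; omega
      · simp [Fin.ext_iff] at h; omega
      · simp [Fin.ext_iff] at h
        simp only [Option.some.injEq, Prod.mk.injEq, Fin.ext_iff]; omega
    · simp [mul_comm]

theorem wedge_symplectic_pos {n : ℕ} (B : V →ₗ[ℝ] V →ₗ[ℝ] ℝ) (hB : ∀ v, B v v = 0)
    (η : V →ₗ[ℝ] ℝ) (u : Fin n × Fin 2 → V) (hu : IsSymplecticFamily B u) (ξ : V)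
    (hξ : ∀ v, B ξ v = 0) (hη : 0 < η ξ) :
    0 < wedge (wedgePow (twoFormAlt B hB) n) (oneFormAlt η)
      ((fun o : Option (Fin n × Fin 2) ↦ o.elim ξ u) ∘ (optionProdEquivFin n).symm) := by
  have hξ' : ∀ v, B v ξ = 0 := fun v ↦ by
    have h := hB (v + ξ)
    simp only [map_add, LinearMap.add_apply, hB, hξ, zero_add, add_zero] at h
    exact h
  set f : Option (Fin n × Fin 2) → V := fun o ↦ o.elim ξ u with hf
  rw [wedge_wedgePow_oneForm_apply, ← Equiv.sum_comp (optionProdEquivFin n).permCongr]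
  have h0 : ∀ i : Fin n, (optionProdEquivFin n).symm ⟨2 * i, by omega⟩ = some (i, 0) := by
    intro i; rw [Equiv.symm_apply_eq]; simp [optionProdEquivFin]
  have h1 : ∀ i : Fin n, (optionProdEquivFin n).symm ⟨2 * i + 1, by omega⟩ = some (i, 1) := by
    intro i; rw [Equiv.symm_apply_eq]; simp [optionProdEquivFin]
  have h2 : (optionProdEquivFin n).symm (Fin.last (2 * n)) = none := by
    rw [Equiv.symm_apply_eq]; simp [optionProdEquivFin]
  simp only [Equiv.Perm.sign_permCongr, Equiv.permCongr_apply, Function.comp_apply,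
    Equiv.symm_apply_apply, h0, h1, h2]
  refine Finset.sum_pos' (fun τ _ ↦ ?_) ⟨1, Finset.mem_univ _, ?_⟩
  · by_cases hτ : τ none = none
    · have hσ : τ = Equiv.optionCongr (Equiv.removeNone τ) := by
        ext1 x
        cases x with
        | none => simp [hτ]
        | some x =>
          rw [Equiv.optionCongr_apply, Option.map_some, Equiv.removeNone_some]
          refine Option.ne_none_iff_exists'.1 fun h ↦ ?_
          simpa using τ.injective (h.trans hτ.symm)
      generalize Equiv.removeNone τ = σ at hσ
      subst hσ
      simp only [Equiv.optionCongr_sign, Equiv.optionCongr_apply, Option.map_some, Option.map_none]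
      have := sign_mul_prod_symplectic_nonneg σ
      simp only [hf, Option.elim, hu _ _]
      rw [← mul_assoc]
      exact mul_nonneg this hη.le
    · obtain ⟨⟨i, a⟩, hi⟩ : ∃ x, τ (some x) = none := by
        obtain ⟨x, hx⟩ := τ.surjective none
        cases x with
        | none => exact absurd hx hτ
        | some x => exact ⟨x, hx⟩
      rw [Finset.prod_eq_zero (Finset.mem_univ i), zero_mul, mul_zero]
      fin_cases a
      · simp only [Fin.zero_eta] at hi; simp [hi, hf, hξ]
      · simp only [Fin.mk_one] at hi; simp [hi, hf, hξ']
  · simp only [Equiv.Perm.sign_one, Equiv.Perm.one_apply, hf, Option.elim, hu _ _]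
    simp [symplecticSymbol, hη]

theorem eq_zero_of_wedge_ne_zero [FiniteDimensional ℝ V] {n : ℕ}
    (hV : Module.finrank ℝ V = 2 * n + 1) (B : V →ₗ[ℝ] V →ₗ[ℝ] ℝ) (hB : ∀ v, B v v = 0)
    (η : V →ₗ[ℝ] ℝ) (h : wedge (wedgePow (twoFormAlt B hB) n) (oneFormAlt η) ≠ 0)
    (v : V) (hv : ∀ w, B v w = 0) (hηv : η v = 0) : v = 0 := by
  by_contra hne
  have hv' : ∀ w, B w v = 0 := fun w ↦ by
    have h := hB (w + v)
    simp only [map_add, LinearMap.add_apply, hB, hv, zero_add, add_zero] at h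
    exact h
  have hs : LinearIndepOn ℝ id ({v} : Set V) := LinearIndepOn.singleton hne
  let b₀ := Module.Basis.extend hs
  have : Fintype (hs.extend (Set.subset_univ _)) := FiniteDimensional.fintypeBasisIndex b₀
  let e : hs.extend (Set.subset_univ _) ≃ Fin (2 * n + 1) :=
    Fintype.equivFinOfCardEq (by rw [← Module.finrank_eq_card_basis b₀, hV])
  let b := b₀.reindex e
  have hmem : v ∈ hs.extend (Set.subset_univ _) := hs.subset_extend _ rfl
  have hb : b (e ⟨v, hmem⟩) = v := by simp [b, b₀]
  generalize e ⟨v, hmem⟩ = k at hb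
  refine (AlternatingMap.map_basis_ne_zero_iff b _).2 h ?_
  rw [wedge_wedgePow_oneForm_apply]
  refine Finset.sum_eq_zero fun σ _ ↦ ?_
  obtain ⟨j, rfl⟩ := σ.surjective k
  rcases lt_or_ge (j : ℕ) (2 * n) with hj | hj
  · rw [Finset.prod_eq_zero (Finset.mem_univ (⟨j / 2, by omega⟩ : Fin n)), zero_mul, mul_zero]
    rcases Nat.even_or_odd' (j : ℕ) with ⟨c, hc | hc⟩
    · rw [show (⟨2 * ((j : ℕ) / 2), by omega⟩ : Fin (2 * n + 1)) = j from Fin.ext (by simp; omega),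
        hb, hv, mul_zero]
    · rw [show (⟨2 * ((j : ℕ) / 2) + 1, by omega⟩ : Fin (2 * n + 1)) = j from
        Fin.ext (by simp; omega), hb, hv', mul_zero]
  · rw [show Fin.last (2 * n) = j from Fin.ext (by simp; omega), hb, hηv, mul_zero, mul_zero]

theorem IsSymplecticFamily.apply_sum {B : V →ₗ[ℝ] V →ₗ[ℝ] ℝ} {m : ℕ} {u : Fin m × Fin 2 → V}
    (hu : IsSymplecticFamily B u) (c : Fin m × Fin 2 → ℝ) (q : Fin m × Fin 2) :
    B (∑ i, (c (i, 1) • u (i, 0) - c (i, 0) • u (i, 1))) (u q) = c q := by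
  obtain ⟨j, b⟩ := q
  simp only [map_sum, map_sub, map_smul, LinearMap.sum_apply, LinearMap.sub_apply,
    LinearMap.smul_apply, hu _ _, smul_eq_mul, mul_ite, mul_zero]
  rw [Finset.sum_sub_distrib, Finset.sum_ite_eq', Finset.sum_ite_eq']
  fin_cases b <;> simp [symplecticSymbol]

theorem IsSymplecticFamily.two_mul_le_finrank [FiniteDimensional ℝ V] {B : V →ₗ[ℝ] V →ₗ[ℝ] ℝ}
    {m : ℕ} {u : Fin m × Fin 2 → V} (hu : IsSymplecticFamily B u) :
    Module.finrank ℝ V = 2 * m + Module.finrank ℝ (LinearMap.ker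
      (LinearMap.pi fun p ↦ B.flip (u p))) := by
  have hsurj : Function.Surjective (LinearMap.pi fun p ↦ B.flip (u p)) := fun c ↦
    ⟨_, funext fun q ↦ hu.apply_sum c q⟩
  rw [← LinearMap.finrank_range_add_finrank_ker (LinearMap.pi fun p ↦ B.flip (u p)),
    LinearMap.range_eq_top.2 hsurj, finrank_top]
  simp [mul_comm]

theorem exists_symplecticFamily [FiniteDimensional ℝ V] (B : V →ₗ[ℝ] V →ₗ[ℝ] ℝ)
    (hB : ∀ v, B v v = 0) : ∃ (m : ℕ) (u : Fin m × Fin 2 → V), IsSymplecticFamily B u ∧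
      Module.finrank ℝ V = 2 * m + Module.finrank ℝ (LinearMap.ker B) := by
  have hanti : ∀ v w, B v w = -B w v := fun v w ↦ by
    have h := hB (v + w)
    simp only [map_add, LinearMap.add_apply, hB] at h
    linarith
  have main : ∀ k : ℕ, ∃ (m : ℕ) (u : Fin m × Fin 2 → V), IsSymplecticFamily B u ∧
      (m = k ∨ ∀ x y, (∀ p, B x (u p) = 0) → (∀ p, B y (u p) = 0) → B x y = 0) := by
    intro k
    induction k with
    | zero => exact ⟨0, fun p ↦ p.1.elim0, fun p ↦ p.1.elim0, Or.inl rfl⟩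
    | succ k ih =>
      obtain ⟨m, u, hu, rfl | hmax⟩ := ih
      · by_cases hmax : ∀ x y, (∀ p, B x (u p) = 0) → (∀ p, B y (u p) = 0) → B x y = 0
        · exact ⟨m, u, hu, Or.inr hmax⟩
        · push Not at hmax
          obtain ⟨x, y, hx, hy, hxy⟩ := hmax
          have hx' : ∀ p, B (u p) x = 0 := fun p ↦ by rw [hanti, hx, neg_zero]
          have hy' : ∀ p, B (u p) y = 0 := fun p ↦ by rw [hanti, hy, neg_zero]
          have hyx := hanti y x
          refine ⟨m + 1, fun p ↦ Fin.cases (![x, (B x y)⁻¹ • y] p.2) (fun i ↦ u (i, p.2)) p.1,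
            ?_, Or.inl rfl⟩
          rintro ⟨i, a⟩ ⟨j, b⟩
          refine Fin.cases ?_ (fun i ↦ ?_) i <;> refine Fin.cases ?_ (fun j ↦ ?_) j
          · fin_cases a <;> fin_cases b <;> simp [symplecticSymbol, hB, hyx, hxy]
          · fin_cases a <;> simp [hx, hy, (Fin.succ_ne_zero j).symm]
          · fin_cases b <;> simp [hx', hy']
          · simpa using hu (i, a) (j, b)
      · exact ⟨m, u, hu, Or.inr hmax⟩
  obtain ⟨m, u, hu, h⟩ := main (Module.finrank ℝ V + 1)
  have hdim := hu.two_mul_le_finrank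
  have hmax := h.resolve_left (by omega)
  refine ⟨m, u, hu, ?_⟩
  suffices h : LinearMap.ker B = LinearMap.ker (LinearMap.pi fun p ↦ B.flip (u p)) by rwa [h]
  ext x
  simp only [LinearMap.mem_ker]
  refine ⟨fun hx ↦ by ext p; simp [hx], fun hx ↦ ?_⟩
  have hx' : ∀ p, B x (u p) = 0 := fun p ↦ congrFun hx p
  ext y
  set z := ∑ i, (B y (u (i, 1)) • u (i, 0) - B y (u (i, 0)) • u (i, 1)) with hz
  have h1 : B x (y - z) = 0 := hmax _ _ hx' fun p ↦ by
    rw [map_sub, LinearMap.sub_apply, hu.apply_sum (fun q ↦ B y (u q)) p, sub_self]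
  have h2 : B x z = 0 := by simp [hz, map_sum, hx']
  rw [map_sub, h2, sub_zero] at h1
  simpa using h1

theorem exists_reeb_of_ker_inf_ker_eq_zero [FiniteDimensional ℝ V] {n : ℕ}
    (hV : Module.finrank ℝ V = 2 * n + 1) (B : V →ₗ[ℝ] V →ₗ[ℝ] ℝ) (hB : ∀ v, B v v = 0)
    (η : V →ₗ[ℝ] ℝ) (h : ∀ v, (∀ w, B v w = 0) → η v = 0 → v = 0) :
    Module.finrank ℝ (LinearMap.ker B) = 1 ∧
    ∃ (u : Fin n × Fin 2 → V) (ξ : V), IsSymplecticFamily B u ∧ (∀ v, B ξ v = 0) ∧ η ξ = 1 := by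
  obtain ⟨m, u, hu, hdim⟩ := exists_symplecticFamily B hB
  have hinj : Function.Injective (η ∘ₗ (LinearMap.ker B).subtype) := by
    rw [injective_iff_map_eq_zero]
    rintro ⟨v, hv⟩ hηv
    exact Subtype.ext (h v (fun w ↦ by rw [LinearMap.mem_ker.1 hv]; rfl) hηv)
  have hle := LinearMap.finrank_le_finrank_of_injective hinj
  rw [Module.finrank_self] at hle
  obtain rfl : m = n := by omega
  have hker : Module.finrank ℝ (LinearMap.ker B) = 1 := by omega
  have : Nontrivial (LinearMap.ker B) := Module.nontrivial_of_finrank_pos (R := ℝ) (by omega)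
  obtain ⟨⟨k, hk⟩, hk0⟩ := exists_ne (0 : LinearMap.ker B)
  have hk' : ∀ w, B k w = 0 := fun w ↦ by rw [LinearMap.mem_ker.1 hk]; rfl
  have hηk : η k ≠ 0 := fun h0 ↦ hk0 (Subtype.ext (h k hk' h0))
  exact ⟨hker, u, (η k)⁻¹ • k, hu, fun v ↦ by simp [hk'], by simp [hηk]⟩

theorem wedge_ne_zero_of_ker_inf_ker_eq_zero [FiniteDimensional ℝ V] {n : ℕ}
    (hV : Module.finrank ℝ V = 2 * n + 1) (B : V →ₗ[ℝ] V →ₗ[ℝ] ℝ) (hB : ∀ v, B v v = 0)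
    (η : V →ₗ[ℝ] ℝ) (h : ∀ v, (∀ w, B v w = 0) → η v = 0 → v = 0) :
    wedge (wedgePow (twoFormAlt B hB) n) (oneFormAlt η) ≠ 0 := by
  obtain ⟨-, u, ξ, hu, hξ, hηξ⟩ := exists_reeb_of_ker_inf_ker_eq_zero hV B hB η h
  have := wedge_symplectic_pos B hB η u hu ξ hξ (by rw [hηξ]; exact one_pos)
  intro h0
  simp [h0] at this

theorem exists_oneForm_of_finrank_ker_eq_one [FiniteDimensional ℝ V] (B : V →ₗ[ℝ] V →ₗ[ℝ] ℝ)
    (h : Module.finrank ℝ (LinearMap.ker B) = 1) :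
    ∃ η : V →ₗ[ℝ] ℝ, ∀ v, (∀ w, B v w = 0) → η v = 0 → v = 0 := by
  obtain ⟨k, hk0, hk⟩ := finrank_eq_one_iff'.1 h
  have hk0' : (k : V) ≠ 0 := fun h ↦ hk0 (Subtype.ext h)
  obtain ⟨η, hη⟩ : ∃ η : Module.Dual ℝ V, η k ≠ 0 := by
    by_contra! h0
    exact hk0' ((Module.forall_dual_apply_eq_zero_iff ℝ _).1 h0)
  refine ⟨η, fun v hv hηv ↦ ?_⟩
  obtain ⟨c, hc⟩ := hk ⟨v, LinearMap.ext hv⟩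
  have hc' : v = c • (k : V) := (congrArg Subtype.val hc).symm
  rw [hc', map_smul, smul_eq_mul, mul_eq_zero, or_iff_left hη] at hηv
  rw [hc', hηv, zero_smul]

end WedgeAlgebra

section BilinearForms

variable {E : Type*} [NormedAddCommGroup E] [NormedSpace ℝ E] [FiniteDimensional ℝ E]

theorem exists_pos_mul_sq_norm_le (B : E →L[ℝ] E →L[ℝ] ℝ) (hB : ∀ v, v ≠ 0 → 0 < B v v) :
    ∃ c > 0, ∀ v, c * ‖v‖ ^ 2 ≤ B v v := by
  rcases subsingleton_or_nontrivial E with hE | hE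
  · exact ⟨1, one_pos, fun v ↦ by simp [Subsingleton.elim v 0]⟩
  have hcomp : IsCompact (Metric.sphere (0 : E) 1) := isCompact_sphere 0 1
  have hne : (Metric.sphere (0 : E) 1).Nonempty := NormedSpace.sphere_nonempty.2 zero_le_one
  have hcont : ContinuousOn (fun v ↦ B v v) (Metric.sphere (0 : E) 1) :=
    (B.continuous.clm_apply continuous_id).continuousOn
  obtain ⟨v₀, hv₀, hmin⟩ := hcomp.exists_isMinOn hne hcont
  refine ⟨B v₀ v₀, hB _ (ne_zero_of_mem_unit_sphere ⟨v₀, hv₀⟩), fun v ↦ ?_⟩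
  rcases eq_or_ne v 0 with rfl | hv
  · simp
  have hn : ‖v‖ ≠ 0 := norm_ne_zero_iff.2 hv
  have hmem : ‖v‖⁻¹ • v ∈ Metric.sphere (0 : E) 1 := by simp [norm_smul, hn]
  have h : B v₀ v₀ ≤ B (‖v‖⁻¹ • v) (‖v‖⁻¹ • v) := hmin hmem
  simp only [map_smul, smul_apply, smul_eq_mul] at h
  calc B v₀ v₀ * ‖v‖ ^ 2 ≤ ‖v‖⁻¹ * (‖v‖⁻¹ * B v v) * ‖v‖ ^ 2 := by gcongr
    _ = B v v := by field_simp

theorem isVonNBounded_of_pos (B : E →L[ℝ] E →L[ℝ] ℝ) (hB : ∀ v, v ≠ 0 → 0 < B v v) :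
    Bornology.IsVonNBounded ℝ {v : E | B v v < 1} := by
  obtain ⟨c, hc, h⟩ := exists_pos_mul_sq_norm_le B hB
  rw [NormedSpace.isVonNBounded_iff, isBounded_iff_forall_norm_le]
  refine ⟨Real.sqrt c⁻¹, fun v hv ↦ Real.le_sqrt_of_sq_le ?_⟩
  rw [Set.mem_ofPred_eq] at hv
  rw [inv_eq_one_div, le_div_iff₀ hc, mul_comm]
  exact (h v).trans hv.le

/-- A bilinear form without left kernel on a finite-dimensional space, as an isomorphism onto the
dual space. -/
def bilinEquiv (B : E →L[ℝ] E →L[ℝ] ℝ) (hB : ∀ v, (∀ w, B v w = 0) → v = 0) :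
    E ≃L[ℝ] (E →L[ℝ] ℝ) :=
  (LinearEquiv.ofInjectiveOfFinrankEq (B : E →ₗ[ℝ] E →L[ℝ] ℝ)
    ((injective_iff_map_eq_zero _).2 fun v hv ↦ hB v fun w ↦ by
      rw [ContinuousLinearMap.coe_coe] at hv; rw [hv]; rfl)
    (by
      rw [← (LinearMap.toContinuousLinearMap (𝕜 := ℝ) (E := E) (F' := ℝ)).finrank_eq]
      exact (Subspace.dual_finrank_eq (K := ℝ) (V := E)).symm)).toContinuousLinearEquiv

theorem bilinEquiv_symm_apply (B : E →L[ℝ] E →L[ℝ] ℝ) (hB : ∀ v, (∀ w, B v w = 0) → v = 0)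
    (α : E →L[ℝ] ℝ) : B ((bilinEquiv B hB).symm α) = α :=
  (bilinEquiv B hB).apply_symm_apply α

end BilinearForms

section SmoothFields

variable {E : Type*} [NormedAddCommGroup E] [NormedSpace ℝ E]
  {H : Type*} [TopologicalSpace H] {I : ModelWithCorners ℝ E H}
  {M : Type*} [TopologicalSpace M] [ChartedSpace H M]

theorem contMDiffAt_clm_of_apply [FiniteDimensional ℝ E] {E' : Type*} [NormedAddCommGroup E']
    [NormedSpace ℝ E'] {H' : Type*} [TopologicalSpace H'] {I' : ModelWithCorners ℝ E' H'}
    {N : Type*} [TopologicalSpace N] [ChartedSpace H' N]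
    {F : Type*} [NormedAddCommGroup F] [NormedSpace ℝ F] {n : ℕ∞ω}
    {A : N → E →L[ℝ] F} {x : N} (h : ∀ u, ContMDiffAt I' 𝓘(ℝ, F) n (fun y ↦ A y u) x) :
    ContMDiffAt I' 𝓘(ℝ, E →L[ℝ] F) n A x := by
  let b := Module.finBasis ℝ E
  have hA : A = fun y ↦ ∑ i, (ContinuousLinearMap.smulRightL ℝ E F
      (LinearMap.toContinuousLinearMap (b.coord i))) (A y (b i)) := by
    ext y u
    conv_lhs => rw [← b.sum_repr u]
    rw [map_sum, sum_apply]
    simp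
  rw [hA]
  exact ContMDiffAt.sum fun i _ ↦ (ContinuousLinearMap.contMDiff _).contMDiffAt.comp x (h (b i))

theorem contMDiffAt_trivial_section {n : ℕ∞ω} {F : Type*} [NormedAddCommGroup F]
    [NormedSpace ℝ F] {E' : Type*} [NormedAddCommGroup E'] [NormedSpace ℝ E'] {H' : Type*}
    [TopologicalSpace H'] {I' : ModelWithCorners ℝ E' H'} {N : Type*} [TopologicalSpace N]
    [ChartedSpace H' N] {b : N → M} {f : N → F} {x : N} (hb : ContMDiffAt I' I n b x) :
    ContMDiffAt I' (I.prod 𝓘(ℝ, F)) n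
      (fun y ↦ TotalSpace.mk' F (E := fun _ : M ↦ F) (b y) (f y)) x ↔
      ContMDiffAt I' 𝓘(ℝ, F) n f x := by
  rw [contMDiffAt_totalSpace]
  exact and_iff_right hb

theorem convex_posDef (x : M) : Convex ℝ
    {g : TangentSpace I x →L[ℝ] TangentSpace I x →L[ℝ] ℝ |
      (∀ v w, g v w = g w v) ∧ ∀ v, v ≠ 0 → 0 < g v v} := by
  intro g hg g' hg' a b ha hb hab
  refine ⟨fun v w ↦ by simp [hg.1 v w, hg'.1 v w], fun v hv ↦ ?_⟩
  have h1 := hg.2 v hv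
  have h2 := hg'.2 v hv
  simp only [add_apply, smul_apply, smul_eq_mul]
  rcases ha.eq_or_lt with rfl | ha
  · rw [zero_add] at hab
    simp [hab, h2]
  · positivity

variable [IsManifold I ∞ M]

instance [FiniteDimensional ℝ E] (x : M) : FiniteDimensional ℝ (TangentSpace I x) :=
  inferInstanceAs (FiniteDimensional ℝ E)

instance (x : M) : T2Space (TangentSpace I x) := inferInstanceAs (T2Space E)

/-- The local vector field which is constant in the trivialization of `TM` at `x₀`. -/
def tangentFrame (I : ModelWithCorners ℝ E H) {M : Type*} [TopologicalSpace M] [ChartedSpace H M]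
    [IsManifold I ∞ M] (x₀ : M) (u : E) (x : M) : TangentSpace I x :=
  (trivializationAt E (TangentSpace I : M → Type _) x₀).symmL ℝ x u

theorem contMDiffAt_tangentFrame (x₀ : M) (u : E) {x : M}
    (hx : x ∈ (trivializationAt E (TangentSpace I : M → Type _) x₀).baseSet) :
    ContMDiffAt I (I.prod 𝓘(ℝ, E)) ∞
      (fun y ↦ TotalSpace.mk' E y (tangentFrame I x₀ u y)) x := by
  rw [(trivializationAt E (TangentSpace I : M → Type _) x₀).contMDiffAt_section_iff hx]
  refine (contMDiffAt_const (c := u)).congr_of_eventuallyEq ?_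
  filter_upwards [(trivializationAt E (TangentSpace I : M → Type _) x₀).open_baseSet.mem_nhds hx]
    with y hy
  rw [tangentFrame, Trivialization.symmL_apply _ hy, Trivialization.apply_mk_symm _ hy]

section Hom

variable {F : Type*} [NormedAddCommGroup F] [NormedSpace ℝ F]
  {V : M → Type*} [TopologicalSpace (TotalSpace F V)] [∀ x, AddCommGroup (V x)]
  [∀ x, Module ℝ (V x)] [∀ x, TopologicalSpace (V x)] [∀ x, IsTopologicalAddGroup (V x)]
  [∀ x, ContinuousSMul ℝ (V x)] [FiberBundle F V] [VectorBundle ℝ F V]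

/-- A field of linear maps on the tangent spaces is smooth as soon as its values on the local
frames are. -/
theorem contMDiffAt_hom_of_tangentFrame [FiniteDimensional ℝ E] {n : ℕ∞ω}
    {A : ∀ x, TangentSpace I x →L[ℝ] V x} {x₀ : M}
    (h : ∀ u, ContMDiffAt I (I.prod 𝓘(ℝ, F)) n
      (fun x ↦ TotalSpace.mk' F x (A x (tangentFrame I x₀ u x))) x₀) :
    ContMDiffAt I (I.prod 𝓘(ℝ, E →L[ℝ] F)) n
      (fun x ↦ TotalSpace.mk' (E →L[ℝ] F) (E := fun x ↦ TangentSpace I x →L[ℝ] V x) x (A x))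
      x₀ := by
  rw [contMDiffAt_hom_bundle]
  refine ⟨contMDiffAt_id, contMDiffAt_clm_of_apply fun u ↦ ?_⟩
  have h' := (contMDiffAt_totalSpace.1 (h u)).2
  refine h'.congr_of_eventuallyEq ?_
  filter_upwards [(trivializationAt E (TangentSpace I : M → Type _) x₀).open_baseSet.mem_nhds
    (mem_baseSet_trivializationAt E _ x₀),
    (trivializationAt F V x₀).open_baseSet.mem_nhds (mem_baseSet_trivializationAt F V x₀)]
    with y hy hy'
  rw [ContinuousLinearMap.inCoordinates_eq hy hy']
  simp [tangentFrame, Trivialization.symmL_apply _ hy]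

/-- The inverse of a smooth field of linear isomorphisms, applied to a smooth section, is
smooth. -/
theorem contMDiffAt_symm_apply [CompleteSpace E] {n : ℕ∞ω}
    {Φ : ∀ x, TangentSpace I x ≃L[ℝ] V x} {α : ∀ x, V x} {x₀ : M}
    (hΦ : ContMDiffAt I (I.prod 𝓘(ℝ, E →L[ℝ] F)) n
      (fun x ↦ TotalSpace.mk' (E →L[ℝ] F) (E := fun x ↦ TangentSpace I x →L[ℝ] V x) x
        (Φ x : TangentSpace I x →L[ℝ] V x)) x₀)
    (hα : ContMDiffAt I (I.prod 𝓘(ℝ, F)) n (fun x ↦ TotalSpace.mk' F x (α x)) x₀) :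
    ContMDiffAt I (I.prod 𝓘(ℝ, E)) n (fun x ↦ TotalSpace.mk' E x ((Φ x).symm (α x))) x₀ := by
  have hx₀ := mem_baseSet_trivializationAt E (TangentSpace I : M → Type _) x₀
  have hx₀' := mem_baseSet_trivializationAt F V x₀
  rw [contMDiffAt_hom_bundle] at hΦ
  rw [contMDiffAt_totalSpace] at hα ⊢
  refine ⟨contMDiffAt_id, ?_⟩
  let T : ∀ x, x ∈ (trivializationAt E (TangentSpace I : M → Type _) x₀).baseSet →
      x ∈ (trivializationAt F V x₀).baseSet → E ≃L[ℝ] F := fun x hx hx' ↦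
    ((trivializationAt E (TangentSpace I : M → Type _) x₀).continuousLinearEquivAt ℝ x hx).symm.trans
      ((Φ x).trans ((trivializationAt F V x₀).continuousLinearEquivAt ℝ x hx'))
  have hT : ∀ x hx hx', ContinuousLinearMap.inCoordinates E (TangentSpace I : M → Type _) F V
      x₀ x x₀ x (Φ x : TangentSpace I x →L[ℝ] V x) = (T x hx hx' : E →L[ℝ] F) := by
    intro x hx hx'
    rw [ContinuousLinearMap.inCoordinates_eq hx hx']
    rfl
  have hinv : ContMDiffAt I 𝓘(ℝ, F →L[ℝ] E) n (fun x ↦ ContinuousLinearMap.inverse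
      (ContinuousLinearMap.inCoordinates E (TangentSpace I : M → Type _) F V
      x₀ x x₀ x (Φ x : TangentSpace I x →L[ℝ] V x))) x₀ := by
    have h := contDiffAt_map_inverse (n := n) (T x₀ hx₀ hx₀')
    rw [← hT] at h
    exact h.contMDiffAt.comp x₀ hΦ.2
  refine (hinv.clm_apply hα.2).congr_of_eventuallyEq ?_
  filter_upwards [(trivializationAt E (TangentSpace I : M → Type _) x₀).open_baseSet.mem_nhds hx₀,
    (trivializationAt F V x₀).open_baseSet.mem_nhds hx₀'] with y hy hy'
  rw [hT y hy hy', ContinuousLinearMap.inverse_equiv]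
  have h1 : ((trivializationAt F V x₀) (TotalSpace.mk' F y (α y))).2 =
      (trivializationAt F V x₀).continuousLinearEquivAt ℝ y hy' (α y) := by
    simp
  have h2 : ∀ v, ((trivializationAt E (TangentSpace I : M → Type _) x₀) (TotalSpace.mk' E y v)).2 =
      (trivializationAt E (TangentSpace I : M → Type _) x₀).continuousLinearEquivAt ℝ y hy v := by
    simp
  rw [h1, h2]
  simp only [T, ContinuousLinearEquiv.coe_coe, ContinuousLinearEquiv.symm_trans_apply,
    ContinuousLinearEquiv.symm_symm, ContinuousLinearEquiv.symm_apply_apply]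

end Hom

section

variable [FiniteDimensional ℝ E]

/-- A field of linear forms is smooth as soon as its values on the local frames are. -/
theorem contMDiffAt_oneForm_of_tangentFrame {η : ∀ x : M, TangentSpace I x →L[ℝ] ℝ} {x₀ : M}
    (h : ∀ u, ContMDiffAt I 𝓘(ℝ, ℝ) ∞ (fun x ↦ η x (tangentFrame I x₀ u x)) x₀) :
    ContMDiffAt I (I.prod 𝓘(ℝ, E →L[ℝ] ℝ)) ∞ (fun x ↦ TotalSpace.mk' (E →L[ℝ] ℝ)
      (E := fun x : M ↦ TangentSpace I x →L[ℝ] ℝ) x (η x)) x₀ :=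
  contMDiffAt_hom_of_tangentFrame fun u ↦ (contMDiffAt_trivial_section contMDiffAt_id).2 (h u)

/-- A field of bilinear forms is smooth as soon as its values on the local frames are. -/
theorem contMDiffAt_bilin_of_tangentFrame
    {B : ∀ x : M, TangentSpace I x →L[ℝ] TangentSpace I x →L[ℝ] ℝ} {x₀ : M}
    (h : ∀ u v, ContMDiffAt I 𝓘(ℝ, ℝ) ∞
      (fun x ↦ B x (tangentFrame I x₀ u x) (tangentFrame I x₀ v x)) x₀) :
    ContMDiffAt I (I.prod 𝓘(ℝ, E →L[ℝ] E →L[ℝ] ℝ)) ∞ (fun x ↦ TotalSpace.mk' (E →L[ℝ] E →L[ℝ] ℝ)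
      (E := fun x : M ↦ TangentSpace I x →L[ℝ] TangentSpace I x →L[ℝ] ℝ) x (B x)) x₀ :=
  contMDiffAt_hom_of_tangentFrame fun u ↦
    contMDiffAt_oneForm_of_tangentFrame (η := fun x ↦ B x (tangentFrame I x₀ u x)) (h u)

end

section Apply

variable {E' : Type*} [NormedAddCommGroup E'] [NormedSpace ℝ E'] {H' : Type*}
    [TopologicalSpace H'] {I' : ModelWithCorners ℝ E' H'} {N : Type*} [TopologicalSpace N]
    [ChartedSpace H' N] {b : N → M} {x₀ : N} {v w : ∀ x, TangentSpace I (b x)}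

theorem contMDiffAt_oneForm_apply {η : ∀ x : M, TangentSpace I x →L[ℝ] ℝ}
    (hη : ContMDiffAt I (I.prod 𝓘(ℝ, E →L[ℝ] ℝ)) ∞ (fun x ↦ TotalSpace.mk' (E →L[ℝ] ℝ)
      (E := fun x : M ↦ TangentSpace I x →L[ℝ] ℝ) x (η x)) (b x₀))
    (hv : ContMDiffAt I' (I.prod 𝓘(ℝ, E)) ∞ (fun x ↦ TotalSpace.mk' E (b x) (v x)) x₀) :
    ContMDiffAt I' 𝓘(ℝ, ℝ) ∞ (fun x ↦ η (b x) (v x)) x₀ := by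
  have hb : ContMDiffAt I' I ∞ b x₀ := (contMDiffAt_totalSpace.1 hv).1
  refine (contMDiffAt_trivial_section hb).1 ?_
  exact ContMDiffAt.clm_bundle_apply (E₁ := (TangentSpace I : M → Type _)) (E₂ := fun _ : M ↦ ℝ)
    (hη.comp x₀ hb) hv

theorem contMDiffAt_bilin_apply {B : ∀ x : M, TangentSpace I x →L[ℝ] TangentSpace I x →L[ℝ] ℝ}
    (hB : ContMDiffAt I (I.prod 𝓘(ℝ, E →L[ℝ] E →L[ℝ] ℝ)) ∞
      (fun x ↦ TotalSpace.mk' (E →L[ℝ] E →L[ℝ] ℝ)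
      (E := fun x : M ↦ TangentSpace I x →L[ℝ] TangentSpace I x →L[ℝ] ℝ) x (B x)) (b x₀))
    (hv : ContMDiffAt I' (I.prod 𝓘(ℝ, E)) ∞ (fun x ↦ TotalSpace.mk' E (b x) (v x)) x₀)
    (hw : ContMDiffAt I' (I.prod 𝓘(ℝ, E)) ∞ (fun x ↦ TotalSpace.mk' E (b x) (w x)) x₀) :
    ContMDiffAt I' 𝓘(ℝ, ℝ) ∞ (fun x ↦ B (b x) (v x) (w x)) x₀ := by
  have hb : ContMDiffAt I' I ∞ b x₀ := (contMDiffAt_totalSpace.1 hv).1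
  refine (contMDiffAt_trivial_section hb).1 ?_
  exact ContMDiffAt.clm_bundle_apply₂ (E₁ := (TangentSpace I : M → Type _))
    (E₂ := (TangentSpace I : M → Type _)) (E₃ := fun _ : M ↦ ℝ) (hB.comp x₀ hb) hv hw

end Apply

variable [FiniteDimensional ℝ E]

/-- The flat local metric of the trivialization at `x₀`. -/
def flatMetric (I : ModelWithCorners ℝ E H) {M : Type*} [TopologicalSpace M] [ChartedSpace H M]
    [IsManifold I ∞ M] (x₀ x : M) : TangentSpace I x →L[ℝ] TangentSpace I x →L[ℝ] ℝ :=
  let L : E →L[ℝ] EuclideanSpace ℝ (Fin (Module.finrank ℝ E)) :=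
    (toEuclidean (E := E) : E →L[ℝ] EuclideanSpace ℝ (Fin (Module.finrank ℝ E))).comp
      ((trivializationAt E (TangentSpace I : M → Type _) x₀).continuousLinearMapAt ℝ x)
  (innerSL ℝ).bilinearComp (E' := E) (F' := E) L L

theorem flatMetric_apply (x₀ x : M) (v w : TangentSpace I x) :
    flatMetric I x₀ x v w = inner ℝ
      (toEuclidean ((trivializationAt E (TangentSpace I : M → Type _) x₀).continuousLinearMapAt ℝ x v))
      (toEuclidean ((trivializationAt E (TangentSpace I : M → Type _) x₀).continuousLinearMapAt ℝ x w)) :=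
  rfl

theorem contMDiffAt_flatMetric (x₀ : M) {x : M}
    (hx : x ∈ (trivializationAt E (TangentSpace I : M → Type _) x₀).baseSet) :
    ContMDiffAt I (I.prod 𝓘(ℝ, E →L[ℝ] E →L[ℝ] ℝ)) ∞ (fun x ↦ TotalSpace.mk' (E →L[ℝ] E →L[ℝ] ℝ)
      (E := fun x : M ↦ TangentSpace I x →L[ℝ] TangentSpace I x →L[ℝ] ℝ) x
      (flatMetric I x₀ x)) x := by
  refine contMDiffAt_bilin_of_tangentFrame fun u v ↦ ?_
  have key : ∀ u : E, ContMDiffAt I 𝓘(ℝ, EuclideanSpace ℝ (Fin (Module.finrank ℝ E))) ∞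
      (fun y ↦ toEuclidean ((trivializationAt E (TangentSpace I : M → Type _)
        x₀).continuousLinearMapAt ℝ y (tangentFrame I x u y))) x := by
    intro u
    have h := contMDiffAt_tangentFrame (I := I) x u (mem_baseSet_trivializationAt E _ x)
    rw [(trivializationAt E (TangentSpace I : M → Type _) x₀).contMDiffAt_section_iff hx] at h
    refine ((toEuclidean (E := E)).contDiff.contMDiff.contMDiffAt.comp x h).congr_of_eventuallyEq ?_
    filter_upwards [(trivializationAt E (TangentSpace I : M → Type _) x₀).open_baseSet.mem_nhds hx]
      with y hy
    simp [Trivialization.coe_linearMapAt_of_mem _ hy]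
  exact ((isBoundedBilinearMap_inner (𝕜 := ℝ)
    (E := EuclideanSpace ℝ (Fin (Module.finrank ℝ E)))).contDiff.contMDiff.contMDiffAt).comp x
    ((key u).prodMk_space (key v))

set_option synthInstance.maxHeartbeats 200000 in
set_option maxHeartbeats 1000000 in
/-- Smooth bilinear forms satisfying a pointwise convex condition exist as soon as they exist
locally. -/
theorem exists_bilin_forall_mem_convex_of_local [T2Space M] [SigmaCompactSpace M]
    (t : ∀ x : M, Set (TangentSpace I x →L[ℝ] TangentSpace I x →L[ℝ] ℝ))
    (ht : ∀ x, Convex ℝ (t x))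
    (hloc : ∀ x₀ : M, ∃ U ∈ 𝓝 x₀,
      ∃ s : (x : M) → (TangentSpace I x →L[ℝ] TangentSpace I x →L[ℝ] ℝ),
      (∀ x ∈ U, ContMDiffAt I (I.prod 𝓘(ℝ, E →L[ℝ] E →L[ℝ] ℝ)) ∞
        (fun x ↦ TotalSpace.mk' (E →L[ℝ] E →L[ℝ] ℝ)
        (E := fun x : M ↦ TangentSpace I x →L[ℝ] TangentSpace I x →L[ℝ] ℝ) x (s x)) x) ∧
      ∀ y ∈ U, s y ∈ t y) :
    ∃ s : Cₛ^∞⟮I; E →L[ℝ] E →L[ℝ] ℝ,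
      fun x : M ↦ (TangentSpace I x →L[ℝ] TangentSpace I x →L[ℝ] ℝ)⟯, ∀ x, s x ∈ t x := by
  refine exists_contMDiffSection_forall_mem_convex_of_local I (n := ⊤) _ t ht fun x₀ ↦ ?_
  obtain ⟨U, hU, s, hs, hs'⟩ := hloc x₀
  exact ⟨U, hU, s, fun x hx ↦ (hs x hx).contMDiffWithinAt, hs'⟩

theorem exists_smoothMetric [T2Space M] [SigmaCompactSpace M] : Nonempty (SmoothMetric I M) := by
  obtain ⟨s, hs⟩ := exists_bilin_forall_mem_convex_of_local (I := I) (M := M) _ convex_posDef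
    fun x₀ ↦ by
      set e := trivializationAt E (TangentSpace I : M → Type _) x₀ with he
      have hx₀ : x₀ ∈ e.baseSet := mem_baseSet_trivializationAt E _ x₀
      refine ⟨e.baseSet, e.open_baseSet.mem_nhds hx₀, flatMetric I x₀,
        fun x hx ↦ contMDiffAt_flatMetric x₀ hx, fun x hx ↦ ⟨?_, ?_⟩⟩
      · intro v w
        rw [flatMetric_apply, flatMetric_apply, real_inner_comm]
      · intro v hv
        rw [flatMetric_apply, real_inner_self_eq_norm_sq]
        refine sq_pos_of_pos (norm_pos_iff.2 fun h ↦ hv ?_)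
        have h' := (toEuclidean (E := E)).map_eq_zero_iff.1 h
        rw [← e.coe_continuousLinearEquivAt_eq hx] at h'
        exact (e.continuousLinearEquivAt ℝ x hx).map_eq_zero_iff.1 h'
  exact ⟨⟨fun x ↦ s x, fun x ↦ (hs x).1, fun x ↦ (hs x).2, fun x ↦
      isVonNBounded_of_pos (E := E) (s x) (hs x).2, s.contMDiff⟩⟩

end SmoothFields

section VectorDerivative

variable {E : Type*} [NormedAddCommGroup E] [NormedSpace ℝ E]
  {H : Type*} [TopologicalSpace H] {I : ModelWithCorners ℝ E H}
  {M : Type*} [TopologicalSpace M] [ChartedSpace H M]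
  {F : Type*} [NormedAddCommGroup F] [NormedSpace ℝ F]
  {G : Type*} [NormedAddCommGroup G] [NormedSpace ℝ G]

theorem MDifferentiableAt.hasMFDerivAt_mvfderiv {f : M → F} {x : M}
    (hf : MDifferentiableAt I 𝓘(ℝ, F) f x) :
    HasMFDerivAt I 𝓘(ℝ, F) f x (d% f x : TangentSpace I x →L[ℝ] F) := hf.hasMFDerivAt

theorem mvfderiv_eq_of_hasMFDerivAt {f : M → F} {x : M} {f' : TangentSpace I x →L[ℝ] F}
    (hf : HasMFDerivAt I 𝓘(ℝ, F) f x f') : d% f x = f' := hf.mfderiv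

theorem mvfderiv_congr_of_eventuallyEq {f g : M → F} {x : M} (h : f =ᶠ[𝓝 x] g) :
    (d% f x : TangentSpace I x →L[ℝ] F) = d% g x := h.mfderiv_eq

theorem mvfderiv_clm_apply {A : M → F →L[ℝ] G} {v : M → F} {x : M}
    (hA : MDifferentiableAt I 𝓘(ℝ, F →L[ℝ] G) A x) (hv : MDifferentiableAt I 𝓘(ℝ, F) v x)
    (Z : TangentSpace I x) :
    d% (fun y ↦ A y (v y)) x Z = d% A x Z (v x) + A x (d% v x Z) := by
  have hp : HasMFDerivAt I 𝓘(ℝ, (F →L[ℝ] G) × F) (fun y ↦ (A y, v y)) x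
      ((d% A x : TangentSpace I x →L[ℝ] (F →L[ℝ] G)).prod (d% v x)) :=
    ⟨hA.hasMFDerivAt_mvfderiv.1.prodMk hv.hasMFDerivAt_mvfderiv.1,
      hA.hasMFDerivAt_mvfderiv.2.prodMk hv.hasMFDerivAt_mvfderiv.2⟩
  have h := HasMFDerivAt.comp x (I' := 𝓘(ℝ, (F →L[ℝ] G) × F)) (I'' := 𝓘(ℝ, G))
    (g := fun p : (F →L[ℝ] G) × F ↦ p.1 p.2)
    ((isBoundedBilinearMap_apply (𝕜 := ℝ) (E := F) (F := G)).hasFDerivAt (A x, v x)).hasMFDerivAt hp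
  have h' := mvfderiv_eq_of_hasMFDerivAt h
  have h'' := congrArg (fun T : TangentSpace I x →L[ℝ] G ↦ T Z) h'
  refine h''.trans ?_
  rw [add_comm]
  rfl

variable [IsManifold I ∞ M]

theorem contMDiffAt_mvfderiv_apply {f : M → F} {X : ∀ x : M, TangentSpace I x} {x : M}
    (hf : ContMDiffAt I 𝓘(ℝ, F) ∞ f x)
    (hX : ContMDiffAt I (I.prod 𝓘(ℝ, E)) ∞ (fun y ↦ TotalSpace.mk' E y (X y)) x) :
    ContMDiffAt I 𝓘(ℝ, F) ∞ (fun y ↦ d% f y (X y)) x := by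
  have h1 : ContMDiffAt I 𝓘(ℝ, E →L[ℝ] F) ∞
      (inTangentCoordinates I 𝓘(ℝ, F) id f (fun y ↦ mfderiv I 𝓘(ℝ, F) f y) x) x :=
    ContMDiffAt.mfderiv_const (m := ∞) (n := ∞) hf (by simp)
  have h2 := ContMDiffAt.clm_apply_of_inCoordinates (E₁ := (TangentSpace I : M → Type _))
    (E₂ := (TangentSpace 𝓘(ℝ, F) : F → Type _)) (b₁ := id) (b₂ := f) h1 hX hf
  exact (contMDiff_snd_tangentBundle_modelSpace F 𝓘(ℝ, F)).contMDiffAt.comp x h2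

end VectorDerivative

section LocalConnection

variable {E : Type*} [NormedAddCommGroup E] [NormedSpace ℝ E]
  {H : Type*} [TopologicalSpace H] {I : ModelWithCorners ℝ E H}
  {M : Type*} [TopologicalSpace M] [ChartedSpace H M] [IsManifold I ∞ M]

/-- The domain of the trivialization of the tangent bundle at `x₀`. -/
def tangentDomain (I : ModelWithCorners ℝ E H) {M : Type*} [TopologicalSpace M] [ChartedSpace H M]
    [IsManifold I ∞ M] (x₀ : M) : Set M :=
  (trivializationAt E (TangentSpace I : M → Type _) x₀).baseSet

theorem isOpen_tangentDomain (x₀ : M) : IsOpen (tangentDomain I x₀) :=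
  (trivializationAt E (TangentSpace I : M → Type _) x₀).open_baseSet

theorem mem_tangentDomain (x₀ : M) : x₀ ∈ tangentDomain I x₀ :=
  mem_baseSet_trivializationAt E _ x₀

/-- The trivialization of the tangent bundle at `x₀` over the point `x`. -/
def tangentCoord (I : ModelWithCorners ℝ E H) {M : Type*} [TopologicalSpace M] [ChartedSpace H M]
    [IsManifold I ∞ M] (x₀ x : M) : TangentSpace I x →L[ℝ] E :=
  (trivializationAt E (TangentSpace I : M → Type _) x₀).continuousLinearMapAt ℝ x

/-- The inverse of the trivialization of the tangent bundle at `x₀` over the point `x`. -/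
def tangentCoordSymm (I : ModelWithCorners ℝ E H) {M : Type*} [TopologicalSpace M]
    [ChartedSpace H M] [IsManifold I ∞ M] (x₀ x : M) : E →L[ℝ] TangentSpace I x :=
  (trivializationAt E (TangentSpace I : M → Type _) x₀).symmL ℝ x

theorem tangentCoord_symm {x₀ x : M} (hx : x ∈ tangentDomain I x₀) (u : E) :
    tangentCoord I x₀ x (tangentCoordSymm I x₀ x u) = u :=
  Trivialization.continuousLinearMapAt_symmL _ hx u

theorem tangentCoordSymm_coord {x₀ x : M} (hx : x ∈ tangentDomain I x₀) (v : TangentSpace I x) :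
    tangentCoordSymm I x₀ x (tangentCoord I x₀ x v) = v :=
  Trivialization.symmL_continuousLinearMapAt _ hx v

theorem tangentCoord_eventuallyEq {x₀ x : M} (hx : x ∈ tangentDomain I x₀)
    (σ : ∀ x : M, TangentSpace I x) :
    (fun y ↦ tangentCoord I x₀ y (σ y)) =ᶠ[𝓝 x] fun y ↦
      ((trivializationAt E (TangentSpace I : M → Type _) x₀) (TotalSpace.mk' E y (σ y))).2 := by
  filter_upwards [(isOpen_tangentDomain x₀).mem_nhds hx] with y hy
  simp [tangentCoord, Trivialization.coe_linearMapAt_of_mem _ hy]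

theorem contMDiffAt_tangentCoord_iff {x₀ x : M} (hx : x ∈ tangentDomain I x₀)
    {σ : ∀ x : M, TangentSpace I x} :
    ContMDiffAt I 𝓘(ℝ, E) ∞ (fun y ↦ tangentCoord I x₀ y (σ y)) x ↔
    ContMDiffAt I (I.prod 𝓘(ℝ, E)) ∞ (fun y ↦ TotalSpace.mk' E y (σ y)) x := by
  rw [(trivializationAt E (TangentSpace I : M → Type _) x₀).contMDiffAt_section_iff hx]
  exact (tangentCoord_eventuallyEq hx σ).contMDiffAt_iff

theorem mdifferentiableAt_tangentCoord {x₀ x : M} (hx : x ∈ tangentDomain I x₀)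
    {σ : ∀ x : M, TangentSpace I x}
    (hσ : MDifferentiableAt I (I.prod 𝓘(ℝ, E)) (fun y ↦ TotalSpace.mk' E y (σ y)) x) :
    MDifferentiableAt I 𝓘(ℝ, E) (fun y ↦ tangentCoord I x₀ y (σ y)) x :=
  (((trivializationAt E (TangentSpace I : M → Type _) x₀).mdifferentiableAt_section_iff I σ
    hx).1 hσ).congr_of_eventuallyEq (tangentCoord_eventuallyEq hx σ)

theorem contMDiffAt_tangentCoordSymm_apply {x₀ x : M} (hx : x ∈ tangentDomain I x₀) {f : M → E}
    (hf : ContMDiffAt I 𝓘(ℝ, E) ∞ f x) :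
    ContMDiffAt I (I.prod 𝓘(ℝ, E)) ∞
      (fun y ↦ TotalSpace.mk' E y (tangentCoordSymm I x₀ y (f y))) x := by
  refine (contMDiffAt_tangentCoord_iff hx).1 (hf.congr_of_eventuallyEq ?_)
  filter_upwards [(isOpen_tangentDomain x₀).mem_nhds hx] with y hy
  exact tangentCoord_symm hy _

/-- The connection `d + Γ` in the trivialization of the tangent bundle at `x₀`. -/
def localConnection (x₀ : M) (Γ : ∀ x : M, TangentSpace I x →L[ℝ] E →L[ℝ] E)
    (σ : ∀ x : M, TangentSpace I x) (x : M) : TangentSpace I x →L[ℝ] TangentSpace I x :=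
  (tangentCoordSymm I x₀ x).comp (mvfderiv I (fun y ↦ tangentCoord I x₀ y (σ y)) x +
    (ContinuousLinearMap.apply ℝ E (tangentCoord I x₀ x (σ x))).comp (Γ x))

theorem localConnection_apply (x₀ : M) (Γ : ∀ x : M, TangentSpace I x →L[ℝ] E →L[ℝ] E)
    (σ : ∀ x : M, TangentSpace I x) (x : M) (Z : TangentSpace I x) :
    localConnection x₀ Γ σ x Z = tangentCoordSymm I x₀ x
      (mvfderiv I (fun y ↦ tangentCoord I x₀ y (σ y)) x Z +
        Γ x Z (tangentCoord I x₀ x (σ x))) := rfl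

theorem isCovariantDerivativeOn_localConnection (x₀ : M)
    (Γ : ∀ x : M, TangentSpace I x →L[ℝ] E →L[ℝ] E) :
    IsCovariantDerivativeOn E (localConnection x₀ Γ) (tangentDomain I x₀) where
  add {σ σ' x} hσ hσ' hx := by
    ext Z
    have h : (fun y ↦ tangentCoord I x₀ y ((σ + σ') y)) =
        (fun y ↦ tangentCoord I x₀ y (σ y)) + fun y ↦ tangentCoord I x₀ y (σ' y) := by
      ext y
      simp
    rw [localConnection_apply, h, mvfderiv_add (mdifferentiableAt_tangentCoord hx hσ)
      (mdifferentiableAt_tangentCoord hx hσ')]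
    simp only [add_apply, localConnection_apply, Pi.add_apply, map_add]
    abel
  leibniz {σ g x} hσ hg hx := by
    ext Z
    have h : (fun y ↦ tangentCoord I x₀ y ((g • σ) y)) =
        g • (fun y ↦ tangentCoord I x₀ y (σ y)) := by
      ext y
      simp
    rw [localConnection_apply, h, mvfderiv_smul hg (mdifferentiableAt_tangentCoord hx hσ)]
    simp only [add_apply, smul_apply, localConnection_apply, Pi.smul_apply', map_add, map_smul,
      ContinuousLinearMap.smulRight_apply, tangentCoordSymm_coord hx, smul_add]
    abel

theorem contMDiffAt_localConnection [FiniteDimensional ℝ E] {x₀ x : M}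
    (hx : x ∈ tangentDomain I x₀) {Γ : ∀ x : M, TangentSpace I x →L[ℝ] E →L[ℝ] E}
    (hΓ : ∀ X : ∀ x : M, TangentSpace I x,
      ContMDiffAt I (I.prod 𝓘(ℝ, E)) ∞ (fun y ↦ TotalSpace.mk' E y (X y)) x →
      ContMDiffAt I 𝓘(ℝ, E →L[ℝ] E) ∞ (fun y ↦ Γ y (X y)) x)
    {σ : ∀ x : M, TangentSpace I x}
    (hσ : ContMDiffAt I (I.prod 𝓘(ℝ, E)) ∞ (fun y ↦ TotalSpace.mk' E y (σ y)) x) :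
    ContMDiffAt I (I.prod 𝓘(ℝ, E →L[ℝ] E)) ∞ (fun y ↦ TotalSpace.mk' (E →L[ℝ] E)
      (E := fun x : M ↦ TangentSpace I x →L[ℝ] TangentSpace I x) y
      (localConnection x₀ Γ σ y)) x := by
  refine contMDiffAt_hom_of_tangentFrame fun u ↦ ?_
  have hu := contMDiffAt_tangentFrame (I := I) x u (mem_baseSet_trivializationAt E _ x)
  have hσ' := (contMDiffAt_tangentCoord_iff hx).2 hσ
  exact contMDiffAt_tangentCoordSymm_apply hx
    ((contMDiffAt_mvfderiv_apply hσ' hu).add ((hΓ _ hu).clm_apply hσ'))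

end LocalConnection

section Gluing

variable {E : Type*} [NormedAddCommGroup E] [NormedSpace ℝ E]
  {H : Type*} [TopologicalSpace H] {I : ModelWithCorners ℝ E H}
  {M : Type*} [TopologicalSpace M] [ChartedSpace H M] [IsManifold I ∞ M]
  {ι : Type*} (ρ : SmoothPartitionOfUnity ι I M Set.univ)

/-- The combination of local connections with the weights of a partition of unity. -/
def gluedConnection
    (D : ι → (∀ x : M, TangentSpace I x) → ∀ x : M, TangentSpace I x →L[ℝ] TangentSpace I x)
    (σ : ∀ x : M, TangentSpace I x) (x : M) : TangentSpace I x →L[ℝ] TangentSpace I x :=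
  ∑ᶠ i, ρ i x • D i σ x

omit [IsManifold I ∞ M] in
theorem gluedConnection_eq_sum
    (D : ι → (∀ x : M, TangentSpace I x) → ∀ x : M, TangentSpace I x →L[ℝ] TangentSpace I x)
    (σ : ∀ x : M, TangentSpace I x) (x : M) :
    gluedConnection ρ D σ x = ∑ i ∈ ρ.finsupport x, ρ i x • D i σ x := by
  rw [gluedConnection]
  refine finsum_eq_sum_of_support_subset _ fun i hi ↦ ?_
  rw [ρ.coe_finsupport]
  exact left_ne_zero_of_smul hi

variable {ρ} {U : ι → Set M} (hρ : ρ.IsSubordinate U)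
include hρ

omit [IsManifold I ∞ M] in
theorem mem_of_mem_finsupport {i : ι} {x : M} (hi : i ∈ ρ.finsupport x) : x ∈ U i :=
  hρ i (subset_tsupport _ ((ρ.mem_finsupport x).1 hi))

theorem isCovariantDerivativeOn_gluedConnection
    {D : ι → (∀ x : M, TangentSpace I x) → ∀ x : M, TangentSpace I x →L[ℝ] TangentSpace I x}
    (hD : ∀ i, IsCovariantDerivativeOn E (D i) (U i)) :
    IsCovariantDerivativeOn E (gluedConnection ρ D) Set.univ where
  add {σ σ' x} hσ hσ' _ := by
    simp only [gluedConnection_eq_sum, ← Finset.sum_add_distrib, ← smul_add]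
    refine Finset.sum_congr rfl fun i hi ↦ ?_
    rw [(hD i).add hσ hσ' (mem_of_mem_finsupport hρ hi)]
  leibniz {σ g x} hσ hg _ := by
    simp only [gluedConnection_eq_sum, Finset.smul_sum]
    conv_rhs => rw [← one_smul ℝ ((d% g x).smulRight (σ x)), ← ρ.sum_finsupport x (Set.mem_univ x),
      Finset.sum_smul, ← Finset.sum_add_distrib]
    refine Finset.sum_congr rfl fun i hi ↦ ?_
    rw [(hD i).leibniz hσ hg (mem_of_mem_finsupport hρ hi), smul_add, smul_comm]

theorem contMDiff_gluedConnection (hU : ∀ i, IsOpen (U i))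
    {D : ι → (∀ x : M, TangentSpace I x) → ∀ x : M, TangentSpace I x →L[ℝ] TangentSpace I x}
    {σ : ∀ x : M, TangentSpace I x}
    (hD : ∀ i, ∀ x ∈ U i, ContMDiffAt I (I.prod 𝓘(ℝ, E →L[ℝ] E)) ∞
      (fun y ↦ TotalSpace.mk' (E →L[ℝ] E)
      (E := fun x : M ↦ TangentSpace I x →L[ℝ] TangentSpace I x) y (D i σ y)) x) :
    ContMDiff I (I.prod 𝓘(ℝ, E →L[ℝ] E)) ∞ (fun y ↦ TotalSpace.mk' (E →L[ℝ] E)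
      (E := fun x : M ↦ TangentSpace I x →L[ℝ] TangentSpace I x) y (gluedConnection ρ D σ y)) := by
  refine ContMDiff.finsum_section_of_locallyFinite (t := fun i x ↦ ρ i x • D i σ x) ?_ fun i ↦ ?_
  · refine ρ.locallyFinite.subset fun i x hx ↦ ?_
    exact left_ne_zero_of_smul (show ρ i x • D i σ x ≠ 0 from hx)
  · exact ContMDiffOn.smul_section_of_tsupport (ρ i).contMDiff.contMDiffOn (hU i) (hρ i)
      fun x hx ↦ (hD i x hx).contMDiffWithinAt

end Gluing

section GaugeAlgebra

variable {E : Type*} [NormedAddCommGroup E] [NormedSpace ℝ E]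

/-- The linear map `W ↦ (W + h ⊗ W k) / 2`. -/
def halfAddSmulRight {F : Type*} [NormedAddCommGroup F] [NormedSpace ℝ F] (h : E →L[ℝ] ℝ) (k : E) :
    (E →L[ℝ] F) →L[ℝ] E →L[ℝ] F :=
  (2⁻¹ : ℝ) • (ContinuousLinearMap.id ℝ (E →L[ℝ] F) +
    (ContinuousLinearMap.smulRightL ℝ E F h).comp (ContinuousLinearMap.apply ℝ F k))

/-- The linear map `W ↦ K ∘ (W + h ⊗ W (K h)) / 2`. -/
def gaugeSymbol (K : (E →L[ℝ] ℝ) →L[ℝ] E) (h : E →L[ℝ] ℝ) :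
    (E →L[ℝ] E →L[ℝ] ℝ) →L[ℝ] E →L[ℝ] E :=
  (ContinuousLinearMap.compL ℝ E (E →L[ℝ] ℝ) E K).comp (halfAddSmulRight h (K h))

theorem gaugeSymbol_apply (K : (E →L[ℝ] ℝ) →L[ℝ] E) (h : E →L[ℝ] ℝ) (W : E →L[ℝ] E →L[ℝ] ℝ)
    (u : E) : gaugeSymbol K h W u = K ((2⁻¹ : ℝ) • (W u + h u • W (K h))) := rfl

/-- The linear map `W ↦ L ∘ Wᵀ`. -/
def compFlip (L : (E →L[ℝ] ℝ) →L[ℝ] E) : (E →L[ℝ] E →L[ℝ] ℝ) →L[ℝ] E →L[ℝ] E :=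
  (ContinuousLinearMap.compL ℝ E (E →L[ℝ] ℝ) E L).comp
    ((ContinuousLinearMap.flipₗᵢ ℝ E E ℝ).toContinuousLinearEquiv :
      (E →L[ℝ] E →L[ℝ] ℝ) →L[ℝ] E →L[ℝ] E →L[ℝ] ℝ)

/-- The form `w + h ⊗ h`. -/
def addSquare (w : E →L[ℝ] E →L[ℝ] ℝ) (h : E →L[ℝ] ℝ) : E →L[ℝ] E →L[ℝ] ℝ := w + h.smulRight h

theorem addSquare_apply (w : E →L[ℝ] E →L[ℝ] ℝ) (h : E →L[ℝ] ℝ) (u v : E) :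
    addSquare w h u v = w u v + h u * h v := rfl

theorem skew_gaugeSymbol {w w' : E →L[ℝ] E →L[ℝ] ℝ} {h : E →L[ℝ] ℝ} {K : (E →L[ℝ] ℝ) →L[ℝ] E}
    (hw : ∀ v, w v v = 0) (hw' : ∀ v, w' v v = 0) (hΦ : ∀ v, (∀ u, addSquare w h v u = 0) → v = 0)
    (hK : ∀ α, addSquare w h (K α) = α) (hξ : ∃ ξ, (∀ v, w ξ v = 0) ∧ ∀ v, h ξ * h v = h v)
    (u v : E) :
    w (gaugeSymbol K h w' u) v - w (gaugeSymbol K h w' v) u = w' u v := by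
  obtain ⟨ξ, hξ, hhξ⟩ := hξ
  have skew : ∀ {w : E →L[ℝ] E →L[ℝ] ℝ}, (∀ v, w v v = 0) → ∀ a b, w a b = - w b a := by
    intro w hw a b
    have := hw (a + b)
    simp only [map_add, add_apply, hw] at this
    linarith
  have hKh : K h = ξ := by
    refine sub_eq_zero.1 (hΦ _ fun b ↦ ?_)
    rw [map_sub, sub_apply, hK, addSquare_apply, hξ, hhξ]
    simp
  have key : ∀ α b, w (K α) b = α b - α ξ * h b := by
    intro α b
    have h1 := congrArg (fun T : E →L[ℝ] ℝ ↦ T b) (hK α)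
    have h2 := congrArg (fun T : E →L[ℝ] ℝ ↦ T ξ) (hK α)
    simp only [addSquare_apply] at h1 h2
    rw [skew hw _ ξ, hξ] at h2
    rw [← h1, ← h2]
    linear_combination h (K α) * hhξ b
  simp only [gaugeSymbol_apply, key, hKh, smul_apply, add_apply, smul_eq_mul, hw']
  rw [skew hw' v u, skew hw' u ξ, skew hw' v ξ]
  ring

/-- The gauge equation for the infinitesimal variations of a metric `G`, a two-form `w` and the
endomorphism `t` determined by them. -/
theorem gauge_equation_of_variation {G G' w w' : E →L[ℝ] E →L[ℝ] ℝ} {t t' γ γ' : E →L[ℝ] E}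
    (hG : ∀ v, (∀ u, G v u = 0) → v = 0) (hGs : ∀ u v, G u v = G v u)
    (hGs' : ∀ u v, G' u v = G' v u) (hw : ∀ v, w v v = 0) (ht : ∀ u v, G (t u) v = w u v)
    (ht' : ∀ u v, G' (t u) v + G (t' u) v = w' u v)
    (hγ : ∀ u v, w (γ u) v - w (γ v) u = w' u v)
    (hγ' : ∀ u v, G (γ' v) u = G' u v - G (γ u) v) (u : E) :
    t' u + γ' (t u) = t (γ u) := by
  refine sub_eq_zero.1 (hG _ fun v ↦ ?_)
  have skew : ∀ a b, w a b = - w b a := by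
    intro a b
    have := hw (a + b)
    simp only [map_add, add_apply, hw] at this
    linarith
  have h1 := ht (γ u) v
  have h2 := ht' u v
  have h3 := hγ' v (t u)
  have h4 := ht u (γ v)
  have h5 := hγ u v
  rw [skew u] at h4
  rw [hGs _ (γ v)] at h4
  rw [hGs' (t u)] at h2
  simp only [map_sub, map_add, sub_apply, add_apply]
  linarith

end GaugeAlgebra

section LocalExpressions

variable {E : Type*} [NormedAddCommGroup E] [NormedSpace ℝ E]
  {H : Type*} [TopologicalSpace H] {I : ModelWithCorners ℝ E H}
  {M : Type*} [TopologicalSpace M] [ChartedSpace H M] [IsManifold I ∞ M]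

/-- A field of linear forms in the trivialization of the tangent bundle at `x₀`. -/
def localOneForm (x₀ : M) (η : ∀ x : M, TangentSpace I x →L[ℝ] ℝ) (x : M) : E →L[ℝ] ℝ :=
  (η x).comp (tangentCoordSymm I x₀ x)

theorem localOneForm_apply (x₀ : M) (η : ∀ x : M, TangentSpace I x →L[ℝ] ℝ) (x : M) (u : E) :
    localOneForm x₀ η x u = η x (tangentCoordSymm I x₀ x u) := rfl

/-- A field of bilinear forms in the trivialization of the tangent bundle at `x₀`. -/
def localBilin (x₀ : M) (B : ∀ x : M, TangentSpace I x →L[ℝ] TangentSpace I x →L[ℝ] ℝ) (x : M) :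
    E →L[ℝ] E →L[ℝ] ℝ :=
  ((ContinuousLinearMap.precomp ℝ (tangentCoordSymm I x₀ x)).comp (B x)).comp
    (tangentCoordSymm I x₀ x)

theorem localBilin_apply (x₀ : M) (B : ∀ x : M, TangentSpace I x →L[ℝ] TangentSpace I x →L[ℝ] ℝ)
    (x : M) (u v : E) :
    localBilin x₀ B x u v = B x (tangentCoordSymm I x₀ x u) (tangentCoordSymm I x₀ x v) := rfl

/-- A field of endomorphisms in the trivialization of the tangent bundle at `x₀`. -/
def localEnd (x₀ : M) (A : ∀ x : M, TangentSpace I x →L[ℝ] TangentSpace I x) (x : M) :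
    E →L[ℝ] E :=
  ((tangentCoord I x₀ x).comp (A x)).comp (tangentCoordSymm I x₀ x)

theorem localEnd_apply (x₀ : M) (A : ∀ x : M, TangentSpace I x →L[ℝ] TangentSpace I x) (x : M)
    (u : E) : localEnd x₀ A x u = tangentCoord I x₀ x (A x (tangentCoordSymm I x₀ x u)) := rfl

variable [FiniteDimensional ℝ E] {x₀ x : M} (hx : x ∈ tangentDomain I x₀)
include hx

theorem contMDiffAt_localOneForm (η : SmoothOneForm I M) :
    ContMDiffAt I 𝓘(ℝ, E →L[ℝ] ℝ) ∞ (localOneForm x₀ fun y ↦ η y) x :=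
  contMDiffAt_clm_of_apply fun _ ↦ contMDiffAt_oneForm_apply (I' := I) (b := id) (η.contMDiff x)
    (v := fun y ↦ tangentCoordSymm I x₀ y _)
    (contMDiffAt_tangentCoordSymm_apply hx contMDiffAt_const)

theorem contMDiffAt_localBilin
    {B : ∀ x : M, TangentSpace I x →L[ℝ] TangentSpace I x →L[ℝ] ℝ}
    (hB : ContMDiffAt I (I.prod 𝓘(ℝ, E →L[ℝ] E →L[ℝ] ℝ)) ∞
      (fun x ↦ TotalSpace.mk' (E →L[ℝ] E →L[ℝ] ℝ)
      (E := fun x : M ↦ TangentSpace I x →L[ℝ] TangentSpace I x →L[ℝ] ℝ) x (B x)) x) :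
    ContMDiffAt I 𝓘(ℝ, E →L[ℝ] E →L[ℝ] ℝ) ∞ (localBilin x₀ B) x :=
  contMDiffAt_clm_of_apply fun _ ↦ contMDiffAt_clm_of_apply fun _ ↦
    contMDiffAt_bilin_apply (I' := I) (b := id) hB
    (v := fun y ↦ tangentCoordSymm I x₀ y _) (w := fun y ↦ tangentCoordSymm I x₀ y _)
    (contMDiffAt_tangentCoordSymm_apply hx contMDiffAt_const)
    (contMDiffAt_tangentCoordSymm_apply hx contMDiffAt_const)

theorem contMDiffAt_localEnd (A : SmoothEndomorphismField I M) :
    ContMDiffAt I 𝓘(ℝ, E →L[ℝ] E) ∞ (localEnd x₀ fun y ↦ A y) x :=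
  contMDiffAt_clm_of_apply fun _ ↦ (contMDiffAt_tangentCoord_iff hx).2 <|
    ContMDiffAt.clm_bundle_apply (E₁ := (TangentSpace I : M → Type _))
      (E₂ := (TangentSpace I : M → Type _)) (A.contMDiff x)
    (v := fun y ↦ tangentCoordSymm I x₀ y _)
    (contMDiffAt_tangentCoordSymm_apply hx contMDiffAt_const)

omit [FiniteDimensional ℝ E] in
theorem localBilin_nondegenerate
    {B : ∀ x : M, TangentSpace I x →L[ℝ] TangentSpace I x →L[ℝ] ℝ}
    (hB : ∀ v, (∀ u, B x v u = 0) → v = 0) (v : E) (hv : ∀ u, localBilin x₀ B x v u = 0) :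
    v = 0 := by
  have h := hB (tangentCoordSymm I x₀ x v) fun u ↦ by
    rw [← tangentCoordSymm_coord hx u]
    exact hv _
  rw [← tangentCoord_symm hx v, h, map_zero]

omit hx in
/-- The inverse of a smooth field of non-degenerate bilinear forms is smooth. -/
theorem contMDiffAt_inverse_bilin {N : Type*} [TopologicalSpace N] [ChartedSpace H N]
    {W : N → E →L[ℝ] E →L[ℝ] ℝ} {y : N} (hW : ContMDiffAt I 𝓘(ℝ, E →L[ℝ] E →L[ℝ] ℝ) ∞ W y)
    (hnd : ∀ v, (∀ u, W y v u = 0) → v = 0) :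
    ContMDiffAt I 𝓘(ℝ, (E →L[ℝ] ℝ) →L[ℝ] E) ∞ (fun z ↦ (W z).inverse) y :=
  (contDiffAt_map_inverse (n := ∞) (bilinEquiv (W y) hnd)).contMDiffAt.comp y hW

omit hx in
theorem apply_inverse_bilin (W : E →L[ℝ] E →L[ℝ] ℝ) (hnd : ∀ v, (∀ u, W v u = 0) → v = 0)
    (α : E →L[ℝ] ℝ) : W (W.inverse α) = α := by
  have h : W.inverse = ((bilinEquiv W hnd).symm : (E →L[ℝ] ℝ) →L[ℝ] E) :=
    ContinuousLinearMap.inverse_equiv (bilinEquiv W hnd)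
  rw [h]
  exact bilinEquiv_symm_apply W hnd α

end LocalExpressions

section LocalGauge

variable {E : Type*} [NormedAddCommGroup E] [NormedSpace ℝ E]
  {H : Type*} [TopologicalSpace H] {I : ModelWithCorners ℝ E H}
  {M : Type*} [TopologicalSpace M] [ChartedSpace H M]

theorem mvfderiv_clm_apply_const {F G : Type*} [NormedAddCommGroup F] [NormedSpace ℝ F]
    [NormedAddCommGroup G] [NormedSpace ℝ G] {A : M → F →L[ℝ] G} {x : M}
    (hA : MDifferentiableAt I 𝓘(ℝ, F →L[ℝ] G) A x) (v : F) (Z : TangentSpace I x) :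
    d% (fun y ↦ A y v) x Z = d% A x Z v := by
  rw [mvfderiv_clm_apply hA mdifferentiableAt_const, mvfderiv_const]
  simp

variable [IsManifold I ∞ M] [FiniteDimensional ℝ E]

/-- A family of local connection forms depends smoothly on the point. -/
def IsSmoothConnectionForm (Γ : ∀ x : M, TangentSpace I x →L[ℝ] E →L[ℝ] E) (x : M) : Prop :=
  ∀ X : ∀ x : M, TangentSpace I x,
    ContMDiffAt I (I.prod 𝓘(ℝ, E)) ∞ (fun y ↦ TotalSpace.mk' E y (X y)) x →
    ContMDiffAt I 𝓘(ℝ, E →L[ℝ] E) ∞ (fun y ↦ Γ y (X y)) x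

end LocalGauge

section LocalGauge

variable {E : Type*} [NormedAddCommGroup E] [NormedSpace ℝ E] [FiniteDimensional ℝ E]
  {H : Type*} [TopologicalSpace H] {I : ModelWithCorners ℝ E H}
  {M : Type*} [TopologicalSpace M] [ChartedSpace H M] [IsManifold I ∞ M]

/-- The connection form of the first connection of a dual pair solving the gauge equation. -/
def gaugeForm (W : M → E →L[ℝ] E →L[ℝ] ℝ) (h : M → E →L[ℝ] ℝ) (x : M) :
    TangentSpace I x →L[ℝ] E →L[ℝ] E :=
  (gaugeSymbol (addSquare (W x) (h x)).inverse (h x)).comp (mvfderiv I W x)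

omit [FiniteDimensional ℝ E] [IsManifold I ∞ M] in
theorem gaugeForm_apply (W : M → E →L[ℝ] E →L[ℝ] ℝ) (h : M → E →L[ℝ] ℝ) (x : M)
    (Z : TangentSpace I x) : gaugeForm W h x Z =
      gaugeSymbol (addSquare (W x) (h x)).inverse (h x) (mvfderiv I W x Z) := rfl

/-- The connection form which is dual to `Γ` with respect to the metric `G`. -/
def dualForm (G : M → E →L[ℝ] E →L[ℝ] ℝ) (Γ : ∀ x : M, TangentSpace I x →L[ℝ] E →L[ℝ] E) (x : M) :
    TangentSpace I x →L[ℝ] E →L[ℝ] E :=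
  (compFlip (G x).inverse).comp (mvfderiv I G x) -
    (compFlip (G x).inverse).comp
      ((ContinuousLinearMap.compL ℝ E E (E →L[ℝ] ℝ) (G x)).comp (Γ x))

omit [FiniteDimensional ℝ E] [IsManifold I ∞ M] in
theorem dualForm_apply (G : M → E →L[ℝ] E →L[ℝ] ℝ)
    (Γ : ∀ x : M, TangentSpace I x →L[ℝ] E →L[ℝ] E) (x : M) (Z : TangentSpace I x) (v : E) :
    dualForm G Γ x Z v = (G x).inverse ((mvfderiv I G x Z : E →L[ℝ] E →L[ℝ] ℝ).flip v) -
      (G x).inverse (((G x).comp (Γ x Z)).flip v) := rfl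

theorem isSmoothConnectionForm_gaugeForm {W : M → E →L[ℝ] E →L[ℝ] ℝ} {h : M → E →L[ℝ] ℝ} {x : M}
    (hW : ContMDiffAt I 𝓘(ℝ, E →L[ℝ] E →L[ℝ] ℝ) ∞ W x) (hh : ContMDiffAt I 𝓘(ℝ, E →L[ℝ] ℝ) ∞ h x)
    (nd : ∀ v, (∀ u, addSquare (W x) (h x) v u = 0) → v = 0) :
    IsSmoothConnectionForm (I := I) (gaugeForm W h) x := by
  intro X hX
  have hA : ContMDiffAt I 𝓘(ℝ, E →L[ℝ] E →L[ℝ] ℝ) ∞ (fun y ↦ addSquare (W y) (h y)) x :=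
    contMDiffAt_clm_of_apply fun u ↦ (hW.clm_apply contMDiffAt_const).add
      ((hh.clm_apply contMDiffAt_const).smul hh)
  have hK : ContMDiffAt I 𝓘(ℝ, (E →L[ℝ] ℝ) →L[ℝ] E) ∞ (fun y ↦ (addSquare (W y) (h y)).inverse) x :=
    contMDiffAt_inverse_bilin hA nd
  refine contMDiffAt_clm_of_apply fun u ↦ ?_
  have h1 := contMDiffAt_mvfderiv_apply hW hX
  have h2 := (h1.clm_apply (contMDiffAt_const (c := u))).add
    ((hh.clm_apply (contMDiffAt_const (c := u))).smul (h1.clm_apply (hK.clm_apply hh)))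
  exact hK.clm_apply ((contMDiffAt_const (I' := 𝓘(ℝ, ℝ)) (c := (2⁻¹ : ℝ))).smul h2)

theorem isSmoothConnectionForm_dualForm {G : M → E →L[ℝ] E →L[ℝ] ℝ}
    {Γ : ∀ x : M, TangentSpace I x →L[ℝ] E →L[ℝ] E} {x : M}
    (hG : ContMDiffAt I 𝓘(ℝ, E →L[ℝ] E →L[ℝ] ℝ) ∞ G x) (hΓ : IsSmoothConnectionForm Γ x)
    (nd : ∀ v, (∀ u, G x v u = 0) → v = 0) :
    IsSmoothConnectionForm (I := I) (dualForm G Γ) x := by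
  intro X hX
  have hL := contMDiffAt_inverse_bilin hG nd
  refine contMDiffAt_clm_of_apply fun v ↦ ?_
  have h1 := contMDiffAt_mvfderiv_apply hG hX
  have h2 : ContMDiffAt I 𝓘(ℝ, E →L[ℝ] ℝ) ∞
      (fun y ↦ (mvfderiv I G y (X y) : E →L[ℝ] E →L[ℝ] ℝ).flip v) x :=
    contMDiffAt_clm_of_apply fun u ↦
      (h1.clm_apply (contMDiffAt_const (c := u))).clm_apply (contMDiffAt_const (c := v))
  have h3 : ContMDiffAt I 𝓘(ℝ, E →L[ℝ] ℝ) ∞ (fun y ↦ ((G y).comp (Γ y (X y))).flip v) x :=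
    contMDiffAt_clm_of_apply fun u ↦
      (hG.clm_apply ((hΓ X hX).clm_apply (contMDiffAt_const (c := u)))).clm_apply
        (contMDiffAt_const (c := v))
  exact (hL.clm_apply h2).sub (hL.clm_apply h3)

omit [IsManifold I ∞ M] in
theorem apply_dualForm {G : M → E →L[ℝ] E →L[ℝ] ℝ} (Γ : ∀ x : M, TangentSpace I x →L[ℝ] E →L[ℝ] E)
    {x : M} (nd : ∀ v, (∀ u, G x v u = 0) → v = 0) (Z : TangentSpace I x) (u v : E) :
    G x (dualForm G Γ x Z v) u = mvfderiv I G x Z u v - G x (Γ x Z u) v := by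
  rw [dualForm_apply, map_sub, apply_inverse_bilin _ nd, apply_inverse_bilin _ nd]
  rfl

omit [IsManifold I ∞ M] in
theorem gauge_equation_gaugeForm {G W : M → E →L[ℝ] E →L[ℝ] ℝ} {h : M → E →L[ℝ] ℝ}
    {t : M → E →L[ℝ] E} {x : M}
    (cG : ContMDiffAt I 𝓘(ℝ, E →L[ℝ] E →L[ℝ] ℝ) ∞ G x)
    (cW : ContMDiffAt I 𝓘(ℝ, E →L[ℝ] E →L[ℝ] ℝ) ∞ W x)
    (ct : ContMDiffAt I 𝓘(ℝ, E →L[ℝ] E) ∞ t x)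
    (ndG : ∀ v, (∀ u, G x v u = 0) → v = 0)
    (ndΦ : ∀ v, (∀ u, addSquare (W x) (h x) v u = 0) → v = 0)
    (hξ : ∃ ξ, (∀ v, W x ξ v = 0) ∧ ∀ v, h x ξ * h x v = h x v)
    (symG : ∀ y u v, G y u v = G y v u) (altW : ∀ y v, W y v v = 0)
    (hGt : ∀ᶠ y in 𝓝 x, ∀ u v, G y (t y u) v = W y u v) (Z : TangentSpace I x) (u : E) :
    mvfderiv I t x Z u + dualForm G (gaugeForm W h) x Z (t x u) = t x (gaugeForm W h x Z u) := by
  have dG := cG.mdifferentiableAt (by simp)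
  have dW := cW.mdifferentiableAt (by simp)
  have dt := ct.mdifferentiableAt (by simp)
  have eG : ∀ u v, mvfderiv I (fun y ↦ G y u v) x Z = mvfderiv I G x Z u v := fun u v ↦ by
    rw [mvfderiv_clm_apply_const
      ((cG.clm_apply (contMDiffAt_const (c := u))).mdifferentiableAt (by simp)),
      mvfderiv_clm_apply_const dG]
  have eW : ∀ u v, mvfderiv I (fun y ↦ W y u v) x Z = mvfderiv I W x Z u v := fun u v ↦ by
    rw [mvfderiv_clm_apply_const
      ((cW.clm_apply (contMDiffAt_const (c := u))).mdifferentiableAt (by simp)),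
      mvfderiv_clm_apply_const dW]
  have eGt : ∀ u v, mvfderiv I (fun y ↦ G y (t y u) v) x Z =
      mvfderiv I G x Z (t x u) v + G x (mvfderiv I t x Z u) v := fun u v ↦ by
    have ctu := ct.clm_apply (contMDiffAt_const (c := u))
    rw [mvfderiv_clm_apply_const ((cG.clm_apply ctu).mdifferentiableAt (by simp)),
      mvfderiv_clm_apply dG (ctu.mdifferentiableAt (by simp)), mvfderiv_clm_apply_const dt]
    rfl
  have altW' : ∀ v, mvfderiv I W x Z v v = 0 := fun v ↦ by
    rw [← eW, show (fun y ↦ W y v v) = fun _ ↦ (0 : ℝ) from funext fun y ↦ altW y v,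
      mvfderiv_const]
    rfl
  refine gauge_equation_of_variation (G := G x) (G' := mvfderiv I G x Z) (w := W x)
    (w' := mvfderiv I W x Z) ndG (symG x) (fun u v ↦ ?_) (altW x) hGt.self_of_nhds
    (fun u v ↦ ?_) (fun u v ↦ ?_) (apply_dualForm _ ndG Z) u
  · rw [← eG, ← eG]
    simp only [symG _ u v]
  · rw [← eGt, ← eW]
    refine congrArg (fun T : TangentSpace I x →L[ℝ] ℝ ↦ T Z)
      (mvfderiv_congr_of_eventuallyEq ?_)
    filter_upwards [hGt] with y hy
    exact hy u v
  · rw [gaugeForm_apply]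
    exact skew_gaugeSymbol (altW x) altW' ndΦ (apply_inverse_bilin _ ndΦ) hξ u v

end LocalGauge

section GaugeSolution

variable {E : Type*} [NormedAddCommGroup E] [NormedSpace ℝ E] [FiniteDimensional ℝ E]
  {H : Type*} [TopologicalSpace H] {I : ModelWithCorners ℝ E H}
  {M : Type*} [TopologicalSpace M] [ChartedSpace H M] [IsManifold I ∞ M]

theorem dual_localConnection (g : SmoothMetric I M) {x₀ x : M} (hx : x ∈ tangentDomain I x₀)
    {Γ Γ' : ∀ x : M, TangentSpace I x →L[ℝ] E →L[ℝ] E} {Z : TangentSpace I x}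
    (h : ∀ u v, mvfderiv I (localBilin x₀ fun y ↦ g.inner y) x Z u v =
      localBilin x₀ (fun y ↦ g.inner y) x (Γ x Z u) v +
      localBilin x₀ (fun y ↦ g.inner y) x u (Γ' x Z v)) (X Y : SmoothVectorField I M) :
    mvfderiv I (fun y : M ↦ g.inner y (X y) (Y y)) x Z =
      g.inner x (localConnection x₀ Γ X x Z) (Y x) +
      g.inner x (X x) (localConnection x₀ Γ' Y x Z) := by
  have cG := contMDiffAt_localBilin hx (g.contMDiff x)
  have cX := (contMDiffAt_tangentCoord_iff hx).2 (X.contMDiff x)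
  have cY := (contMDiffAt_tangentCoord_iff hx).2 (Y.contMDiff x)
  have heq : (fun y : M ↦ g.inner y (X y) (Y y)) =ᶠ[𝓝 x] fun y ↦
      localBilin x₀ (fun y ↦ g.inner y) y (tangentCoord I x₀ y (X y))
        (tangentCoord I x₀ y (Y y)) := by
    filter_upwards [(isOpen_tangentDomain x₀).mem_nhds hx] with y hy
    rw [localBilin_apply, tangentCoordSymm_coord hy, tangentCoordSymm_coord hy]
  have h0 : mvfderiv I (fun y : M ↦ g.inner y (X y) (Y y)) x Z = _ :=
    congrArg (fun T : TangentSpace I x →L[ℝ] ℝ ↦ T Z) (mvfderiv_congr_of_eventuallyEq heq)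
  rw [h0, mvfderiv_clm_apply ((cG.clm_apply cX).mdifferentiableAt (by simp))
    (cY.mdifferentiableAt (by simp)), mvfderiv_clm_apply (cG.mdifferentiableAt (by simp))
    (cX.mdifferentiableAt (by simp)), add_apply, h]
  have e1 : g.inner x (localConnection x₀ Γ X x Z) (Y x) =
      localBilin x₀ (fun y ↦ g.inner y) x
        (mvfderiv I (fun y ↦ tangentCoord I x₀ y (X y)) x Z + Γ x Z (tangentCoord I x₀ x (X x)))
        (tangentCoord I x₀ x (Y x)) := by
    rw [localBilin_apply, tangentCoordSymm_coord hx]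
    rfl
  have e2 : g.inner x (X x) (localConnection x₀ Γ' Y x Z) =
      localBilin x₀ (fun y ↦ g.inner y) x (tangentCoord I x₀ x (X x))
        (mvfderiv I (fun y ↦ tangentCoord I x₀ y (Y y)) x Z +
          Γ' x Z (tangentCoord I x₀ x (Y x))) := by
    rw [localBilin_apply, tangentCoordSymm_coord hx]
    rfl
  rw [e1, e2]
  simp only [map_add, add_apply]
  ring

theorem gauge_localConnection (θ : SmoothEndomorphismField I M) {x₀ x : M}
    (hx : x ∈ tangentDomain I x₀) {Γ Γ' : ∀ x : M, TangentSpace I x →L[ℝ] E →L[ℝ] E}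
    {Z : TangentSpace I x}
    (h : ∀ u, mvfderiv I (localEnd x₀ fun y ↦ θ y) x Z u +
      Γ' x Z (localEnd x₀ (fun y ↦ θ y) x u) = localEnd x₀ (fun y ↦ θ y) x (Γ x Z u))
    (Y : SmoothVectorField I M) :
    localConnection x₀ Γ' (fun y ↦ θ y (Y y)) x Z = θ x (localConnection x₀ Γ Y x Z) := by
  have ct := contMDiffAt_localEnd hx θ
  have cY := (contMDiffAt_tangentCoord_iff hx).2 (Y.contMDiff x)
  have hpt : ∀ y ∈ tangentDomain I x₀, tangentCoord I x₀ y (θ y (Y y)) =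
      localEnd x₀ (fun y ↦ θ y) y (tangentCoord I x₀ y (Y y)) := by
    intro y hy
    rw [localEnd_apply, tangentCoordSymm_coord hy]
  have heq : (fun y : M ↦ tangentCoord I x₀ y (θ y (Y y))) =ᶠ[𝓝 x] fun y ↦
      localEnd x₀ (fun y ↦ θ y) y (tangentCoord I x₀ y (Y y)) := by
    filter_upwards [(isOpen_tangentDomain x₀).mem_nhds hx] with y hy using hpt y hy
  have h0 : mvfderiv I (fun y : M ↦ tangentCoord I x₀ y (θ y (Y y))) x Z = _ :=
    congrArg (fun T : TangentSpace I x →L[ℝ] E ↦ T Z) (mvfderiv_congr_of_eventuallyEq heq)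
  rw [localConnection_apply, h0, mvfderiv_clm_apply (ct.mdifferentiableAt (by simp))
    (cY.mdifferentiableAt (by simp)), hpt x hx, add_right_comm, h, ← map_add, localEnd_apply,
    tangentCoordSymm_coord hx, localConnection_apply, add_comm]

omit [FiniteDimensional ℝ E] in
theorem nondegenerate_metric (g : SmoothMetric I M) (x : M) (v : TangentSpace I x)
    (hv : ∀ u, g.inner x v u = 0) : v = 0 := by
  by_contra hne
  exact (g.pos x v hne).ne' (hv v)

/-- Around every point there is a local dual pair which solves the gauge equation. -/
theorem exists_local_gauge_pair (g : SmoothMetric I M) (β : SmoothTwoForm I M)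
    (η : SmoothOneForm I M) (θ : SmoothEndomorphismField I M)
    (hθ : ∀ x u v, g.inner x (θ x u) v = β.toSection x u v)
    (hΦ : ∀ x v, (∀ u, β.toSection x v u + η x v * η x u = 0) → v = 0)
    (hξ : ∀ x, ∃ ξ, (∀ v, β.toSection x ξ v = 0) ∧ ∀ v, η x ξ * η x v = η x v) (x₀ : M) :
    ∃ Γ Γ' : ∀ x : M, TangentSpace I x →L[ℝ] E →L[ℝ] E, ∀ x ∈ tangentDomain I x₀,
      IsSmoothConnectionForm Γ x ∧ IsSmoothConnectionForm Γ' x ∧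
      ∀ (Z : TangentSpace I x) (X Y : SmoothVectorField I M),
        mvfderiv I (fun y : M ↦ g.inner y (X y) (Y y)) x Z =
          g.inner x (localConnection x₀ Γ X x Z) (Y x) +
          g.inner x (X x) (localConnection x₀ Γ' Y x Z) ∧
        localConnection x₀ Γ' (fun y ↦ θ y (Y y)) x Z = θ x (localConnection x₀ Γ Y x Z) := by
  refine ⟨gaugeForm (localBilin x₀ fun y ↦ β.toSection y) (localOneForm x₀ fun y ↦ η y),
    dualForm (localBilin x₀ fun y ↦ g.inner y)
    (gaugeForm (localBilin x₀ fun y ↦ β.toSection y) (localOneForm x₀ fun y ↦ η y)),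
    fun x hx ↦ ?_⟩
  have cG := contMDiffAt_localBilin hx (g.contMDiff x)
  have cW := contMDiffAt_localBilin hx (β.toSection.contMDiff x)
  have ch := contMDiffAt_localOneForm hx η
  have ndG := localBilin_nondegenerate (B := fun y ↦ g.inner y) hx (nondegenerate_metric g x)
  have ndΦ : ∀ v, (∀ u, addSquare (localBilin x₀ (fun y ↦ β.toSection y) x)
      (localOneForm x₀ (fun y ↦ η y) x) v u = 0) → v = 0 := by
    intro v hv
    have h1 := hΦ x (tangentCoordSymm I x₀ x v) fun u ↦ by
      rw [← tangentCoordSymm_coord hx u]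
      exact hv _
    rw [← tangentCoord_symm hx v, h1, map_zero]
  have cΓ := isSmoothConnectionForm_gaugeForm cW ch ndΦ
  refine ⟨cΓ, isSmoothConnectionForm_dualForm cG cΓ ndG, fun Z X Y ↦
    ⟨dual_localConnection g hx (fun u v ↦ ?_) X Y,
      gauge_localConnection θ hx (fun u ↦ ?_) Y⟩⟩
  · have sym : ∀ a b, localBilin x₀ (fun y ↦ g.inner y) x a b =
      localBilin x₀ (fun y ↦ g.inner y) x b a := fun a b ↦ g.symm x _ _
    rw [sym u, apply_dualForm _ ndG]
    ring
  · refine gauge_equation_gaugeForm cG cW (contMDiffAt_localEnd hx θ) ndG ndΦ ?_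
      (fun y _ _ ↦ g.symm y _ _) (fun y _ ↦ β.alternating y _) ?_ Z u
    · obtain ⟨ξ, h1, h2⟩ := hξ x
      refine ⟨tangentCoord I x₀ x ξ, fun v ↦ ?_, fun v ↦ ?_⟩
      · rw [localBilin_apply, tangentCoordSymm_coord hx, h1]
      · rw [localOneForm_apply, localOneForm_apply, tangentCoordSymm_coord hx, h2]
    · filter_upwards [(isOpen_tangentDomain x₀).mem_nhds hx] with y hy u v
      rw [localBilin_apply, localBilin_apply, localEnd_apply, tangentCoordSymm_coord hy, hθ]

variable [T2Space M] [SigmaCompactSpace M]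

theorem exists_gauge_pair (g : SmoothMetric I M) (β : SmoothTwoForm I M)
    (η : SmoothOneForm I M) (θ : SmoothEndomorphismField I M)
    (hθ : ∀ x u v, g.inner x (θ x u) v = β.toSection x u v)
    (hΦ : ∀ x v, (∀ u, β.toSection x v u + η x v * η x u = 0) → v = 0)
    (hξ : ∀ x, ∃ ξ, (∀ v, β.toSection x ξ v = 0) ∧ ∀ v, η x ξ * η x v = η x v) :
    ∃ D D' : AffineConnection I M, D.ContMDiffCovariantDerivative ∞ ∧
      D'.ContMDiffCovariantDerivative ∞ ∧ AreDualConnections g D D' ∧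
      SatisfiesGaugeEquation D D' θ := by
  choose Γ Γ' h using exists_local_gauge_pair g β η θ hθ hΦ hξ
  obtain ⟨ρ, hρ⟩ := SmoothPartitionOfUnity.exists_isSubordinate I isClosed_univ
    (tangentDomain I : M → Set M) isOpen_tangentDomain
    fun x _ ↦ Set.mem_iUnion.2 ⟨x, mem_tangentDomain x⟩
  have smooth : ∀ Γ : M → ∀ x : M, TangentSpace I x →L[ℝ] E →L[ℝ] E,
      (∀ x₀, ∀ x ∈ tangentDomain I x₀, IsSmoothConnectionForm (Γ x₀) x) →
      ContMDiffCovariantDerivativeOn E ∞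
        (gluedConnection ρ fun x₀ ↦ localConnection x₀ (Γ x₀)) Set.univ := by
    intro Γ hΓ
    refine ⟨fun {σ} hσ ↦ (contMDiff_gluedConnection hρ isOpen_tangentDomain
      fun x₀ x hx ↦ ?_).contMDiffOn⟩
    exact contMDiffAt_localConnection hx (hΓ x₀ x hx) (contMDiffOn_univ.1 hσ x)
  refine ⟨⟨_, isCovariantDerivativeOn_gluedConnection hρ fun x₀ ↦
    isCovariantDerivativeOn_localConnection x₀ (Γ x₀)⟩,
    ⟨_, isCovariantDerivativeOn_gluedConnection hρ fun x₀ ↦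
    isCovariantDerivativeOn_localConnection x₀ (Γ' x₀)⟩,
    ⟨smooth Γ fun x₀ x hx ↦ (h x₀ x hx).1⟩, ⟨smooth Γ' fun x₀ x hx ↦ (h x₀ x hx).2.1⟩, ?_, ?_⟩
  · intro X Y Z x
    change _ = g.inner x (gluedConnection ρ _ X x (Z x)) (Y x) +
      g.inner x (X x) (gluedConnection ρ _ Y x (Z x))
    rw [gluedConnection_eq_sum, gluedConnection_eq_sum]
    simp only [sum_apply, map_sum, smul_apply, map_smul, smul_eq_mul, ← Finset.sum_add_distrib]
    rw [← one_mul (mvfderiv I (fun y : M ↦ g.inner y (X y) (Y y)) x (Z x)),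
      ← ρ.sum_finsupport x (Set.mem_univ x), Finset.sum_mul]
    refine Finset.sum_congr rfl fun i hi ↦ ?_
    rw [((h i x (mem_of_mem_finsupport hρ hi)).2.2 (Z x) X Y).1, mul_add]
  · intro X Y x
    change gluedConnection ρ _ (fun y ↦ θ y (Y y)) x (X x) = θ x (gluedConnection ρ _ Y x (X x))
    rw [gluedConnection_eq_sum, gluedConnection_eq_sum]
    simp only [sum_apply, map_sum, smul_apply, map_smul]
    refine Finset.sum_congr rfl fun i hi ↦ ?_
    rw [((h i x (mem_of_mem_finsupport hρ hi)).2.2 (X x) Y Y).2]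

omit [T2Space M] [SigmaCompactSpace M] in
/-- The endomorphism field which represents a two-form with respect to a metric. -/
theorem exists_endomorphismField (g : SmoothMetric I M) (β : SmoothTwoForm I M) :
    ∃ θ : SmoothEndomorphismField I M, (∀ x u v, g.inner x (θ x u) v = β.toSection x u v) ∧
      ∀ x, Module.finrank ℝ (LinearMap.range (θ x).toLinearMap) =
        Module.finrank ℝ (LinearMap.range (β.toSection x).toLinearMap) := by
  let Φ : ∀ x : M, TangentSpace I x ≃L[ℝ] (TangentSpace I x →L[ℝ] ℝ) := fun x ↦
    bilinEquiv (E := E) (g.inner x) (nondegenerate_metric g x)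
  refine ⟨⟨fun x ↦ ((Φ x).symm : (TangentSpace I x →L[ℝ] ℝ) →L[ℝ] TangentSpace I x).comp
    (β.toSection x), fun x ↦ ?_⟩, fun x u v ↦ ?_, fun x ↦ ?_⟩
  · refine contMDiffAt_hom_of_tangentFrame fun u ↦ ?_
    refine contMDiffAt_symm_apply (V := fun x : M ↦ TangentSpace I x →L[ℝ] ℝ) (Φ := Φ)
      (g.contMDiff x) ?_
    exact ContMDiffAt.clm_bundle_apply (E₁ := (TangentSpace I : M → Type _))
      (E₂ := fun x : M ↦ TangentSpace I x →L[ℝ] ℝ) (β.toSection.contMDiff x)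
      (contMDiffAt_tangentFrame x u (mem_baseSet_trivializationAt E _ x))
  · exact congrArg (fun T : TangentSpace I x →L[ℝ] ℝ ↦ T v)
      ((Φ x).apply_symm_apply (β.toSection x u))
  · have hr : LinearMap.range (((Φ x).symm : (TangentSpace I x →L[ℝ] ℝ) →L[ℝ] TangentSpace I x).comp
        (β.toSection x)).toLinearMap = (LinearMap.range (β.toSection x).toLinearMap).map
        ((Φ x).symm.toLinearEquiv : (TangentSpace I x →L[ℝ] ℝ) →ₗ[ℝ] TangentSpace I x) :=
      LinearMap.range_comp _ _
    exact (congrArg (fun S : Submodule ℝ (TangentSpace I x) ↦ Module.finrank ℝ S) hr).trans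
      (LinearEquiv.finrank_map_eq _ _)

/-- A two-form `β` of rank `r`, together with a one-form `η` which spans the annihilator of a
complement of the kernel of `β`, gives rise to a skew-symmetric solution of the gauge equation. -/
theorem hasSkewGaugeSolution_of_twoForm {r : ℕ} (β : SmoothTwoForm I M) (η : SmoothOneForm I M)
    (hΦ : ∀ x v, (∀ u, β.toSection x v u + η x v * η x u = 0) → v = 0)
    (hξ : ∀ x, ∃ ξ, (∀ v, β.toSection x ξ v = 0) ∧ ∀ v, η x ξ * η x v = η x v)
    (hr : ∀ x, Module.finrank ℝ (LinearMap.range (β.toSection x).toLinearMap) = r) :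
    HasSkewGaugeSolution I M r := by
  obtain ⟨g⟩ := exists_smoothMetric (I := I) (M := M)
  obtain ⟨θ, hθ, hrank⟩ := exists_endomorphismField g β
  obtain ⟨D, D', hD, hD', hdual, hgauge⟩ := exists_gauge_pair g β η θ hθ hΦ hξ
  refine ⟨g, D, D', θ, hD, hD', hdual, hgauge, fun x v w ↦ ?_, fun x ↦ (hrank x).trans (hr x)⟩
  rw [hθ, g.symm, hθ]
  have h := β.alternating x (v + w)
  simp only [map_add, add_apply, β.alternating] at h
  linarith

end GaugeSolution

section Cosymplectic

variable {E : Type*} [NormedAddCommGroup E] [NormedSpace ℝ E] [FiniteDimensional ℝ E]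
  {H : Type*} [TopologicalSpace H] {I : ModelWithCorners ℝ E H}
  {M : Type*} [TopologicalSpace M] [ChartedSpace H M] [IsManifold I ∞ M]

omit [FiniteDimensional ℝ E] in
theorem SmoothTwoForm.skew (β : SmoothTwoForm I M) (x : M) (u v : TangentSpace I x) :
    β.toSection x u v = -β.toSection x v u := by
  have h := β.alternating x (u + v)
  simp only [map_add, add_apply, β.alternating] at h
  linarith

/-- The value of a two-form at a point as an algebraic bilinear form. -/
def SmoothTwoForm.linAt (β : SmoothTwoForm I M) (x : M) : E →ₗ[ℝ] E →ₗ[ℝ] ℝ :=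
  (ContinuousLinearMap.coeLM ℝ).comp (β.toSection x).toLinearMap

theorem wedge_ne_zero_iff {n : ℕ} (hE : Module.finrank ℝ E = 2 * n + 1) (β : SmoothTwoForm I M)
    (η : SmoothOneForm I M) (x : M) :
    wedge (wedgePow (β.altAt x) n) (SmoothOneForm.altAt η x) ≠ 0 ↔
      ∀ v, (∀ u, β.toSection x v u = 0) → η x v = 0 → v = 0 :=
  ⟨fun h v hv hη ↦ eq_zero_of_wedge_ne_zero hE (β.linAt x) (β.alternating x) (η x).toLinearMap
      h v hv hη,
    fun h ↦ wedge_ne_zero_of_ker_inf_ker_eq_zero hE (β.linAt x) (β.alternating x)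
      (η x).toLinearMap h⟩

theorem exists_reeb_of_wedge_ne_zero {n : ℕ} (hE : Module.finrank ℝ E = 2 * n + 1)
    (β : SmoothTwoForm I M) (η : SmoothOneForm I M) (x : M)
    (h : ∀ v, (∀ u, β.toSection x v u = 0) → η x v = 0 → v = 0) :
    Module.finrank ℝ (LinearMap.ker (β.linAt x)) = 1 ∧
      ∃ ξ, (∀ v, β.toSection x ξ v = 0) ∧ η x ξ = 1 := by
  obtain ⟨h1, -, ξ, -, h2, h3⟩ := exists_reeb_of_ker_inf_ker_eq_zero hE (β.linAt x)
    (β.alternating x) (η x).toLinearMap h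
  exact ⟨h1, ξ, h2, h3⟩

theorem finrank_range_add_finrank_ker_linAt (β : SmoothTwoForm I M) (x : M) :
    Module.finrank ℝ (LinearMap.range (β.toSection x).toLinearMap) +
      Module.finrank ℝ (LinearMap.ker (β.linAt x)) = Module.finrank ℝ E := by
  have h : LinearMap.ker (β.linAt x) = LinearMap.ker (β.toSection x).toLinearMap := by
    ext v
    exact ⟨fun h ↦ ContinuousLinearMap.ext fun u ↦ congrArg (fun T : E →ₗ[ℝ] ℝ ↦ T u) h,
      fun h ↦ LinearMap.ext fun u ↦
        congrArg (fun T : TangentSpace I x →L[ℝ] ℝ ↦ T u) (show β.toSection x v = 0 from h)⟩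
  rw [h]
  exact LinearMap.finrank_range_add_finrank_ker (V := TangentSpace I x) _

theorem hasSkewGaugeSolution_of_cosymplectic [T2Space M] [SigmaCompactSpace M] {n : ℕ}
    (hE : Module.finrank ℝ E = 2 * n + 1) (h : HasAlmostCosymplecticStructure I M n) :
    HasSkewGaugeSolution I M (2 * n) := by
  obtain ⟨β, η, h⟩ := h
  have key : ∀ x v, (∀ u, β.toSection x v u = 0) → η x v = 0 → v = 0 := fun x ↦
    (wedge_ne_zero_iff hE β η x).1 (h x)
  have reeb := fun x ↦ exists_reeb_of_wedge_ne_zero hE β η x (key x)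
  refine hasSkewGaugeSolution_of_twoForm β η (fun x v hv ↦ ?_) (fun x ↦ ?_) fun x ↦ ?_
  · have h1 := hv v
    rw [β.alternating, zero_add, mul_self_eq_zero] at h1
    refine key x v (fun u ↦ ?_) h1
    have h2 := hv u
    rwa [h1, zero_mul, add_zero] at h2
  · obtain ⟨-, ξ, h1, h2⟩ := reeb x
    refine ⟨ξ, h1, fun v ↦ ?_⟩
    rw [show η x ξ = 1 from h2, one_mul]
  · have h1 := (reeb x).1
    have h2 := finrank_range_add_finrank_ker_linAt β x
    omega

theorem hasSkewGaugeSolution_of_symplectic [T2Space M] [SigmaCompactSpace M]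
    (h : HasAlmostSymplecticStructure I M) :
    HasSkewGaugeSolution I M (Module.finrank ℝ E) := by
  obtain ⟨β, h⟩ := h
  refine hasSkewGaugeSolution_of_twoForm β 0 (fun x v hv ↦ h x v fun u ↦ ?_)
    (fun x ↦ ⟨0, fun v ↦ ?_, fun v ↦ ?_⟩) fun x ↦ ?_
  · simpa using hv u
  · simp
  · simp
  · rw [← finrank_range_add_finrank_ker_linAt β x, left_eq_add]
    have h0 : LinearMap.ker (β.linAt x) = ⊥ :=
      (LinearMap.ker_eq_bot').2 fun v hv ↦ h x v fun u ↦
        congrArg (fun T : TangentSpace I x →ₗ[ℝ] ℝ ↦ T u) hv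
    rw [h0]
    exact finrank_bot ℝ (TangentSpace I x)

/-- The two-form `g (θ u) v`. -/
def metricTwoForm (g : SmoothMetric I M) (θ : SmoothEndomorphismField I M)
    (h : IsSkewSymmetric g θ) : SmoothTwoForm I M where
  toSection := ⟨fun x ↦ (g.inner x).comp (θ x), fun x ↦ contMDiffAt_bilin_of_tangentFrame
    fun u v ↦ contMDiffAt_bilin_apply (b := id) (I' := I)
      (v := fun y ↦ θ y (tangentFrame I x u y)) (w := tangentFrame I x v) (g.contMDiff x)
      (ContMDiffAt.clm_bundle_apply (E₁ := (TangentSpace I : M → Type _))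
        (E₂ := (TangentSpace I : M → Type _)) (θ.contMDiff x)
        (contMDiffAt_tangentFrame x u (mem_baseSet_trivializationAt E _ x)))
      (contMDiffAt_tangentFrame x v (mem_baseSet_trivializationAt E _ x))⟩
  alternating x v := by
    have h1 : g.inner x (θ x v) v = 0 := by
      have h2 := h x v v
      rw [g.symm x v] at h2
      linarith
    exact h1

theorem hasAlmostSymplecticStructure_of_gauge
    (h : HasSkewGaugeSolution I M (Module.finrank ℝ E)) : HasAlmostSymplecticStructure I M := by
  obtain ⟨g, D, D', θ, -, -, -, -, hskew, hrank⟩ := h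
  refine ⟨metricTwoForm g θ hskew, fun x v hv ↦ ?_⟩
  have h1 := nondegenerate_metric g x _ hv
  have h2 := LinearMap.finrank_range_add_finrank_ker (V := TangentSpace I x) (θ x).toLinearMap
  have h3 : Module.finrank ℝ (TangentSpace I x) = Module.finrank ℝ E := rfl
  rw [hrank x, h3] at h2
  have h4 : LinearMap.ker (θ x).toLinearMap = ⊥ := Submodule.finrank_eq_zero.1 (by omega)
  exact LinearMap.ker_eq_bot'.1 h4 v h1

/-- The two-form `g (φ u) v - g u (φ v)`. -/
def skewTwoForm (g : SmoothMetric I M) (φ : SmoothEndomorphismField I M) : SmoothTwoForm I M where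
  toSection := ⟨fun x ↦ (g.inner x).comp (φ x) -
      (ContinuousLinearMap.precomp ℝ (φ x)).comp (g.inner x), fun x ↦ by
    have hu : ∀ u, ContMDiffAt I (I.prod 𝓘(ℝ, E)) ∞
        (fun y ↦ TotalSpace.mk' E y (tangentFrame I x u y)) x := fun u ↦
      contMDiffAt_tangentFrame x u (mem_baseSet_trivializationAt E _ x)
    have hφ : ∀ u, ContMDiffAt I (I.prod 𝓘(ℝ, E)) ∞
        (fun y ↦ TotalSpace.mk' E y (φ y (tangentFrame I x u y))) x := fun u ↦
      ContMDiffAt.clm_bundle_apply (E₁ := (TangentSpace I : M → Type _))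
        (E₂ := (TangentSpace I : M → Type _)) (φ.contMDiff x) (hu u)
    exact contMDiffAt_bilin_of_tangentFrame fun u v ↦
      (contMDiffAt_bilin_apply (b := id) (I' := I) (v := fun y ↦ φ y (tangentFrame I x u y))
        (w := tangentFrame I x v) (g.contMDiff x) (hφ u) (hu v)).sub
      (contMDiffAt_bilin_apply (b := id) (I' := I) (v := tangentFrame I x u)
        (w := fun y ↦ φ y (tangentFrame I x v y)) (g.contMDiff x) (hu u) (hφ v))⟩
  alternating x v := sub_eq_zero.2 (g.symm x _ _)

theorem skewTwoForm_apply (g : SmoothMetric I M) (φ : SmoothEndomorphismField I M) (x : M)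
    (v w : TangentSpace I x) :
    (skewTwoForm g φ).toSection x v w = g.inner x (φ x v) w - g.inner x v (φ x w) := rfl

theorem hasAlmostCosymplecticStructure_of_contact [T2Space M] [SigmaCompactSpace M] {n : ℕ}
    (hE : Module.finrank ℝ E = 2 * n + 1) (h : HasAlmostContactStructure I M) :
    HasAlmostCosymplecticStructure I M n := by
  obtain ⟨φ, ξ, η, h⟩ := h
  obtain ⟨g⟩ := exists_smoothMetric (I := I) (M := M)
  refine ⟨skewTwoForm g φ, η, fun x ↦ (wedge_ne_zero_iff hE _ η x).2 fun v hv hη ↦ ?_⟩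
  have h1 := hv (φ x v)
  rw [skewTwoForm_apply, (h x).2 v, hη, zero_smul, add_zero, map_neg] at h1
  by_contra hne
  have h2 := g.pos x v hne
  have h3 : 0 ≤ g.inner x (φ x v) (φ x v) := by
    rcases eq_or_ne (φ x v) 0 with h0 | h0
    · rw [h0, map_zero]
    · exact (g.pos x _ h0).le
  linarith

end Cosymplectic

section Cylinder

variable {E : Type*} [NormedAddCommGroup E] [NormedSpace ℝ E] [FiniteDimensional ℝ E]
  {H : Type*} [TopologicalSpace H] {I : ModelWithCorners ℝ E H}
  {M : Type*} [TopologicalSpace M] [ChartedSpace H M] [IsManifold I ∞ M]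

omit [FiniteDimensional ℝ E] in
theorem contMDiffAt_fst_tangent {p : M × ℝ} {v : ∀ p : M × ℝ, TangentSpace (I.prod 𝓘(ℝ, ℝ)) p}
    (hv : ContMDiffAt (I.prod 𝓘(ℝ, ℝ)) ((I.prod 𝓘(ℝ, ℝ)).prod 𝓘(ℝ, E × ℝ)) ∞
      (fun q ↦ TotalSpace.mk' (E × ℝ) q (v q)) p) :
    ContMDiffAt (I.prod 𝓘(ℝ, ℝ)) (I.prod 𝓘(ℝ, E)) ∞
      (fun q ↦ TotalSpace.mk' E (E := (TangentSpace I : M → Type _)) q.1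
        (ContinuousLinearMap.fst ℝ E ℝ (v q))) p := by
  have h : ContMDiff (I.prod 𝓘(ℝ, ℝ)).tangent I.tangent ∞
      (tangentMap (I.prod 𝓘(ℝ, ℝ)) I (Prod.fst : M × ℝ → M)) :=
    (contMDiff_fst (n := ∞)).contMDiff_tangentMap (by simp)
  have h2 := h.contMDiffAt.comp p hv
  refine h2.congr_of_eventuallyEq (Filter.Eventually.of_forall fun q ↦ ?_)
  simp only [Function.comp, tangentMap, mfderiv_fst]
  rfl

omit [FiniteDimensional ℝ E] in
theorem contMDiffAt_snd_tangent {p : M × ℝ} {v : ∀ p : M × ℝ, TangentSpace (I.prod 𝓘(ℝ, ℝ)) p}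
    (hv : ContMDiffAt (I.prod 𝓘(ℝ, ℝ)) ((I.prod 𝓘(ℝ, ℝ)).prod 𝓘(ℝ, E × ℝ)) ∞
      (fun q ↦ TotalSpace.mk' (E × ℝ) q (v q)) p) :
    ContMDiffAt (I.prod 𝓘(ℝ, ℝ)) 𝓘(ℝ, ℝ) ∞
      (fun q ↦ ContinuousLinearMap.snd ℝ E ℝ (v q)) p := by
  have h : ContMDiff (I.prod 𝓘(ℝ, ℝ)).tangent 𝓘(ℝ, ℝ).tangent ∞
      (tangentMap (I.prod 𝓘(ℝ, ℝ)) 𝓘(ℝ, ℝ) (Prod.snd : M × ℝ → ℝ)) :=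
    (contMDiff_snd (n := ∞)).contMDiff_tangentMap (by simp)
  have h2 := (contMDiff_snd_tangentBundle_modelSpace ℝ 𝓘(ℝ, ℝ)).contMDiffAt.comp p
    (h.contMDiffAt.comp p hv)
  refine h2.congr_of_eventuallyEq (Filter.Eventually.of_forall fun q ↦ ?_)
  simp only [Function.comp, tangentMap, mfderiv_snd]
  rfl

/-- The two-form `β + η ∧ dt` on `M × ℝ`. -/
def cylinderTwoForm (β : SmoothTwoForm I M) (η : SmoothOneForm I M) :
    SmoothTwoForm (I.prod 𝓘(ℝ, ℝ)) (M × ℝ) where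
  toSection := ⟨fun p ↦
    let b : E →L[ℝ] E →L[ℝ] ℝ := β.toSection p.1
    let h : E →L[ℝ] ℝ := η p.1
    let B : E × ℝ →L[ℝ] E × ℝ →L[ℝ] ℝ :=
      b.bilinearComp (ContinuousLinearMap.fst ℝ E ℝ) (ContinuousLinearMap.fst ℝ E ℝ) +
      ((h.comp (ContinuousLinearMap.fst ℝ E ℝ)).smulRight (ContinuousLinearMap.snd ℝ E ℝ) -
      (ContinuousLinearMap.snd ℝ E ℝ).smulRight (h.comp (ContinuousLinearMap.fst ℝ E ℝ)))
    B, fun p ↦ by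
    refine contMDiffAt_bilin_of_tangentFrame fun u v ↦ ?_
    have hu := contMDiffAt_tangentFrame (I := I.prod 𝓘(ℝ, ℝ)) p u
      (mem_baseSet_trivializationAt (E × ℝ) _ p)
    have hv := contMDiffAt_tangentFrame (I := I.prod 𝓘(ℝ, ℝ)) p v
      (mem_baseSet_trivializationAt (E × ℝ) _ p)
    have hu1 := contMDiffAt_fst_tangent hu
    have hv1 := contMDiffAt_fst_tangent hv
    have hu2 := contMDiffAt_snd_tangent hu
    have hv2 := contMDiffAt_snd_tangent hv
    exact (contMDiffAt_bilin_apply (b := Prod.fst) (β.toSection.contMDiff p.1) hu1 hv1).add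
      (((contMDiffAt_oneForm_apply (b := Prod.fst) (η.contMDiff p.1) hu1).mul hv2).sub
      (hu2.mul (contMDiffAt_oneForm_apply (b := Prod.fst) (η.contMDiff p.1) hv1)))⟩
  alternating p v := by
    have h1 : ∀ (u : TangentSpace I p.1) (s : ℝ),
        β.toSection p.1 u u + (η p.1 u * s - s * η p.1 u) = 0 := fun u s ↦ by
      rw [β.alternating]
      ring
    exact h1 _ _

theorem hasAlmostSymplecticStructure_cylinder {n : ℕ} (hE : Module.finrank ℝ E = 2 * n + 1)
    (h : HasAlmostCosymplecticStructure I M n) :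
    HasAlmostSymplecticStructure (I.prod 𝓘(ℝ, ℝ)) (M × ℝ) := by
  obtain ⟨β, η, h⟩ := h
  refine ⟨cylinderTwoForm β η, fun p v hv ↦ ?_⟩
  have key := (wedge_ne_zero_iff hE β η p.1).1 (h p.1)
  obtain ⟨-, ξ, hξ, hηξ⟩ := exists_reeb_of_wedge_ne_zero hE β η p.1 key
  obtain ⟨u, s⟩ := v
  have h1 : ∀ (w : TangentSpace I p.1) (t : ℝ),
      β.toSection p.1 u w + (η p.1 u * t - s * η p.1 w) = 0 := fun w t ↦ hv ((w, t) : E × ℝ)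
  have h2 : β.toSection p.1 u ξ = 0 := (β.skew p.1 u ξ).trans (neg_eq_zero.2 (hξ u))
  have hηu : η p.1 u = 0 := by
    have h3 := h1 0 1
    simpa using h3
  have hs : s = 0 := by
    have h3 := h1 ξ 0
    rw [h2, show η p.1 ξ = 1 from hηξ] at h3
    linarith
  have hu : u = 0 := key u (fun w ↦ by
    have h3 := h1 w 0
    rw [hs] at h3
    linarith) hηu
  rw [hs, hu]
  rfl

omit [FiniteDimensional ℝ E] in
theorem contMDiffAt_inl_tangent {x : M} {v : ∀ x : M, TangentSpace I x}
    (hv : ContMDiffAt I (I.prod 𝓘(ℝ, E)) ∞ (fun y ↦ TotalSpace.mk' E y (v y)) x) (c : ℝ) :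
    ContMDiffAt I ((I.prod 𝓘(ℝ, ℝ)).prod 𝓘(ℝ, E × ℝ)) ∞
      (fun y ↦ TotalSpace.mk' (E × ℝ)
        (E := (TangentSpace (I.prod 𝓘(ℝ, ℝ)) : M × ℝ → Type _)) (y, (0 : ℝ))
        ((v y, c) : E × ℝ)) x := by
  have h1 : ContMDiffAt I 𝓘(ℝ, ℝ).tangent ∞
      (fun _ : M ↦ (TotalSpace.mk' ℝ (0 : ℝ) c : TangentBundle 𝓘(ℝ, ℝ) ℝ)) x := contMDiffAt_const
  exact (contMDiff_equivTangentBundleProd_symm (I := I) (M := M) (I' := 𝓘(ℝ, ℝ)) (M' := ℝ)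
    (n := ∞)).contMDiffAt.comp x (hv.prodMk h1)

theorem hasAlmostCosymplecticStructure_of_cylinder {n : ℕ} (hE : Module.finrank ℝ E = 2 * n + 1)
    (h : HasAlmostSymplecticStructure (I.prod 𝓘(ℝ, ℝ)) (M × ℝ)) :
    HasAlmostCosymplecticStructure I M n := by
  obtain ⟨Ω, hΩ⟩ := h
  have hf : ∀ (x : M) (u : E) (c : ℝ), ContMDiffAt I ((I.prod 𝓘(ℝ, ℝ)).prod 𝓘(ℝ, E × ℝ)) ∞
      (fun y ↦ TotalSpace.mk' (E × ℝ)
        (E := (TangentSpace (I.prod 𝓘(ℝ, ℝ)) : M × ℝ → Type _)) (y, (0 : ℝ))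
        ((tangentFrame I x u y, c) : E × ℝ)) x := fun x u c ↦
    contMDiffAt_inl_tangent (contMDiffAt_tangentFrame x u (mem_baseSet_trivializationAt E _ x)) c
  have h0 : ∀ x : M, ContMDiffAt I ((I.prod 𝓘(ℝ, ℝ)).prod 𝓘(ℝ, E × ℝ)) ∞
      (fun y ↦ TotalSpace.mk' (E × ℝ)
        (E := (TangentSpace (I.prod 𝓘(ℝ, ℝ)) : M × ℝ → Type _)) (y, (0 : ℝ))
        ((0, 1) : E × ℝ)) x := fun x ↦
    contMDiffAt_inl_tangent (v := fun _ ↦ 0) ((0 : SmoothVectorField I M).contMDiff x) 1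
  let B : ∀ x : M, E × ℝ →L[ℝ] E × ℝ →L[ℝ] ℝ := fun x ↦ Ω.toSection (x, 0)
  let β : SmoothTwoForm I M :=
    ⟨⟨fun x ↦ (B x).bilinearComp (E' := E) (F' := E) (ContinuousLinearMap.inl ℝ E ℝ)
        (ContinuousLinearMap.inl ℝ E ℝ),
      fun x ↦ contMDiffAt_bilin_of_tangentFrame fun u v ↦
        contMDiffAt_bilin_apply (b := fun y : M ↦ (y, (0 : ℝ))) (Ω.toSection.contMDiff (x, 0))
          (hf x u 0) (hf x v 0)⟩, fun x v ↦ Ω.alternating (x, 0) _⟩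
  let η : SmoothOneForm I M :=
    ⟨fun x ↦ ((B x).flip (0, 1)).comp (ContinuousLinearMap.inl ℝ E ℝ),
      fun x ↦ contMDiffAt_oneForm_of_tangentFrame fun u ↦
        contMDiffAt_bilin_apply (b := fun y : M ↦ (y, (0 : ℝ))) (Ω.toSection.contMDiff (x, 0))
          (hf x u 0) (h0 x)⟩
  refine ⟨β, η, fun x ↦ (wedge_ne_zero_iff hE β η x).2 fun v hv hη ↦ ?_⟩
  have hv' : ∀ u : E, B x (v, 0) (u, 0) = 0 := hv
  have hη' : B x (v, 0) (0, 1) = 0 := hη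
  have h1 := hΩ (x, 0) ((v, 0) : E × ℝ) fun w ↦ by
    obtain ⟨u, t⟩ := w
    have h2 : B x (v, 0) (u, t) = 0 := by
      have h3 : ((u, t) : E × ℝ) = (u, 0) + t • (0, 1) := by ext <;> simp
      rw [h3, map_add, map_smul, hv', hη', smul_zero, add_zero]
    exact h2
  exact congrArg Prod.fst (show ((v, 0) : E × ℝ) = (0, 0) from h1)

end Cylinder

section TopForms

variable {V E ι : Type*} [AddCommGroup V] [Module ℝ V] [AddCommGroup E] [Module ℝ E]
  [Fintype ι] [DecidableEq ι]

theorem alternatingMap_mul_det (F : V [⋀^ι]→ₗ[ℝ] ℝ) (b : Module.Basis ι ℝ E) (D : V ≃ₗ[ℝ] E)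
    (v w : ι → V) : F w * b.det (fun i ↦ D (v i)) = F v * b.det (fun i ↦ D (w i)) := by
  have h : ∀ w, F w = F (b.map D.symm) * b.det (fun i ↦ D (w i)) := fun w ↦ by
    conv_lhs => rw [F.eq_smul_basis_det (b.map D.symm)]
    rw [AlternatingMap.smul_apply, smul_eq_mul, Module.Basis.det_map]
    rfl
  rw [h w, h v]
  ring

theorem continuousAt_basis_det {X E : Type*} [TopologicalSpace X] [NormedAddCommGroup E]
    [NormedSpace ℝ E] [FiniteDimensional ℝ E] (b : Module.Basis ι ℝ E) {v : X → ι → E} {x : X}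
    (hv : ∀ i, ContinuousAt (fun y ↦ v y i) x) : ContinuousAt (fun y ↦ b.det (v y)) x := by
  have h : ContinuousAt (fun y ↦ b.toMatrix (v y)) x :=
    continuousAt_pi.2 fun i ↦ continuousAt_pi.2 fun j ↦
      (LinearMap.continuous_of_finiteDimensional (b.coord i)).continuousAt.comp (hv j)
  exact (Continuous.matrix_det continuous_id).continuousAt.comp h

end TopForms

section Orientation

variable {E : Type*} [NormedAddCommGroup E] [NormedSpace ℝ E]
  {M : Type*} [TopologicalSpace M] [ChartedSpace E M] [IsManifold 𝓘(ℝ, E) ∞ M]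

omit [IsManifold 𝓘(ℝ, E) ∞ M] in
theorem mdifferentiable_of_mem_maximalAtlas {e : OpenPartialHomeomorph M E}
    (he : e ∈ IsManifold.maximalAtlas 𝓘(ℝ, E) ∞ M) :
    e.MDifferentiable 𝓘(ℝ, E) 𝓘(ℝ, E) :=
  ⟨(contMDiffOn_of_mem_maximalAtlas he).mdifferentiableOn (by simp),
    (contMDiffOn_symm_of_mem_maximalAtlas he).mdifferentiableOn (by simp)⟩

omit [IsManifold 𝓘(ℝ, E) ∞ M] in
theorem mvfderiv_chart_change {e e' : OpenPartialHomeomorph M E}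
    (he : e ∈ IsManifold.maximalAtlas 𝓘(ℝ, E) ∞ M) (he' : e' ∈ IsManifold.maximalAtlas 𝓘(ℝ, E) ∞ M)
    {x : M} (hx : x ∈ e.source) (hx' : x ∈ e'.source) :
    mvfderiv 𝓘(ℝ, E) e' x =
      (fderiv ℝ (e' ∘ e.symm) (e x)).comp (mvfderiv 𝓘(ℝ, E) e x) := by
  have h1 : (e' : M → E) =ᶠ[𝓝 x] (e' ∘ e.symm) ∘ e := by
    filter_upwards [e.open_source.mem_nhds hx] with y hy
    simp [e.left_inv hy]
  have h2 : MDifferentiableAt 𝓘(ℝ, E) 𝓘(ℝ, E) e x :=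
    (mdifferentiable_of_mem_maximalAtlas he).mdifferentiableAt hx
  have h3 : MDifferentiableAt 𝓘(ℝ, E) 𝓘(ℝ, E) (e' ∘ e.symm) (e x) := by
    refine MDifferentiableAt.comp (e x) (I' := 𝓘(ℝ, E)) ?_
      ((mdifferentiable_of_mem_maximalAtlas he).mdifferentiableAt_symm (e.map_source hx))
    rw [e.left_inv hx]
    exact (mdifferentiable_of_mem_maximalAtlas he').mdifferentiableAt hx'
  have h4 := mfderiv_comp x h3 h2
  rw [mfderiv_eq_fderiv] at h4
  exact (mvfderiv_congr_of_eventuallyEq h1).trans h4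

/-- The differential of a chart. -/
def chartDifferential {e : OpenPartialHomeomorph M E}
    (he : e ∈ IsManifold.maximalAtlas 𝓘(ℝ, E) ∞ M) {x : M} (hx : x ∈ e.source) :
    TangentSpace 𝓘(ℝ, E) x ≃ₗ[ℝ] E :=
  LinearEquiv.ofBijective (mvfderiv 𝓘(ℝ, E) e x).toLinearMap
    ((mdifferentiable_of_mem_maximalAtlas he).mfderiv_bijective hx)

variable [FiniteDimensional ℝ E]

set_option synthInstance.maxHeartbeats 200000 in
set_option maxHeartbeats 1000000 in
/-- Smooth one-forms satisfying a pointwise convex condition exist as soon as they exist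
locally. -/
theorem exists_oneForm_forall_mem_convex_of_local {H : Type*} [TopologicalSpace H]
    {I : ModelWithCorners ℝ E H} {M : Type*} [TopologicalSpace M] [ChartedSpace H M]
    [IsManifold I ∞ M] [T2Space M] [SigmaCompactSpace M]
    (t : ∀ x : M, Set (TangentSpace I x →L[ℝ] ℝ)) (ht : ∀ x, Convex ℝ (t x))
    (hloc : ∀ x₀ : M, ∃ U ∈ 𝓝 x₀, ∃ s : (x : M) → (TangentSpace I x →L[ℝ] ℝ),
      (∀ x ∈ U, ContMDiffAt I (I.prod 𝓘(ℝ, E →L[ℝ] ℝ)) ∞ (fun x ↦ TotalSpace.mk' (E →L[ℝ] ℝ)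
        (E := fun x : M ↦ TangentSpace I x →L[ℝ] ℝ) x (s x)) x) ∧ ∀ y ∈ U, s y ∈ t y) :
    ∃ s : SmoothOneForm I M, ∀ x, s x ∈ t x := by
  refine exists_contMDiffSection_forall_mem_convex_of_local I (n := ⊤) _ t ht fun x₀ ↦ ?_
  obtain ⟨U, hU, s, hs, hs'⟩ := hloc x₀
  exact ⟨U, hU, s, fun x hx ↦ (hs x hx).contMDiffWithinAt, hs'⟩

/-- The top-degree form `β ^ n ∧ η` at a point. -/
def topForm (β : SmoothTwoForm 𝓘(ℝ, E) M) (n : ℕ) (x : M) (η : TangentSpace 𝓘(ℝ, E) x →L[ℝ] ℝ) :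
    TangentSpace 𝓘(ℝ, E) x [⋀^Fin (2 * n + 1)]→ₗ[ℝ] ℝ :=
  wedge (wedgePow (β.altAt x) n) (oneFormAlt η.toLinearMap)

omit [FiniteDimensional ℝ E] in
theorem topForm_add_smul (β : SmoothTwoForm 𝓘(ℝ, E) M) (n : ℕ) (x : M)
    (η η' : TangentSpace 𝓘(ℝ, E) x →L[ℝ] ℝ) (a b : ℝ) (v) :
    topForm β n x (a • η + b • η') v = a * topForm β n x η v + b * topForm β n x η' v :=
  wedge_wedgePow_oneForm_add_smul _ (β.alternating x) η.toLinearMap η'.toLinearMap a b n v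

omit [FiniteDimensional ℝ E] in
theorem continuousAt_topForm (β : SmoothTwoForm 𝓘(ℝ, E) M) (n : ℕ) {x₀ : M}
    {η : ∀ x : M, TangentSpace 𝓘(ℝ, E) x →L[ℝ] ℝ}
    {v : ∀ x : M, Fin (2 * n + 1) → TangentSpace 𝓘(ℝ, E) x}
    (hη : ∀ i, ContinuousAt (fun x ↦ η x (v x i)) x₀)
    (hv : ∀ i, ContMDiffAt 𝓘(ℝ, E) (𝓘(ℝ, E).prod 𝓘(ℝ, E)) ∞
      (fun x ↦ TotalSpace.mk' E x (v x i)) x₀) :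
    ContinuousAt (fun x ↦ topForm β n x (η x) (v x)) x₀ := by
  have h : ∀ x, topForm β n x (η x) (v x) = ∑ σ : Equiv.Perm (Fin (2 * n + 1)),
      ((Equiv.Perm.sign σ : ℤ) : ℝ) * ((∏ i : Fin n, 2⁻¹ * β.toSection x
        (v x (σ ⟨2 * i, by omega⟩)) (v x (σ ⟨2 * i + 1, by omega⟩))) *
          η x (v x (σ (Fin.last (2 * n))))) := fun x ↦
    wedge_wedgePow_oneForm_apply _ (β.alternating x) (η x).toLinearMap n (v x)
  simp only [h]
  refine tendsto_finsetSum _ fun σ _ ↦ tendsto_const_nhds.mul (Filter.Tendsto.mul ?_ (hη _))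
  refine tendsto_finsetProd _ fun i _ ↦ tendsto_const_nhds.mul ?_
  exact (contMDiffAt_bilin_apply (b := id) (I' := 𝓘(ℝ, E)) (β.toSection.contMDiff x₀)
    (hv _) (hv _)).continuousAt

/-- On an oriented manifold of odd dimension a two-form with one-dimensional kernels is part of an
almost cosymplectic structure. -/
theorem hasAlmostCosymplecticStructure_of_orientable [T2Space M] [SigmaCompactSpace M] {n : ℕ}
    (hE : Module.finrank ℝ E = 2 * n + 1) (hM : IsOrientableManifold E M)
    (β : SmoothTwoForm 𝓘(ℝ, E) M)
    (hβ : ∀ x, Module.finrank ℝ (LinearMap.ker (β.linAt x)) = 1) :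
    HasAlmostCosymplecticStructure 𝓘(ℝ, E) M n := by
  obtain ⟨A, hA, hcov, hdet⟩ := hM
  let b : Module.Basis (Fin (2 * n + 1)) ℝ E := Module.finBasisOfFinrankEq ℝ E hE
  let t : ∀ x : M, Set (TangentSpace 𝓘(ℝ, E) x →L[ℝ] ℝ) := fun x ↦
    {η | ∀ e ∈ A, x ∈ e.source → ∀ w : Fin (2 * n + 1) → TangentSpace 𝓘(ℝ, E) x,
      0 < b.det (fun i ↦ mvfderiv 𝓘(ℝ, E) e x (w i)) → 0 < topForm β n x η w}
  have ht : ∀ x, Convex ℝ (t x) := by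
    intro x η hη η' hη' r s hr hs hrs e he hx w hw
    have h1 := hη e he hx w hw
    have h2 := hη' e he hx w hw
    rw [topForm_add_smul]
    rcases hr.eq_or_lt with rfl | hr
    · rw [zero_add] at hrs
      simpa [hrs] using h2
    · positivity
  obtain ⟨η, hη⟩ := exists_oneForm_forall_mem_convex_of_local t ht fun x₀ ↦ by
    obtain ⟨e₀, he₀, hx₀⟩ := hcov x₀
    let v : Fin (2 * n + 1) → TangentSpace 𝓘(ℝ, E) x₀ := fun i ↦
      (chartDifferential (hA he₀) hx₀).symm (b i)
    have hv : ∀ i, mvfderiv 𝓘(ℝ, E) e₀ x₀ (v i) = b i := fun i ↦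
      (chartDifferential (hA he₀) hx₀).apply_symm_apply (b i)
    obtain ⟨η₀, hη₀⟩ : ∃ η₀ : TangentSpace 𝓘(ℝ, E) x₀ →L[ℝ] ℝ, 0 < topForm β n x₀ η₀ v := by
      obtain ⟨η₁, hη₁⟩ := exists_oneForm_of_finrank_ker_eq_one (β.linAt x₀) (hβ x₀)
      obtain ⟨η₂, h1⟩ : ∃ η₂ : TangentSpace 𝓘(ℝ, E) x₀ →L[ℝ] ℝ, topForm β n x₀ η₂ ≠ 0 :=
        ⟨(LinearMap.toContinuousLinearMap η₁ : E →L[ℝ] ℝ),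
          wedge_ne_zero_of_ker_inf_ker_eq_zero hE (β.linAt x₀) (β.alternating x₀) η₁ hη₁⟩
      have h2 : topForm β n x₀ η₂ v ≠ 0 := fun h ↦ h1 <|
        (AlternatingMap.map_basis_eq_zero_iff (b.map (chartDifferential (hA he₀) hx₀).symm) _).1 h
      rcases h2.lt_or_gt with h | h
      · refine ⟨(-1 : ℝ) • η₂ + (0 : ℝ) • η₂, ?_⟩
        rw [topForm_add_smul]
        linarith
      · exact ⟨η₂, h⟩
    let η : ∀ x : M, TangentSpace 𝓘(ℝ, E) x →L[ℝ] ℝ := fun x ↦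
      (η₀.comp (tangentCoordSymm 𝓘(ℝ, E) x₀ x₀)).comp (tangentCoord 𝓘(ℝ, E) x₀ x)
    let f : ∀ x : M, Fin (2 * n + 1) → TangentSpace 𝓘(ℝ, E) x := fun x i ↦
      tangentFrame 𝓘(ℝ, E) x₀ (tangentCoord 𝓘(ℝ, E) x₀ x₀ (v i)) x
    have cη : ∀ x ∈ tangentDomain 𝓘(ℝ, E) x₀, ContMDiffAt 𝓘(ℝ, E) (𝓘(ℝ, E).prod 𝓘(ℝ, E →L[ℝ] ℝ)) ∞
        (fun x ↦ TotalSpace.mk' (E →L[ℝ] ℝ)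
        (E := fun x : M ↦ TangentSpace 𝓘(ℝ, E) x →L[ℝ] ℝ) x (η x)) x := fun x hx ↦
      contMDiffAt_oneForm_of_tangentFrame fun u ↦
        (η₀.comp (tangentCoordSymm 𝓘(ℝ, E) x₀ x₀)).contMDiff.contMDiffAt.comp x
          ((contMDiffAt_tangentCoord_iff hx).2
            (contMDiffAt_tangentFrame x u (mem_baseSet_trivializationAt E _ x)))
    have cf : ∀ i, ContMDiffAt 𝓘(ℝ, E) (𝓘(ℝ, E).prod 𝓘(ℝ, E)) ∞
        (fun x ↦ TotalSpace.mk' E x (f x i)) x₀ := fun i ↦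
      contMDiffAt_tangentFrame x₀ _ (mem_baseSet_trivializationAt E _ x₀)
    have hf₀ : f x₀ = v := funext fun i ↦ tangentCoordSymm_coord (mem_tangentDomain x₀) (v i)
    have hηx₀ : η x₀ = η₀ := by
      ext u
      exact congrArg η₀ (tangentCoordSymm_coord (mem_tangentDomain x₀) u)
    have h1 : ∀ᶠ x in 𝓝 x₀, 0 < topForm β n x (η x) (f x) := by
      refine (continuousAt_topForm β n (fun i ↦ ?_) cf).eventually_const_lt ?_
      · exact (contMDiffAt_oneForm_apply (b := id) (I' := 𝓘(ℝ, E))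
          (cη x₀ (mem_tangentDomain x₀)) (cf i)).continuousAt
      · change 0 < topForm β n x₀ (η x₀) (f x₀)
        rwa [hf₀, hηx₀]
    have h2 : ∀ᶠ x in 𝓝 x₀, 0 < b.det (fun i ↦ mvfderiv 𝓘(ℝ, E) e₀ x (f x i)) := by
      refine (continuousAt_basis_det b fun i ↦ ?_).eventually_const_lt ?_
      · exact (contMDiffAt_mvfderiv_apply ((contMDiffOn_of_mem_maximalAtlas (hA he₀)).contMDiffAt
          (e₀.open_source.mem_nhds hx₀)) (cf i)).continuousAt
      · simp only [hf₀, hv]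
        rw [Module.Basis.det_self]
        exact one_pos
    refine ⟨_, Filter.inter_mem (Filter.inter_mem h1 h2) (Filter.inter_mem
      ((isOpen_tangentDomain (I := 𝓘(ℝ, E)) x₀).mem_nhds (mem_tangentDomain x₀))
      (e₀.open_source.mem_nhds hx₀)), η, fun x hx ↦ cη x hx.2.1, fun x hx e he hxe w hw ↦ ?_⟩
    obtain ⟨⟨hx1, hx2⟩, hx3, hx4⟩ := hx
    rw [Set.mem_ofPred_eq] at hx1 hx2
    have h3 := alternatingMap_mul_det (topForm β n x (η x)) b (chartDifferential (hA he) hxe)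
      (f x) w
    have h4 : 0 < b.det (fun i ↦ mvfderiv 𝓘(ℝ, E) e x (f x i)) := by
      have h5 : (fun i ↦ mvfderiv 𝓘(ℝ, E) e x (f x i)) =
          (fderiv ℝ (e ∘ e₀.symm) (e₀ x)).toLinearMap ∘
            fun i ↦ mvfderiv 𝓘(ℝ, E) e₀ x (f x i) := by
        rw [mvfderiv_chart_change (hA he₀) (hA he) hx4 hxe]
        rfl
      rw [h5, Module.Basis.det_comp]
      exact mul_pos (hdet e₀ he₀ e he x ⟨hx4, hxe⟩) hx2
    have h6 : 0 < topForm β n x (η x) w * b.det (fun i ↦ mvfderiv 𝓘(ℝ, E) e x (f x i)) :=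
      (mul_pos hx1 hw).trans_eq h3.symm
    exact pos_of_mul_pos_left h6 h4.le
  refine ⟨β, η, fun x h ↦ ?_⟩
  obtain ⟨e, he, hx⟩ := hcov x
  have h1 := hη x e he hx (fun i ↦ (chartDifferential (hA he) hx).symm (b i)) (by
    have h2 : (fun i ↦ mvfderiv 𝓘(ℝ, E) e x ((chartDifferential (hA he) hx).symm (b i))) = b :=
      funext fun i ↦ (chartDifferential (hA he) hx).apply_symm_apply (b i)
    rw [h2, Module.Basis.det_self]
    exact one_pos)
  rw [show topForm β n x (η x) = 0 from h] at h1
  exact h1.ne' rfl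

theorem hasAlmostCosymplecticStructure_of_gauge [T2Space M] [SigmaCompactSpace M] {n : ℕ}
    (hE : Module.finrank ℝ E = 2 * n + 1) (hM : IsOrientableManifold E M)
    (h : HasSkewGaugeSolution 𝓘(ℝ, E) M (2 * n)) :
    HasAlmostCosymplecticStructure 𝓘(ℝ, E) M n := by
  obtain ⟨g, D, D', θ, -, -, -, -, hskew, hrank⟩ := h
  refine hasAlmostCosymplecticStructure_of_orientable hE hM (metricTwoForm g θ hskew) fun x ↦ ?_
  have h1 : LinearMap.ker ((metricTwoForm g θ hskew).linAt x) =
      LinearMap.ker (θ x).toLinearMap := by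
    ext v
    refine ⟨fun h ↦ nondegenerate_metric g x _ fun u ↦
      congrArg (fun T : E →ₗ[ℝ] ℝ ↦ T u) h, fun h ↦ LinearMap.ext fun u ↦ ?_⟩
    have h2 : θ x v = 0 := h
    have h3 : g.inner x (θ x v) u = 0 := by rw [h2, map_zero]; rfl
    exact h3
  rw [h1]
  have h2 := LinearMap.finrank_range_add_finrank_ker (V := TangentSpace 𝓘(ℝ, E) x)
    (θ x).toLinearMap
  have h3 : Module.finrank ℝ (TangentSpace 𝓘(ℝ, E) x) = Module.finrank ℝ E := rfl
  rw [hrank x, h3, hE] at h2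
  exact Nat.add_left_cancel h2

end Orientation

section Coefficients

/-- The coefficients of the power series of `(1 - X) ^ (-1/2)`. -/
def invSqrtCoeff (k : ℕ) : ℝ := k.centralBinom / 4 ^ k

theorem invSqrtCoeff_zero : invSqrtCoeff 0 = 1 := by simp [invSqrtCoeff]

theorem invSqrtCoeff_nonneg (k : ℕ) : 0 ≤ invSqrtCoeff k := by
  rw [invSqrtCoeff]
  positivity

theorem invSqrtCoeff_le_one (k : ℕ) : invSqrtCoeff k ≤ 1 := by
  rw [invSqrtCoeff, div_le_one (by positivity)]
  exact_mod_cast k.centralBinom_le_four_pow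

theorem succ_mul_invSqrtCoeff_succ (k : ℕ) :
    ((k : ℝ) + 1) * invSqrtCoeff (k + 1) = (k + 2⁻¹) * invSqrtCoeff k := by
  have h : ((k : ℝ) + 1) * (k + 1).centralBinom = 2 * (2 * k + 1) * k.centralBinom :=
    mod_cast k.succ_mul_centralBinom_succ
  rw [invSqrtCoeff, invSqrtCoeff, ← mul_div_assoc, h, pow_succ]
  field_simp
  ring

theorem sum_antidiagonal_invSqrtCoeff (n : ℕ) :
    ∑ p ∈ Finset.HasAntidiagonal.antidiagonal n, invSqrtCoeff p.1 * invSqrtCoeff p.2 = 1 := by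
  have symm : ∀ m : ℕ, ∑ p ∈ Finset.HasAntidiagonal.antidiagonal m, (p.1 : ℝ) * (invSqrtCoeff p.1 *
      invSqrtCoeff p.2) =
      m / 2 * ∑ p ∈ Finset.HasAntidiagonal.antidiagonal m, invSqrtCoeff p.1 * invSqrtCoeff p.2 := by
    intro m
    have h1 : ∑ p ∈ Finset.HasAntidiagonal.antidiagonal m, (p.1 : ℝ) * (invSqrtCoeff p.1 * invSqrtCoeff p.2) =
        ∑ p ∈ Finset.HasAntidiagonal.antidiagonal m, (p.2 : ℝ) * (invSqrtCoeff p.1 * invSqrtCoeff p.2) := by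
      rw [← Finset.Nat.sum_antidiagonal_swap]
      exact Finset.sum_congr rfl fun p _ ↦ by simp only [Prod.fst_swap, Prod.snd_swap]; ring
    have h2 : ∑ p ∈ Finset.HasAntidiagonal.antidiagonal m, (p.1 : ℝ) * (invSqrtCoeff p.1 * invSqrtCoeff p.2) +
        ∑ p ∈ Finset.HasAntidiagonal.antidiagonal m, (p.2 : ℝ) * (invSqrtCoeff p.1 * invSqrtCoeff p.2) =
        m * ∑ p ∈ Finset.HasAntidiagonal.antidiagonal m, invSqrtCoeff p.1 * invSqrtCoeff p.2 := by
      rw [← Finset.sum_add_distrib, Finset.mul_sum]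
      refine Finset.sum_congr rfl fun p hp ↦ ?_
      rw [← Finset.HasAntidiagonal.mem_antidiagonal.1 hp]
      push_cast
      ring
    linarith
  induction n with
  | zero => simp [invSqrtCoeff_zero]
  | succ n ih =>
    have h1 := symm (n + 1)
    rw [Finset.Nat.sum_antidiagonal_succ] at h1
    have h2 : ∑ p ∈ Finset.HasAntidiagonal.antidiagonal n, ((p.1 + 1 : ℕ) : ℝ) *
        (invSqrtCoeff (p.1 + 1) * invSqrtCoeff p.2) =
        ∑ p ∈ Finset.HasAntidiagonal.antidiagonal n, (p.1 : ℝ) * (invSqrtCoeff p.1 * invSqrtCoeff p.2) +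
        2⁻¹ * ∑ p ∈ Finset.HasAntidiagonal.antidiagonal n, invSqrtCoeff p.1 * invSqrtCoeff p.2 := by
      rw [Finset.mul_sum, ← Finset.sum_add_distrib]
      refine Finset.sum_congr rfl fun p _ ↦ ?_
      rw [← mul_assoc, Nat.cast_succ, succ_mul_invSqrtCoeff_succ]
      ring
    rw [h2, symm n, ih] at h1
    push_cast at h1
    have h3 : ((n : ℝ) + 1) / 2 ≠ 0 := by positivity
    refine mul_left_cancel₀ h3 ?_
    linarith

end Coefficients

section InvSqrt

variable {R : Type*} [Ring R] [Algebra ℝ R] [TopologicalSpace R]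

/-- The power series of `(1 - X) ^ (-1/2)`. -/
def invSqrtSeries (X : R) : R := ∑' k, invSqrtCoeff k • X ^ k

/-- The Cayley transform. -/
def cayley (B : R) : R := (1 - B) * Ring.inverse (1 + B)

/-- The inverse square root. -/
def invSqrt (B : R) : R := (1 + cayley B) * invSqrtSeries (cayley B * cayley B)

theorem map_ringInverse {R S F : Type*} [MonoidWithZero R] [MonoidWithZero S] [EquivLike F R S]
    [MulEquivClass F R S] (f : F) (a : R) : f (Ring.inverse a) = Ring.inverse (f a) := by
  by_cases h : IsUnit a
  · obtain ⟨u, rfl⟩ := h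
    have h1 : f (u : R) = (Units.map (f : R →* S) u : S) := rfl
    rw [Ring.inverse_unit, h1, Ring.inverse_unit]
    rfl
  · rw [Ring.inverse_non_unit _ h, Ring.inverse_non_unit _ (by rwa [isUnit_map_iff]), map_zero]

theorem map_cayley {S : Type*} [Ring S] [Algebra ℝ S] [TopologicalSpace S] (f : R ≃A[ℝ] S)
    (B : R) : f (cayley B) = cayley (f B) := by
  rw [cayley, cayley, map_mul, map_sub, map_ringInverse, map_add, map_one]

theorem map_invSqrt {S : Type*} [Ring S] [Algebra ℝ S] [TopologicalSpace S] [T2Space R] [T2Space S]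
    (f : R ≃A[ℝ] S) (B : R) : f (invSqrt B) = invSqrt (f B) := by
  have h : ∀ X, f (invSqrtSeries X) = invSqrtSeries (f X) := fun X ↦ by
    have h1 := f.toContinuousLinearEquiv.map_tsum (L := .unconditional ℕ) (f := fun k ↦ invSqrtCoeff k • X ^ k)
    refine h1.trans (tsum_congr fun k ↦ ?_)
    change f (invSqrtCoeff k • X ^ k) = _
    rw [map_smul, map_pow]
  rw [invSqrt, invSqrt, map_mul, map_add, map_one, h, map_mul, map_cayley]

variable [IsTopologicalRing R] [T2Space R]

theorem commute_invSqrtSeries {A X : R} (h : Commute A X) : Commute A (invSqrtSeries X) :=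
  Commute.tsum_right _ fun k ↦ (h.pow_right k).smul_right _

theorem commute_ringInverse {R : Type*} [MonoidWithZero R] {A B : R} (h : Commute A B) :
    Commute A (Ring.inverse B) := by
  by_cases hB : IsUnit B
  · obtain ⟨u, rfl⟩ := hB
    rw [Ring.inverse_unit]
    exact h.units_inv_right
  · rw [Ring.inverse_non_unit _ hB]
    exact Commute.zero_right A

omit [Algebra ℝ R] [TopologicalSpace R] [IsTopologicalRing R] [T2Space R] in
theorem commute_cayley {A B : R} (h : Commute A B) : Commute A (cayley B) :=
  ((Commute.one_right A).sub_right h).mul_right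
    (commute_ringInverse ((Commute.one_right A).add_right h))

theorem commute_invSqrt {A B : R} (h : Commute A B) : Commute A (invSqrt B) :=
  ((Commute.one_right A).add_right (commute_cayley h)).mul_right
    (commute_invSqrtSeries ((commute_cayley h).mul_right (commute_cayley h)))

end InvSqrt

section NormedInvSqrt

variable {R : Type*} [NormedRing R] [NormedAlgebra ℝ R] [CompleteSpace R]

omit [CompleteSpace R] in
theorem summable_norm_invSqrtSeries {X : R} (hX : ‖X‖ < 1) :
    Summable fun k ↦ ‖invSqrtCoeff k • X ^ k‖ := by
  refine Summable.of_nonneg_of_le (fun _ ↦ norm_nonneg _) (fun k ↦ ?_)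
    (summable_norm_geometric_of_norm_lt_one hX)
  rw [norm_smul, Real.norm_of_nonneg (invSqrtCoeff_nonneg k)]
  exact mul_le_of_le_one_left (norm_nonneg _) (invSqrtCoeff_le_one k)

theorem invSqrtSeries_mul_self {X : R} (hX : ‖X‖ < 1) :
    invSqrtSeries X * invSqrtSeries X * (1 - X) = 1 := by
  have h := summable_norm_invSqrtSeries hX
  rw [invSqrtSeries, tsum_mul_tsum_eq_tsum_sum_antidiagonal_of_summable_norm h h]
  refine Eq.trans (congrArg (· * (1 - X)) (tsum_congr fun n ↦ ?_)) (geom_series_mul_neg X hX)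
  conv_rhs => rw [← one_smul ℝ (X ^ n), ← sum_antidiagonal_invSqrtCoeff n, Finset.sum_smul]
  refine Finset.sum_congr rfl fun p hp ↦ ?_
  rw [smul_mul_smul_comm, ← pow_add, Finset.HasAntidiagonal.mem_antidiagonal.1 hp]

theorem contDiffAt_invSqrtSeries {X : R} (hX : ‖X‖ < 1) :
    ContDiffAt ℝ ∞ (invSqrtSeries : R → R) X := by
  let p : FormalMultilinearSeries ℝ R R := FormalMultilinearSeries.ofScalars R invSqrtCoeff
  have hr : ((1 : NNReal) : ENNReal) ≤ p.radius := by
    refine p.le_radius_of_bound (1 + ‖p 0‖) fun n ↦ ?_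
    rw [NNReal.coe_one, one_pow, mul_one]
    rcases Nat.eq_zero_or_pos n with rfl | hn
    · exact le_add_of_nonneg_left zero_le_one
    · refine (FormalMultilinearSeries.ofScalars_norm_le R invSqrtCoeff n hn).trans ?_
      rw [Real.norm_of_nonneg (invSqrtCoeff_nonneg n)]
      exact (invSqrtCoeff_le_one n).trans (le_add_of_nonneg_right (norm_nonneg _))
  have hp := p.hasFPowerSeriesOnBall (lt_of_lt_of_le (by simp) hr)
  have hs : p.sum = invSqrtSeries := FormalMultilinearSeries.ofScalarsSum_eq_tsum invSqrtCoeff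
  rw [← hs]
  refine (hp.analyticAt_of_mem ?_).contDiffAt
  refine lt_of_lt_of_le ?_ hr
  rw [edist_zero_right]
  exact_mod_cast hX

omit [NormedAlgebra ℝ R] [CompleteSpace R] in
theorem norm_mul_self_lt_one {Z : R} (hZ : ‖Z‖ < 1) : ‖Z * Z‖ < 1 :=
  (norm_mul_le Z Z).trans_lt (mul_lt_one_of_nonneg_of_lt_one_left (norm_nonneg _) hZ hZ.le)

theorem invSqrt_mul_self_mul {B : R} (hu : IsUnit (1 + B)) (hB : ‖cayley B‖ < 1) :
    invSqrt B * invSqrt B * B = 1 := by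
  set Z := cayley B with hZ
  have h1 : Z * (1 + B) = 1 - B := by
    rw [hZ, cayley, mul_assoc, Ring.inverse_mul_cancel _ hu, mul_one]
  have h2 : (1 + Z) * B = 1 - Z := by
    rw [mul_add, mul_one] at h1
    rw [add_mul, one_mul, eq_sub_iff_add_eq, add_assoc, add_comm (Z * B), h1]
    abel
  have hs := invSqrtSeries_mul_self (norm_mul_self_lt_one hB)
  have c1 : Commute (1 + Z) (invSqrtSeries (Z * Z)) :=
    commute_invSqrtSeries ((Commute.one_left _).add_left
      ((Commute.refl Z).mul_right (Commute.refl Z)))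
  have h3 : invSqrt B = invSqrtSeries (Z * Z) * (1 + Z) := c1
  calc invSqrt B * invSqrt B * B
      = invSqrtSeries (Z * Z) * (1 + Z) * (invSqrtSeries (Z * Z) * (1 + Z)) * B := by rw [h3]
    _ = invSqrtSeries (Z * Z) * ((1 + Z) * invSqrtSeries (Z * Z)) * ((1 + Z) * B) := by
        noncomm_ring
    _ = invSqrtSeries (Z * Z) * invSqrtSeries (Z * Z) * ((1 + Z) * (1 - Z)) := by
        rw [c1.eq, h2]; noncomm_ring
    _ = invSqrtSeries (Z * Z) * invSqrtSeries (Z * Z) * (1 - Z * Z) := by noncomm_ring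
    _ = 1 := hs

theorem contDiffAt_invSqrt {B : R} (hu : IsUnit (1 + B)) (hB : ‖cayley B‖ < 1) :
    ContDiffAt ℝ ∞ (invSqrt : R → R) B := by
  have h1 : ContDiffAt ℝ ∞ (cayley : R → R) B := by
    obtain ⟨u, hu⟩ := hu
    refine (contDiffAt_const.sub contDiffAt_id).mul ?_
    refine ContDiffAt.comp B (g := Ring.inverse) ?_ (contDiffAt_const.add contDiffAt_id)
    rw [← hu]
    exact contDiffAt_ringInverse ℝ u
  exact (contDiffAt_const.add h1).mul
    ((contDiffAt_invSqrtSeries (norm_mul_self_lt_one hB)).fun_comp B (h1.mul h1))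

end NormedInvSqrt

section PositiveOperators

theorem exists_linearEquiv_euclideanSpace {V : Type*} [AddCommGroup V] [Module ℝ V]
    [FiniteDimensional ℝ V] (G : V →ₗ[ℝ] V →ₗ[ℝ] ℝ) (hs : ∀ u v, G u v = G v u)
    (hG : ∀ v, v ≠ 0 → 0 < G v v) :
    ∃ T : V ≃ₗ[ℝ] EuclideanSpace ℝ (Fin (Module.finrank ℝ V)),
      ∀ u v, inner ℝ (T u) (T v) = G u v := by
  let core : InnerProductSpace.Core ℝ V :=
    { inner := fun u v ↦ G u v
      conj_inner_symm := fun u v ↦ hs v u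
      re_inner_nonneg := fun u ↦ by
        rcases eq_or_ne u 0 with rfl | hu
        · simp
        · exact (hG u hu).le
      add_left := fun u v w ↦ by simp
      smul_left := fun u v r ↦ by simp
      definite := fun u hu ↦ by
        by_contra hne
        exact (hG u hne).ne' hu }
  let _ : NormedAddCommGroup V := core.toNormedAddCommGroup
  let _ : InnerProductSpace ℝ V := InnerProductSpace.ofCore core.toCore
  exact ⟨(stdOrthonormalBasis ℝ V).repr.toLinearEquiv,
    fun u v ↦ (stdOrthonormalBasis ℝ V).repr.inner_map_map u v⟩

section Inner

variable {F : Type*} [NormedAddCommGroup F] [InnerProductSpace ℝ F] [FiniteDimensional ℝ F]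
  {B : F →L[ℝ] F}

theorem isUnit_one_add_of_inner_pos (hB : ∀ u, u ≠ 0 → 0 < inner ℝ (B u) u) :
    IsUnit (1 + B) := by
  have hinj : Function.Injective (1 + B : F →L[ℝ] F) := by
    refine (injective_iff_map_eq_zero _).2 fun u hu ↦ ?_
    by_contra hne
    have h1 : u + B u = 0 := hu
    have h2 := hB u hne
    have h3 : inner ℝ (u + B u) u = (0 : ℝ) := by rw [h1, inner_zero_left]
    rw [inner_add_left, real_inner_self_eq_norm_sq] at h3
    nlinarith [sq_nonneg ‖u‖]
  let e : F ≃ₗ[ℝ] F := LinearEquiv.ofInjectiveEndo (1 + B : F →L[ℝ] F).toLinearMap hinj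
  exact ⟨ContinuousLinearEquiv.toUnit e.toContinuousLinearEquiv, by ext; rfl⟩

theorem norm_cayley_lt_one (hB : ∀ u, u ≠ 0 → 0 < inner ℝ (B u) u) : ‖cayley B‖ < 1 := by
  have hu := isUnit_one_add_of_inner_pos hB
  have key : ∀ w : F, w ≠ 0 → ‖cayley B w‖ < ‖w‖ := by
    intro w hw
    set u := Ring.inverse (1 + B) w with hu'
    have hw' : u + B u = w := by
      have h1 := congrArg (fun T : F →L[ℝ] F ↦ T w) (Ring.mul_inverse_cancel _ hu)
      exact h1
    have hu0 : u ≠ 0 := by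
      intro h0
      rw [h0, map_zero, add_zero] at hw'
      exact hw hw'.symm
    have hZ : cayley B w = u - B u := rfl
    rw [hZ]
    refine lt_of_pow_lt_pow_left₀ 2 (norm_nonneg _) ?_
    rw [← hw', norm_sub_sq_real, norm_add_sq_real, real_inner_comm]
    linarith [hB u hu0]
  rcases subsingleton_or_nontrivial F with hF | hF
  · rw [Subsingleton.elim (cayley B) 0, norm_zero]
    exact one_pos
  · obtain ⟨w₀, hw₀, hmax⟩ := (isCompact_sphere (0 : F) 1).exists_isMaxOn
      (NormedSpace.sphere_nonempty.2 zero_le_one)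
      ((cayley B).continuous.norm.continuousOn)
    have h1 : ‖w₀‖ = 1 := by simpa using hw₀
    refine lt_of_le_of_lt (ContinuousLinearMap.opNorm_le_of_unit_norm (norm_nonneg _)
      fun w hw ↦ ?_) ((key w₀ (fun h ↦ by simp [h] at h1)).trans_eq h1)
    exact hmax (by simpa using hw)

end Inner

variable {E : Type*} [NormedAddCommGroup E] [NormedSpace ℝ E] [FiniteDimensional ℝ E]
  {G : E →L[ℝ] E →L[ℝ] ℝ} {B : E →L[ℝ] E}

theorem exists_conj_positive (hs : ∀ u v, G u v = G v u) (hG : ∀ v, v ≠ 0 → 0 < G v v)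
    (hB : ∀ u, u ≠ 0 → 0 < G (B u) u) :
    ∃ T : E ≃L[ℝ] EuclideanSpace ℝ (Fin (Module.finrank ℝ E)),
      IsUnit (1 + T.conjContinuousAlgEquiv B) ∧ ‖cayley (T.conjContinuousAlgEquiv B)‖ < 1 := by
  obtain ⟨T, hT⟩ := exists_linearEquiv_euclideanSpace
    ((ContinuousLinearMap.coeLM ℝ).comp G.toLinearMap) hs hG
  have hpos : ∀ u, u ≠ 0 →
      0 < inner ℝ (T.toContinuousLinearEquiv.conjContinuousAlgEquiv B u) u := by
    intro u hu
    have h1 := hB (T.symm u) (by simpa using hu)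
    have h2 : inner ℝ (T (B (T.symm u))) (T (T.symm u)) = G (B (T.symm u)) (T.symm u) := hT _ _
    rw [T.apply_symm_apply] at h2
    exact h1.trans_eq h2.symm
  exact ⟨T.toContinuousLinearEquiv, isUnit_one_add_of_inner_pos hpos, norm_cayley_lt_one hpos⟩

theorem invSqrt_mul_self_mul_of_pos (hs : ∀ u v, G u v = G v u) (hG : ∀ v, v ≠ 0 → 0 < G v v)
    (hB : ∀ u, u ≠ 0 → 0 < G (B u) u) : invSqrt B * invSqrt B * B = 1 := by
  obtain ⟨T, h1, h2⟩ := exists_conj_positive hs hG hB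
  have h3 : T.conjContinuousAlgEquiv (invSqrt B * invSqrt B * B) = 1 := by
    rw [map_mul, map_mul, map_invSqrt]
    exact invSqrt_mul_self_mul h1 h2
  exact T.conjContinuousAlgEquiv.toAlgEquiv.injective (h3.trans (map_one _).symm)

theorem contDiffAt_invSqrt_of_pos (hs : ∀ u v, G u v = G v u) (hG : ∀ v, v ≠ 0 → 0 < G v v)
    (hB : ∀ u, u ≠ 0 → 0 < G (B u) u) :
    ContDiffAt ℝ ∞ (invSqrt : (E →L[ℝ] E) → E →L[ℝ] E) B := by
  obtain ⟨T, h1, h2⟩ := exists_conj_positive hs hG hB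
  let f := T.conjContinuousAlgEquiv
  have h3 : (invSqrt : (E →L[ℝ] E) → E →L[ℝ] E) = fun X ↦ f.symm (invSqrt (f X)) := by
    ext1 X
    rw [← map_invSqrt]
    exact (f.symm_apply_apply _).symm
  rw [h3]
  have h4 := (contDiffAt_invSqrt h1 h2).fun_comp B
    (f.toContinuousLinearEquiv.contDiff.contDiffAt (x := B))
  exact (f.symm.toContinuousLinearEquiv.contDiff.contDiffAt).fun_comp B h4

end PositiveOperators

section ContactAlgebra

variable {E : Type*} [NormedAddCommGroup E] [NormedSpace ℝ E]

/-- The operator `-A² + η ⊗ ξ`. -/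
def contactSquare (A : E →L[ℝ] E) (η : E →L[ℝ] ℝ) (ξ : E) : E →L[ℝ] E := η.smulRight ξ - A * A

theorem contactSquare_apply (A : E →L[ℝ] E) (η : E →L[ℝ] ℝ) (ξ u : E) :
    contactSquare A η ξ u = η u • ξ - A (A u) := rfl

variable {G : E →L[ℝ] E →L[ℝ] ℝ} {A : E →L[ℝ] E} {η : E →L[ℝ] ℝ} {ξ : E}

theorem contactSquare_pos (hs : ∀ u v, G u v = G v u) (hG : ∀ v, v ≠ 0 → 0 < G v v)
    (hA : ∀ u v, G (A u) v = -G u (A v)) (hGξ : ∀ u, G u ξ = η u)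
    (hk : ∀ v, A v = 0 → η v = 0 → v = 0) (u : E) (hu : u ≠ 0) :
    0 < G (contactSquare A η ξ u) u := by
  have h1 : G (contactSquare A η ξ u) u = η u ^ 2 + G (A u) (A u) := by
    rw [contactSquare_apply, map_sub, map_smul, sub_apply, smul_apply, hA, hs ξ, hGξ, smul_eq_mul]
    ring
  rw [h1]
  by_cases h2 : A u = 0
  · have h3 : η u ≠ 0 := fun h3 ↦ hu (hk u h2 h3)
    have h4 : G (A u) (A u) = 0 := by rw [h2, map_zero]
    rw [h4, add_zero]
    positivity
  · have h3 := hG _ h2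
    positivity

theorem contact_identity [FiniteDimensional ℝ E] (hs : ∀ u v, G u v = G v u)
    (hG : ∀ v, v ≠ 0 → 0 < G v v)
    (hA : ∀ u v, G (A u) v = -G u (A v)) (hηξ : η ξ = 1) (hGξ : ∀ u, G u ξ = η u) (hAξ : A ξ = 0)
    (hk : ∀ v, A v = 0 → η v = 0 → v = 0) (v : E) :
    A (invSqrt (contactSquare A η ξ) (A (invSqrt (contactSquare A η ξ) v))) = -v + η v • ξ := by
  set B := contactSquare A η ξ with hB
  set R := invSqrt B with hR
  have hηA : ∀ v, η (A v) = 0 := fun v ↦ by rw [← hGξ, hA, hAξ, map_zero, neg_zero]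
  have hR1 : R * R * B = 1 :=
    invSqrt_mul_self_mul_of_pos hs hG (contactSquare_pos hs hG hA hGξ hk)
  have cAB : Commute A B := by
    change A * B = B * A
    ext v
    change A (η v • ξ - A (A v)) = η (A v) • ξ - A (A (A v))
    rw [hηA, zero_smul, map_sub, map_smul, hAξ, smul_zero]
  have cAR : ∀ v, A (R v) = R (A v) := fun v ↦
    congrArg (fun T : E →L[ℝ] E ↦ T v) (commute_invSqrt cAB).eq
  have cBR : ∀ v, B (R v) = R (B v) := fun v ↦
    congrArg (fun T : E →L[ℝ] E ↦ T v) (commute_invSqrt (Commute.refl B)).eq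
  have hBRR : ∀ v, B (R (R v)) = v := fun v ↦ by
    rw [cBR, cBR]
    exact congrArg (fun T : E →L[ℝ] E ↦ T v) hR1
  have hηB : ∀ v, η (B v) = η v := fun v ↦ by
    rw [hB, contactSquare_apply, map_sub, map_smul, hηA, hηξ, smul_eq_mul, mul_one, sub_zero]
  have hη : η (R (R v)) = η v := by rw [← hηB, hBRR]
  have h1 : η (R (R v)) • ξ - A (A (R (R v))) = v := hBRR v
  have h2 : A (R (A (R v))) = A (A (R (R v))) := by rw [cAR (R v)]
  rw [hη, sub_eq_iff_eq_add] at h1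
  rw [h2, h1, neg_add_cancel_left]

end ContactAlgebra

section LocalEnd

variable {E : Type*} [NormedAddCommGroup E] [NormedSpace ℝ E]
  {H : Type*} [TopologicalSpace H] {I : ModelWithCorners ℝ E H}
  {M : Type*} [TopologicalSpace M] [ChartedSpace H M] [IsManifold I ∞ M]

/-- The trivialization of the tangent bundle at `x₀` over `x`, with the fibre over `x` seen as the
model space. -/
def tangentCoordEquiv {x₀ x : M} (hx : x ∈ tangentDomain I x₀) : E ≃L[ℝ] E :=
  ContinuousLinearEquiv.equivOfInverse (M₁ := E) (M₂ := E) (tangentCoord I x₀ x)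
    (tangentCoordSymm I x₀ x) (tangentCoordSymm_coord hx) (tangentCoord_symm hx)

theorem localEnd_invSqrt {x₀ x : M} (hx : x ∈ tangentDomain I x₀)
    (B : ∀ x : M, TangentSpace I x →L[ℝ] TangentSpace I x) :
    localEnd (I := I) x₀ (fun y ↦ (invSqrt (B y : E →L[ℝ] E) : E →L[ℝ] E)) x =
      invSqrt (localEnd x₀ B x) :=
  map_invSqrt (tangentCoordEquiv (I := I) hx).conjContinuousAlgEquiv (B x : E →L[ℝ] E)

end LocalEnd

section Contact

variable {E : Type*} [NormedAddCommGroup E] [NormedSpace ℝ E] [FiniteDimensional ℝ E]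
  {H : Type*} [TopologicalSpace H] {I : ModelWithCorners ℝ E H}
  {M : Type*} [TopologicalSpace M] [ChartedSpace H M] [IsManifold I ∞ M]

theorem exists_reeb_field {n : ℕ} (hE : Module.finrank ℝ E = 2 * n + 1) (β : SmoothTwoForm I M)
    (η : SmoothOneForm I M) (key : ∀ x v, (∀ u, β.toSection x v u = 0) → η x v = 0 → v = 0) :
    ∃ ξ : SmoothVectorField I M, ∀ x, (∀ u, β.toSection x (ξ x) u = 0) ∧ η x (ξ x) = 1 := by
  have nd : ∀ x v, (∀ u, (β.toSection x + (η x).smulRight (η x)) v u = 0) → v = 0 := by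
    intro x v hv
    have hv' : ∀ u, β.toSection x v u + η x v * η x u = 0 := hv
    have h1 := hv' v
    rw [β.alternating, zero_add, mul_self_eq_zero] at h1
    refine key x v (fun u ↦ ?_) h1
    have h2 := hv' u
    rwa [h1, zero_mul, add_zero] at h2
  let Φ : ∀ x : M, TangentSpace I x ≃L[ℝ] (TangentSpace I x →L[ℝ] ℝ) := fun x ↦
    bilinEquiv (E := E) (β.toSection x + (η x).smulRight (η x)) (nd x)
  have hframe : ∀ (x : M) (u : E), ContMDiffAt I (I.prod 𝓘(ℝ, E)) ∞
      (fun y ↦ TotalSpace.mk' E y (tangentFrame I x u y)) x := fun x u ↦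
    contMDiffAt_tangentFrame x u (mem_baseSet_trivializationAt E _ x)
  refine ⟨⟨fun x ↦ (Φ x).symm (η x), fun x ↦ ?_⟩, fun x ↦ ?_⟩
  · refine contMDiffAt_symm_apply (V := fun x : M ↦ TangentSpace I x →L[ℝ] ℝ) (Φ := Φ) ?_
      (η.contMDiff x)
    exact contMDiffAt_bilin_of_tangentFrame
      (B := fun x ↦ β.toSection x + (η x).smulRight (η x)) fun u v ↦
      (contMDiffAt_bilin_apply (b := id) (I' := I) (v := tangentFrame I x u)
        (w := tangentFrame I x v) (β.toSection.contMDiff x) (hframe x u) (hframe x v)).add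
      ((contMDiffAt_oneForm_apply (b := id) (I' := I) (v := tangentFrame I x u)
        (η.contMDiff x) (hframe x u)).mul
      (contMDiffAt_oneForm_apply (b := id) (I' := I) (v := tangentFrame I x v)
        (η.contMDiff x) (hframe x v)))
  · obtain ⟨-, ξ, h1, h2⟩ := exists_reeb_of_wedge_ne_zero hE β η x (key x)
    have h3 : Φ x ξ = η x := by
      ext u
      change β.toSection x ξ u + η x ξ * η x u = η x u
      rw [h1, h2, one_mul, zero_add]
    have h4 : (Φ x).symm (η x) = ξ := by rw [← h3, ContinuousLinearEquiv.symm_apply_apply]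
    change (∀ u, β.toSection x ((Φ x).symm (η x)) u = 0) ∧ η x ((Φ x).symm (η x)) = 1
    rw [h4]
    exact ⟨h1, h2⟩

theorem exists_adapted_metric [T2Space M] [SigmaCompactSpace M] (η : SmoothOneForm I M)
    (ξ : SmoothVectorField I M) (h : ∀ x, η x (ξ x) = 1) :
    ∃ g : SmoothMetric I M, ∀ x u, g.inner x u (ξ x) = η x u := by
  obtain ⟨g⟩ := exists_smoothMetric (I := I) (M := M)
  let P : ∀ x : M, TangentSpace I x →L[ℝ] TangentSpace I x := fun x ↦
    ContinuousLinearMap.id ℝ (TangentSpace I x) - (η x).smulRight (ξ x)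
  have hP : ∀ x u, P x u = u - η x u • ξ x := fun _ _ ↦ rfl
  let G : ∀ x : M, TangentSpace I x →L[ℝ] TangentSpace I x →L[ℝ] ℝ := fun x ↦
    ((ContinuousLinearMap.precomp ℝ (P x)).comp (g.inner x)).comp (P x) +
      (η x).smulRight (η x)
  have hG : ∀ x u v, G x u v = g.inner x (P x u) (P x v) + η x u * η x v := fun _ _ _ ↦ rfl
  have pos : ∀ x v, v ≠ 0 → 0 < G x v v := by
    intro x v hv
    rw [hG]
    by_cases h1 : P x v = 0
    · have h2 : η x v ≠ 0 := fun h2 ↦ hv (by rwa [hP, h2, zero_smul, sub_zero] at h1)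
      rw [h1, map_zero]
      have h3 : 0 < η x v * η x v := mul_self_pos.2 h2
      exact h3.trans_eq (zero_add _).symm
    · exact add_pos_of_pos_of_nonneg (g.pos x _ h1) (mul_self_nonneg _)
  have hframe : ∀ (x : M) (u : E), ContMDiffAt I (I.prod 𝓘(ℝ, E)) ∞
      (fun y ↦ TotalSpace.mk' E y (tangentFrame I x u y)) x := fun x u ↦
    contMDiffAt_tangentFrame x u (mem_baseSet_trivializationAt E _ x)
  have hη : ∀ (x : M) (u : E), ContMDiffAt I 𝓘(ℝ, ℝ) ∞
      (fun y ↦ η y (tangentFrame I x u y)) x := fun x u ↦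
    contMDiffAt_oneForm_apply (b := id) (I' := I) (v := tangentFrame I x u)
        (η.contMDiff x) (hframe x u)
  have hPf : ∀ (x : M) (u : E), ContMDiffAt I (I.prod 𝓘(ℝ, E)) ∞
      (fun y ↦ TotalSpace.mk' E y (P y (tangentFrame I x u y))) x := fun x u ↦
    (hframe x u).sub_section ((hη x u).smul_section (ξ.contMDiff x))
  refine ⟨⟨G, fun x u v ↦ ?_, pos, fun x ↦ isVonNBounded_of_pos (E := E) (G x) (pos x), fun x ↦
    contMDiffAt_bilin_of_tangentFrame fun u v ↦ ?_⟩, fun x u ↦ ?_⟩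
  · rw [hG, hG, g.symm, mul_comm]
  · exact (contMDiffAt_bilin_apply (b := id) (I' := I) (v := fun y ↦ P y (tangentFrame I x u y))
      (w := fun y ↦ P y (tangentFrame I x v y)) (g.contMDiff x) (hPf x u) (hPf x v)).add
      ((hη x u).mul (hη x v))
  · change G x u (ξ x) = _
    rw [hG, hP x (ξ x), h, one_smul, sub_self, map_zero, mul_one, zero_add]

theorem hasAlmostContactStructure_of_cosymplectic [T2Space M] [SigmaCompactSpace M] {n : ℕ}
    (hE : Module.finrank ℝ E = 2 * n + 1) (h : HasAlmostCosymplecticStructure I M n) :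
    HasAlmostContactStructure I M := by
  obtain ⟨β, η, h⟩ := h
  have key : ∀ x v, (∀ u, β.toSection x v u = 0) → η x v = 0 → v = 0 := fun x ↦
    (wedge_ne_zero_iff hE β η x).1 (h x)
  obtain ⟨ξ, hξ⟩ := exists_reeb_field hE β η key
  obtain ⟨g, hg⟩ := exists_adapted_metric η ξ fun x ↦ (hξ x).2
  obtain ⟨A, hA, -⟩ := exists_endomorphismField g β
  have skewA : ∀ x u v, g.inner x (A x u) v = -g.inner x u (A x v) := fun x u v ↦ by
    rw [hA, g.symm, hA, β.skew]
  have hAξ : ∀ x, A x (ξ x) = 0 := fun x ↦ nondegenerate_metric g x _ fun u ↦ by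
    rw [hA, (hξ x).1]
  have hk : ∀ x v, A x v = 0 → η x v = 0 → v = 0 := fun x v h1 h2 ↦ key x v (fun u ↦ by
    rw [← hA, h1, map_zero]
    rfl) h2
  let B : ∀ x : M, TangentSpace I x →L[ℝ] TangentSpace I x := fun x ↦
    contactSquare (E := E) (A x) (η x) (ξ x)
  let R : ∀ x : M, TangentSpace I x →L[ℝ] TangentSpace I x := fun x ↦
    (invSqrt (B x : E →L[ℝ] E) : E →L[ℝ] E)
  have pos : ∀ x u, u ≠ 0 → 0 < g.inner x (B x u) u := fun x ↦
    contactSquare_pos (E := E) (G := g.inner x) (g.symm x) (g.pos x) (skewA x) (hg x) (hk x)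
  refine ⟨⟨fun x ↦ (A x).comp (R x), fun x ↦ contMDiffAt_hom_of_tangentFrame fun u ↦ ?_⟩, ξ, η,
    fun x ↦ ⟨(hξ x).2, fun v ↦ ?_⟩⟩
  · have hx := mem_tangentDomain (I := I) x
    have cA := contMDiffAt_localEnd hx A
    have cη := contMDiffAt_localOneForm hx η
    have cξ := (contMDiffAt_tangentCoord_iff hx).2 (ξ.contMDiff x)
    have hBl : ∀ y ∈ tangentDomain I x, localEnd x B y =
        contactSquare (localEnd x (fun y ↦ A y) y) (localOneForm x (fun y ↦ η y) y)
          (tangentCoord I x y (ξ y)) := by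
      intro y hy
      ext u
      have h1 : B y (tangentCoordSymm I x y u) = η y (tangentCoordSymm I x y u) • ξ y -
          A y (A y (tangentCoordSymm I x y u)) := rfl
      rw [localEnd_apply, contactSquare_apply, localEnd_apply, localEnd_apply, localOneForm_apply,
        tangentCoordSymm_coord hy, h1, map_sub, map_smul]
    have cB : ContMDiffAt I 𝓘(ℝ, E →L[ℝ] E) ∞ (localEnd x B) x := by
      refine ContMDiffAt.congr_of_eventuallyEq (contMDiffAt_clm_of_apply fun u ↦ ?_)
        (Filter.eventually_of_mem ((isOpen_tangentDomain x).mem_nhds hx) hBl)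
      exact ((cη.clm_apply (contMDiffAt_const (c := u))).smul cξ).sub
        (cA.clm_apply (cA.clm_apply (contMDiffAt_const (c := u))))
    have cR : ContMDiffAt I 𝓘(ℝ, E →L[ℝ] E) ∞ (fun y ↦ invSqrt (localEnd x B y)) x := by
      refine ContMDiffAt.comp x (g := (invSqrt : (E →L[ℝ] E) → E →L[ℝ] E))
        (ContDiffAt.contMDiffAt ?_) cB
      refine contDiffAt_invSqrt_of_pos (G := localBilin x (fun y ↦ g.inner y) x)
        (fun u v ↦ g.symm x _ _) (fun v hv ↦ g.pos x _ fun h0 ↦ hv ?_) fun v hv ↦ ?_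
      · exact (tangentCoord_symm hx v).symm.trans
          ((congrArg (tangentCoord I x x) h0).trans (map_zero _))
      · rw [localBilin_apply, localEnd_apply, tangentCoordSymm_coord hx]
        refine pos x _ fun h0 ↦ hv ?_
        exact (tangentCoord_symm hx v).symm.trans
          ((congrArg (tangentCoord I x x) h0).trans (map_zero _))
    refine (contMDiffAt_tangentCoord_iff hx).1 ?_
    refine (cA.clm_apply (cR.clm_apply (contMDiffAt_const (c := u)))).congr_of_eventuallyEq ?_
    filter_upwards [(isOpen_tangentDomain x).mem_nhds hx] with y hy
    rw [← localEnd_invSqrt hy, localEnd_apply]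
    exact congrArg (fun w ↦ tangentCoord I x y (A y w)) (tangentCoordSymm_coord hy _).symm
  · exact contact_identity (E := E) (G := g.inner x) (g.symm x) (g.pos x) (skewA x) (hξ x).2 (hg x)
      (hAξ x) (hk x) v

end Contact

theorem mainTheorem6 (n : ℕ) (M : Type*) [TopologicalSpace M] [T2Space M]
    [SecondCountableTopology M] [ChartedSpace (EuclideanSpace ℝ (Fin (2 * n + 1))) M]
    [IsManifold (𝓡 (2 * n + 1)) ∞ M]
    (hM : IsOrientableManifold (EuclideanSpace ℝ (Fin (2 * n + 1))) M) :
    List.TFAE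
      [HasSkewGaugeSolution (𝓡 (2 * n + 1)) M (2 * n),
       HasAlmostCosymplecticStructure (𝓡 (2 * n + 1)) M n,
       HasAlmostContactStructure (𝓡 (2 * n + 1)) M,
       HasAlmostSymplecticStructure ((𝓡 (2 * n + 1)).prod 𝓘(ℝ, ℝ)) (M × ℝ),
       HasSkewGaugeSolution ((𝓡 (2 * n + 1)).prod 𝓘(ℝ, ℝ)) (M × ℝ) (2 * n + 2)] := by
  have : LocallyCompactSpace M :=
    ChartedSpace.locallyCompactSpace (EuclideanSpace ℝ (Fin (2 * n + 1))) M
  have hE : Module.finrank ℝ (EuclideanSpace ℝ (Fin (2 * n + 1))) = 2 * n + 1 :=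
    finrank_euclideanSpace_fin
  have hW : Module.finrank ℝ (EuclideanSpace ℝ (Fin (2 * n + 1)) × ℝ) = 2 * n + 2 := by
    rw [Module.finrank_prod, hE, Module.finrank_self]
  tfae_have 1 → 2 := hasAlmostCosymplecticStructure_of_gauge hE hM
  tfae_have 2 → 1 := hasSkewGaugeSolution_of_cosymplectic hE
  tfae_have 2 → 3 := hasAlmostContactStructure_of_cosymplectic hE
  tfae_have 3 → 2 := hasAlmostCosymplecticStructure_of_contact hE
  tfae_have 2 → 4 := hasAlmostSymplecticStructure_cylinder hE
  tfae_have 4 → 2 := hasAlmostCosymplecticStructure_of_cylinder hE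
  tfae_have 4 → 5 := fun h ↦ hW ▸ hasSkewGaugeSolution_of_symplectic h
  tfae_have 5 → 4 := fun h ↦ hasAlmostSymplecticStructure_of_gauge (hW.symm ▸ h)
  tfae_finish
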